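/- Let $\Bbbk=\bigcup_{n\ge1}\mathbb C(q^{1/n})$ be the extension of $\mathbb C(q)$ by all fractional powers of $q$, let $(a_{ij})$ be an $r\times r$ Cartan matrix of finite type, and let $d_1,\dots,d_r$ be positive integers with $d_ia_{ij}=d_ja_{ji}$. Put $[k]_i=\frac{q^{kd_i}-q^{-kd_i}}{q^{d_i}-q^{-d_i}}$ and $[k]_i!=[1]_i\cdots[k]_i$. Let $U$ be the quantized universal enveloping algebra of simply connected type: the $\Bbbk$-algebra generated by $t_i^{\pm1},e_i,f_i$ ($1\le i\le r$), where the $t_i$ are invertible and commute with each other, with the relations $$t_ie_jt_i^{-1}=q^{d_i\delta_{ij}}e_j,\quad t_if_jt_i^{-1}=q^{-d_i\delta_{ij}}f_j,\quad e_if_j-f_je_i=\delta_{ij}\frac{k_i-k_i^{-1}}{q^{d_i}-q^{-d_i}},\qquad k_i=\prod_jt_j^{a_{ji}},$$ $$\sum_{m=0}^{1-a_{ij}}\frac{(-1)^m}{[m]_i!\,[1-a_{ij}-m]_i!}\,x_i^mx_jx_i^{1-a_{ij}-m}=0\qquad(i\ne j;\ x=e\text{ and }x=f).$$ It is a Hopf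 algebra with $\Delta(t_i)=t_i\otimes t_i$, $\Delta(e_i)=e_i\otimes1+k_i\otimes e_i$, $\Delta(f_i)=f_i\otimes k_i^{-1}+1\otimes f_i$, counit $\varepsilon(t_i)=1$, $\varepsilon(e_i)=\varepsilon(f_i)=0$, and antipode $\sigma(t_i)=t_i^{-1}$, $\sigma(e_i)=-k_i^{-1}e_i$, $\sigma(f_i)=-f_ik_i$. Let $\theta$ be its algebra automorphism $e_i\mapsto-f_i$, $f_i\mapsto-e_i$, $t_i\mapsto t_i^{-1}$. Let $U^+$, $U^-$, $U^0$ be the subalgebras generated by the $e_i$, by the $f_i$, and by the $t_i^{\pm1}$, and let $x\mapsto(x)_0$ be the projection of $U$ onto $U^0$ along $U^-_-U+U\,U^+_+$, where $U^\pm_\pm=\ker\varepsilon|_{U^\pm}$. Let $\mathfrak h$ be the Cartan subalgebra over $\mathbb Q$ and write $\mu=\sum_i\mu_i\alpha_i\in\mathfrak h^*$ with $\mu_i\in\mathbb Q$, where the $\alpha_i$ are the simple roots. Let $q^\mu:U^0\to\Bbbk$ be the character $t_i\mapsto q^{d_i\mu_i}$, and for a $U$-module $V$ let $V[\mu]=\{v\in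 V: tv=q^\mu(t)v\text{ for all }t\text{ in the group generated by the }t_i\}$. A $U$-module is admissible if it is the direct sum of its weight subspaces and these are finite-dimensional. Let $F$ be the quantized coordinate ring: the span in $U^*$ of the matrix coefficients of the finite-dimensional admissible $U$-modules, with the left regular action $(af)(x)=f(xa)$. Fix $\lambda\in\mathfrak h^*$. Let $L(\lambda)$ be the irreducible $U$-module with highest weight $\lambda$, and $\bar{\mathbf 1}_\lambda$ its highest weight vector (the image of the generator of the Verma module). Let $$\pi_\lambda(x\otimes y)=q^\lambda\big((\sigma(x)y)_0\big)\qquad(x\in U^+,\ y\in U^-),$$ $$K_\lambda=\{y\in U^-:\pi_\lambda(x\otimes y)=0\ \ \forall x\in U^+\},\qquad \widetilde K_\lambda=\{x\in U^+:\pi_\lambda(x\otimes y)=0\ \ \forall y\in U^-\}.$$ **Theorem 5.** One has $\widetilde K_\lambda=\theta(K_\lambda)$. For every $\varphi\in\operatorname{Hom}_U(L(\lambda),L(\lambda)\otimes F)$ there is exactly one $f_\varphi\in F$ such that $\varphi(\bar{\mathbf 1}_\lambda)-\bar{\mathbf 1}_\lambda\otimes f_\varphi$ lies in $\sum_{\mu<\lambda}L(\lambda)[\mu]\otimes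 F$ (the sum being over $\mu=\lambda-\beta$ with $\beta\neq0$ a sum of simple roots), and $f_\varphi\in F[0]$. The map $\Theta:\operatorname{Hom}_U(L(\lambda),L(\lambda)\otimes F)\to F[0]$, $\varphi\mapsto f_\varphi$, is linear and injective, and its image is $$F[0]^{K_\lambda+\widetilde K_\lambda}=\{f\in F[0]: yf=0\ \ \forall y\in K_\lambda,\ \ xf=0\ \ \forall x\in\widetilde K_\lambda\}.$$ -/

import Mathlib

open scoped TensorProduct

noncomputable section

namespace QKostant

/-! ## The ground field -/

/-- The ground field: the field of fractions of the group algebra `ℂ[ℚ]`, whose basis element of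
exponent `s` is `q ^ s`. It is the union of the fields `ℂ(q ^ (1 / n))`, that is, the extension of
`ℂ(q)` by all fractional powers of `q`. -/
def QField : Type := FractionRing (AddMonoidAlgebra ℂ ℚ)

instance : Field QField := inferInstanceAs (Field (FractionRing (AddMonoidAlgebra ℂ ℚ)))

instance : Algebra (AddMonoidAlgebra ℂ ℚ) QField :=
  inferInstanceAs (Algebra (AddMonoidAlgebra ℂ ℚ) (FractionRing (AddMonoidAlgebra ℂ ℚ)))

instance : IsFractionRing (AddMonoidAlgebra ℂ ℚ) QField :=
  inferInstanceAs (IsFractionRing (AddMonoidAlgebra ℂ ℚ) (FractionRing (AddMonoidAlgebra ℂ ℚ)))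

/-- The element `q ^ s` of the ground field, for a rational exponent `s`. -/
def qpow (s : ℚ) : QField :=
  algebraMap (AddMonoidAlgebra ℂ ℚ) QField (AddMonoidAlgebra.single s 1)

theorem qpow_zero : qpow 0 = 1 := by
  rw [qpow, ← AddMonoidAlgebra.one_def, map_one]

theorem qpow_add (s t : ℚ) : qpow (s + t) = qpow s * qpow t := by
  rw [qpow, qpow, qpow, ← map_mul, AddMonoidAlgebra.single_mul_single, one_mul]

theorem qpow_mul_neg (s : ℚ) : qpow s * qpow (-s) = 1 := by
  rw [← qpow_add, add_neg_cancel, qpow_zero]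

theorem qpow_ne_zero (s : ℚ) : qpow s ≠ 0 := by
  intro h
  have := qpow_mul_neg s
  rw [h, zero_mul] at this
  exact zero_ne_one this

theorem qpow_injective : Function.Injective qpow := by
  intro s t h
  have h1 := IsFractionRing.injective (AddMonoidAlgebra ℂ ℚ) QField h
  by_contra hne
  have h2 := congrArg (fun x : AddMonoidAlgebra ℂ ℚ => x.coeff s) h1
  simp [Ne.symm hne, AddMonoidAlgebra.coeff_single] at h2

/-- The quantum integer `[k]_i` for `d = d_i`. -/
def qint (d k : ℕ) : QField :=
  (qpow (k * d) - qpow (-(k * d))) / (qpow d - qpow (-d))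

/-- The quantum factorial `[k]_i!` for `d = d_i`. -/
def qfact (d k : ℕ) : QField := ∏ j ∈ Finset.range k, qint d (j + 1)

theorem qpow_sub_ne_zero {s : ℚ} (hs : 0 < s) : qpow s - qpow (-s) ≠ 0 := by
  intro h
  have := qpow_injective (sub_eq_zero.mp h)
  linarith

theorem qint_ne_zero {d : ℕ} (hd : 0 < d) (k : ℕ) : qint d (k + 1) ≠ 0 := by
  have hd' : (0 : ℚ) < d := by exact_mod_cast hd
  refine div_ne_zero ?_ (qpow_sub_ne_zero hd')
  exact qpow_sub_ne_zero (by positivity)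

theorem qfact_ne_zero {d : ℕ} (hd : 0 < d) (k : ℕ) : qfact d k ≠ 0 :=
  Finset.prod_ne_zero_iff.mpr fun j _ => qint_ne_zero hd j

theorem qfact_succ (d k : ℕ) : qfact d (k + 1) = qint d (k + 1) * qfact d k := by
  rw [qfact, Finset.prod_range_succ, mul_comm, qfact]

theorem qint_zero (d : ℕ) : qint d 0 = 0 := by simp [qint]

theorem qint_split (d m l : ℕ) :
    qint d (m + l) = qpow (-(l * d)) * qint d m + qpow (m * d) * qint d l := by
  have h1 : qpow (((m + l : ℕ) : ℚ) * d) = qpow (m * d) * qpow (l * d) := by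
    rw [← qpow_add]; push_cast; ring_nf
  have h2 : qpow (-(((m + l : ℕ) : ℚ) * d)) = qpow (-(l * d)) * qpow (-(m * d)) := by
    rw [← qpow_add]; push_cast; ring_nf
  rw [qint, qint, qint, h1, h2]
  ring

/-! ## Cartan data -/

/-- A Cartan matrix `A` of finite type of size `r`, together with positive integers `d i`
that symmetrize it. Finite type means that the symmetrized matrix `(d i * A i j)` is positive
definite. The entry `A i j` is `⟨α_j, α_i^∨⟩`. -/
structure CartanDatum (r : ℕ) where
  /-- the Cartan matrix -/
  A : Matrix (Fin r) (Fin r) ℤ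
  /-- the symmetrizing integers -/
  d : Fin r → ℕ
  diag : ∀ i, A i i = 2
  offDiag : ∀ i j, i ≠ j → A i j ≤ 0
  d_pos : ∀ i, 0 < d i
  symm : ∀ i j, (d i : ℤ) * A i j = d j * A j i
  finiteType : (Matrix.of fun i j => ((d i * A i j : ℤ) : ℝ)).PosDef

variable {r : ℕ} (D : CartanDatum r)

/-- The exponents of `k_i = ∏ j, t_j ^ (a_{ji})`. -/
def CartanDatum.kExp (i : Fin r) : Fin r → ℤ := fun j => D.A j i

/-- The exponent `∑ a_i d_i μ_i` of the power of `q` by which the torus element `∏ t_i ^ (a i)`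
acts on a vector of weight `μ = ∑ μ_i α_i`. -/
def CartanDatum.pair (a : Fin r → ℤ) (μ : Fin r → ℚ) : ℚ := ∑ i, (a i : ℚ) * D.d i * μ i

section Serre

variable {B : Type*} [Ring B] [Algebra QField B]

/-- The left-hand side of the quantum Serre relation of degree `N` in `x` and `1` in `y`. -/
def serre (d N : ℕ) (x y : B) : B :=
  ∑ m ∈ Finset.range (N + 1),
    ((-1 : QField) ^ m / (qfact d m * qfact d (N - m))) • (x ^ m * y * x ^ (N - m))

end Serre

/-- The defining relations of the quantized enveloping algebra of simply connected type, for
elements `κ a` (standing for `∏ t_i ^ (a i)`), `e i`, `f i` of an algebra `B`. -/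
structure QRel {B : Type*} [Ring B] [Algebra QField B]
    (κ : (Fin r → ℤ) → B) (e f : Fin r → B) : Prop where
  K_zero : κ 0 = 1
  K_add : ∀ a b, κ (a + b) = κ a * κ b
  K_e : ∀ a j, κ a * e j = qpow (a j * D.d j) • (e j * κ a)
  K_f : ∀ a j, κ a * f j = qpow (-(a j * D.d j)) • (f j * κ a)
  e_f : ∀ i j, e i * f j - f j * e i =
    if i = j then (qpow (D.d i) - qpow (-(D.d i)))⁻¹ • (κ (D.kExp i) - κ (-D.kExp i)) else 0
  serre_e : ∀ i j, i ≠ j → serre (D.d i) (1 - D.A i j).toNat (e i) (e j) = 0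
  serre_f : ∀ i j, i ≠ j → serre (D.d i) (1 - D.A i j).toNat (f i) (f j) = 0

section SerreLemmas

variable {B : Type*} [Ring B] [Algebra QField B]

/-- Auxiliary deformation of the quantum Serre expression. -/
def serreAux (d N : ℕ) (z : QField) (x y : B) : B :=
  ∑ m ∈ Finset.range (N + 1),
    ((-z) ^ (N - m) / (qfact d m * qfact d (N - m))) • (x ^ m * y * x ^ (N - m))

theorem serre_eq_aux (d N : ℕ) (x y : B) :
    serre d N x y = ((-1 : QField) ^ N) • serreAux d N 1 x y := by
  rw [serre, serreAux, Finset.smul_sum]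
  refine Finset.sum_congr rfl fun m hm => ?_
  have hm' : m ≤ N := Nat.lt_succ_iff.mp (Finset.mem_range.mp hm)
  obtain ⟨l, rfl⟩ := Nat.exists_eq_add_of_le hm'
  have h1 : (-1 : QField) ^ (m + l) * (-1) ^ l = (-1) ^ m := by
    rw [pow_add, mul_assoc, ← mul_pow]; simp
  rw [smul_smul, Nat.add_sub_cancel_left, ← mul_div_assoc, h1]

theorem serreAux_zero (d : ℕ) (z : QField) (x y : B) : serreAux d 0 z x y = y := by
  simp [serreAux, qfact]

theorem serreAux_succ {d : ℕ} (hd : 0 < d) (N : ℕ) (z : QField) (x y : B) :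
    qint d (N + 1) • serreAux d (N + 1) z x y =
      x * serreAux d N (qpow (-d) * z) x y -
        (qpow (N * d) * z) • (serreAux d N (qpow (-d) * z) x y * x) := by
  have key : qint d (N + 1) • serreAux d (N + 1) z x y =
      ∑ m ∈ Finset.range (N + 1 + 1),
        (qpow (-((N + 1 - m : ℕ) * d)) * qint d m *
          ((-z) ^ (N + 1 - m) / (qfact d m * qfact d (N + 1 - m)))) •
            (x ^ m * y * x ^ (N + 1 - m)) +
      ∑ m ∈ Finset.range (N + 1 + 1),
        (qpow (m * d) * qint d (N + 1 - m) *
          ((-z) ^ (N + 1 - m) / (qfact d m * qfact d (N + 1 - m)))) •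
            (x ^ m * y * x ^ (N + 1 - m)) := by
    rw [serreAux, Finset.smul_sum, ← Finset.sum_add_distrib]
    refine Finset.sum_congr rfl fun m hm => ?_
    have hm' : m ≤ N + 1 := Nat.lt_succ_iff.mp (Finset.mem_range.mp hm)
    have := qint_split d m (N + 1 - m)
    rw [Nat.add_sub_cancel' hm'] at this
    rw [this, ← add_smul, smul_smul]
    congr 1
    ring
  rw [key, Finset.sum_range_succ', Finset.sum_range_succ (n := N + 1)]
  simp only [qint_zero, Nat.sub_self, mul_zero, zero_mul, zero_smul, add_zero]
  rw [sub_eq_add_neg]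
  congr 1
  · rw [serreAux, Finset.mul_sum]
    refine Finset.sum_congr rfl fun m hm => ?_
    have hm' : m ≤ N := Nat.lt_succ_iff.mp (Finset.mem_range.mp hm)
    obtain ⟨l, rfl⟩ := Nat.exists_eq_add_of_le hm'
    have e1 : m + l + 1 - (m + 1) = l := by omega
    rw [e1, Nat.add_sub_cancel_left, mul_smul_comm, ← mul_assoc, ← mul_assoc, ← pow_succ']
    congr 1
    have h1 := qint_ne_zero hd m
    have h2 := qfact_ne_zero hd m
    have h3 := qfact_ne_zero hd l
    have h4 : qpow (-((l : ℚ) * d)) = qpow (-d) ^ l := by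
      clear h1 h2 h3 e1 hm hm' key
      induction l with
      | zero => simp [qpow_zero]
      | succ l ih =>
        rw [pow_succ, ← ih, ← qpow_add]; push_cast; ring_nf
    rw [h4, qfact_succ]
    field_simp
    ring
  · rw [serreAux, Finset.sum_mul, Finset.smul_sum, ← Finset.sum_neg_distrib]
    refine Finset.sum_congr rfl fun m hm => ?_
    have hm' : m ≤ N := Nat.lt_succ_iff.mp (Finset.mem_range.mp hm)
    obtain ⟨l, rfl⟩ := Nat.exists_eq_add_of_le hm'
    have e1 : m + l + 1 - m = l + 1 := by omega
    rw [e1, Nat.add_sub_cancel_left, smul_mul_assoc, smul_smul, mul_assoc _ (x ^ l) x,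
      ← pow_succ, ← neg_smul]
    congr 1
    have h1 := qint_ne_zero hd l
    have h2 := qfact_ne_zero hd m
    have h3 := qfact_ne_zero hd l
    have h4 : qpow (((m + l : ℕ) : ℚ) * d) * qpow (-d) ^ l = qpow (m * d) := by
      clear h1 h2 h3 e1 hm hm' key
      induction l with
      | zero => simp
      | succ l ih =>
        rw [← ih, pow_succ]
        have : qpow (((m + (l + 1) : ℕ) : ℚ) * d) = qpow (((m + l : ℕ) : ℚ) * d) * qpow d := by
          rw [← qpow_add]; push_cast; ring_nf
        rw [this]
        linear_combination (qpow (((m + l : ℕ) : ℚ) * d) * qpow (-d) ^ l) * qpow_mul_neg (d : ℚ)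
    rw [← h4, qfact_succ]
    field_simp
    ring

theorem serreAux_ext {d : ℕ} (hd : 0 < d) (N : ℕ) {u v : B}
    (h : qint d (N + 1) • u = qint d (N + 1) • v) : u = v :=
  smul_right_injective B (qint_ne_zero hd N) h

/-- An element that `q`-commutes with `x` and `y` does so with the Serre expression. -/
theorem serreAux_comm {d : ℕ} (hd : 0 < d) {x y b : B} {s u : QField}
    (hx : b * x = s • (x * b)) (hy : b * y = u • (y * b)) (N : ℕ) (z : QField) :
    b * serreAux d N z x y = (s ^ N * u) • (serreAux d N z x y * b) := by
  induction N generalizing z with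
  | zero => simpa [serreAux_zero] using hy
  | succ N ih =>
    apply serreAux_ext hd N
    rw [← mul_smul_comm, smul_comm, ← smul_mul_assoc, serreAux_succ hd]
    set S := serreAux d N (qpow (-d) * z) x y with hS
    have ih' := ih (qpow (-d) * z)
    rw [← hS] at ih'
    rw [mul_sub, sub_mul, ← mul_assoc, hx, mul_smul_comm, smul_mul_assoc, ← mul_assoc b S x, ih',
      smul_mul_assoc, smul_mul_assoc, mul_assoc x b S, ih', mul_assoc S b x, hx]
    simp only [mul_smul_comm, smul_sub, smul_smul, mul_assoc]
    congr 2 <;> ring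

theorem serreAux_add {d n : ℕ} (hd : 0 < d) {a b c : B}
    (hba : b * a = qpow (2 * d) • (a * b)) (hbc : b * c = qpow (-(n * d)) • (c * b)) (N : ℕ) :
    serreAux d N (qpow ((N - 1 - n) * d)) (a + b) c =
      serreAux d N (qpow ((N - 1 - n) * d)) a c := by
  induction N with
  | zero => simp [serreAux_zero]
  | succ N ih =>
    apply serreAux_ext hd N
    rw [serreAux_succ hd, serreAux_succ hd]
    have h1 : qpow (-(d : ℚ)) * qpow ((((N + 1 : ℕ) : ℚ) - 1 - n) * d)
        = qpow (((N : ℚ) - 1 - n) * d) := by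
      rw [← qpow_add]; push_cast; ring_nf
    rw [h1, ih]
    have h2 := serreAux_comm hd hba hbc N (qpow (((N : ℚ) - 1 - n) * d))
    set S := serreAux d N (qpow (((N : ℚ) - 1 - n) * d)) a c
    have h3 : qpow ((N : ℚ) * d) * qpow ((((N + 1 : ℕ) : ℚ) - 1 - n) * d)
        = qpow (2 * d) ^ N * qpow (-(n * d)) := by
      have h4 : qpow (2 * (d : ℚ)) ^ N = qpow (N * (2 * d)) := by
        clear ih h1 h2
        induction N with
        | zero => simp [qpow_zero]
        | succ N ih => rw [pow_succ, ih, ← qpow_add]; push_cast; ring_nf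
      rw [h4, ← qpow_add, ← qpow_add]; push_cast; ring_nf
    rw [h3, add_mul, mul_add, h2, smul_add]
    abel

theorem serre_add_left {d n : ℕ} (hd : 0 < d) {a b c : B}
    (hba : b * a = qpow (2 * d) • (a * b)) (hbc : b * c = qpow (-(n * d)) • (c * b)) :
    serre d (n + 1) (a + b) c = serre d (n + 1) a c := by
  have h := serreAux_add hd hba hbc (n + 1)
  have h1 : qpow ((((n + 1 : ℕ) : ℚ) - 1 - n) * d) = 1 := by
    rw [← qpow_zero]; push_cast; ring_nf
  rw [h1] at h
  rw [serre_eq_aux, serre_eq_aux, h]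

theorem serre_op (d N : ℕ) (x y : B) :
    serre d N (MulOpposite.op x) (MulOpposite.op y) =
      ((-1 : QField) ^ N) • MulOpposite.op (serre d N x y) := by
  have hsum : MulOpposite.op (serre d N x y) = ∑ m ∈ Finset.range (N + 1), MulOpposite.op
      (((-1 : QField) ^ m / (qfact d m * qfact d (N - m))) • (x ^ m * y * x ^ (N - m))) :=
    map_sum (MulOpposite.opAddEquiv : B ≃+ Bᵐᵒᵖ) _ _
  rw [hsum, serre, Finset.smul_sum, ← Finset.sum_range_reflect]
  refine Finset.sum_congr rfl fun m hm => ?_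
  have hm' : m ≤ N := Nat.lt_succ_iff.mp (Finset.mem_range.mp hm)
  obtain ⟨l, rfl⟩ := Nat.exists_eq_add_of_le hm'
  have e1 : m + l + 1 - 1 - m = l := by omega
  have e2 : m + l - l = m := by omega
  rw [e1, e2, Nat.add_sub_cancel_left, MulOpposite.op_smul, smul_smul, MulOpposite.op_mul,
    MulOpposite.op_mul, MulOpposite.op_pow, MulOpposite.op_pow, mul_assoc]
  have h1 : (-1 : QField) ^ (m + l) * (-1) ^ m = (-1) ^ l := by
    rw [pow_add, mul_right_comm, ← mul_pow]; simp
  rw [← mul_div_assoc, h1, mul_comm (qfact d l)]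

theorem serre_add_right {d n : ℕ} (hd : 0 < d) {a b c : B}
    (hba : b * a = qpow (2 * d) • (a * b)) (hca : c * a = qpow (-(n * d)) • (a * c)) :
    serre d (n + 1) (a + b) c = serre d (n + 1) b c := by
  have h : serre d (n + 1) (MulOpposite.op b + MulOpposite.op a) (MulOpposite.op c) =
      serre d (n + 1) (MulOpposite.op b) (MulOpposite.op c) := by
    apply serre_add_left hd
    · rw [← MulOpposite.op_mul, ← MulOpposite.op_mul, hba, MulOpposite.op_smul]
    · rw [← MulOpposite.op_mul, ← MulOpposite.op_mul, hca, MulOpposite.op_smul]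
  rw [← MulOpposite.op_add, serre_op, serre_op, add_comm b a] at h
  have h2 := smul_right_injective Bᵐᵒᵖ (pow_ne_zero (n + 1) (neg_ne_zero.mpr one_ne_zero)) h
  exact MulOpposite.op_injective h2

theorem serre_add_add (d N : ℕ) (x y y' : B) :
    serre d N x (y + y') = serre d N x y + serre d N x y' := by
  simp only [serre, ← Finset.sum_add_distrib, mul_add, add_mul, smul_add]

theorem serre_zero_right (d N : ℕ) (x : B) : serre d N x 0 = 0 := by
  simp [serre]

theorem serre_map {C : Type*} [Ring C] [Algebra QField C] (φ : B →ₐ[QField] C) (d N : ℕ)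
    (x y : B) : φ (serre d N x y) = serre d N (φ x) (φ y) := by
  simp [serre, map_sum]

theorem serre_smul (d N : ℕ) (s u : QField) (x y : B) :
    serre d N (s • x) (u • y) = (s ^ N * u) • serre d N x y := by
  rw [serre, serre, Finset.smul_sum]
  refine Finset.sum_congr rfl fun m hm => ?_
  have hm' : m ≤ N := Nat.lt_succ_iff.mp (Finset.mem_range.mp hm)
  obtain ⟨l, rfl⟩ := Nat.exists_eq_add_of_le hm'
  simp only [smul_pow, Nat.add_sub_cancel_left, smul_mul_assoc, mul_smul_comm, smul_smul]
  congr 1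
  ring

/-- Multiplying both variables by elements that commute with each other and `q`-commute with the
variables multiplies the Serre expression by an element. -/
theorem serreAux_twist {d : ℕ} (hd : 0 < d) {x y g h : B} {s u : QField}
    (hgh : g * h = h * g) (hxg : x * g = s • (g * x)) (hxh : x * h = u • (h * x))
    (hyg : y * g = u • (g * y)) (N : ℕ) :
    ∃ γ : QField, ∀ z, serreAux d N z (g * x) (h * y) = γ • (g ^ N * h * serreAux d N z x y) := by
  induction N with
  | zero => exact ⟨1, fun z => by simp [serreAux_zero]⟩
  | succ N ih =>
    obtain ⟨γ, hγ⟩ := ih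
    refine ⟨γ * (s ^ N * u), fun z => ?_⟩
    apply serreAux_ext hd N
    rw [serreAux_succ hd, smul_comm (qint d (N + 1)), ← mul_smul_comm (qint d (N + 1)),
      serreAux_succ hd, hγ]
    set S := serreAux d N (qpow (-d) * z) x y with hS
    have hxgN : x * g ^ N = s ^ N • (g ^ N * x) := by
      clear hγ hS S
      induction N with
      | zero => simp
      | succ N ih =>
        rw [pow_succ, ← mul_assoc, ih, smul_mul_assoc, mul_assoc, hxg, mul_smul_comm, smul_smul,
          mul_assoc, ← pow_succ]
    have hSg : S * g = (s ^ N * u) • (g * S) := by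
      have hne : ∀ M, (∀ z, serreAux d M z x y * g = (s ^ M * u) • (g * serreAux d M z x y)) := by
        intro M
        induction M with
        | zero => intro z; simpa [serreAux_zero] using hyg
        | succ M ihM =>
          intro z
          apply serreAux_ext hd M
          rw [← smul_mul_assoc, smul_comm, ← mul_smul_comm, serreAux_succ hd, sub_mul, mul_sub,
            mul_assoc x, ihM, smul_mul_assoc, mul_assoc _ x g, hxg, mul_smul_comm, mul_smul_comm,
            ← mul_assoc x, ← mul_assoc _ g x, hxg, ihM]
          simp only [mul_smul_comm, smul_mul_assoc, smul_sub, smul_smul, mul_assoc]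
          congr 2 <;> ring
      exact hne N _
    have t1 : g * x * (γ • (g ^ N * h * S)) =
        (γ * (s ^ N * u)) • (g ^ (N + 1) * h * (x * S)) := by
      calc g * x * (γ • (g ^ N * h * S)) = γ • (g * (x * g ^ N) * h * S) := by
            simp only [mul_smul_comm, mul_assoc]
        _ = (γ * s ^ N) • (g * g ^ N * (x * h) * S) := by
            rw [hxgN]; simp only [mul_smul_comm, smul_mul_assoc, smul_smul, mul_assoc]
        _ = _ := by
            rw [hxh, ← pow_succ']
            simp only [mul_smul_comm, smul_mul_assoc, smul_smul, mul_assoc]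
    have t2 : (γ • (g ^ N * h * S)) * (g * x) =
        (γ * (s ^ N * u)) • (g ^ (N + 1) * h * (S * x)) := by
      calc (γ • (g ^ N * h * S)) * (g * x) = γ • (g ^ N * h * (S * g) * x) := by
            simp only [smul_mul_assoc, mul_assoc]
        _ = (γ * (s ^ N * u)) • (g ^ N * (h * g) * (S * x)) := by
            rw [hSg]; simp only [mul_smul_comm, smul_mul_assoc, smul_smul, mul_assoc]
        _ = _ := by rw [← hgh, pow_succ]; simp only [mul_assoc]
    rw [t1, t2, mul_sub, smul_sub, mul_smul_comm, smul_comm]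

theorem serre_twist {d : ℕ} (hd : 0 < d) {x y g h : B} {s u : QField}
    (hgh : g * h = h * g) (hxg : x * g = s • (g * x)) (hxh : x * h = u • (h * x))
    (hyg : y * g = u • (g * y)) (N : ℕ) (h0 : serre d N x y = 0) :
    serre d N (g * x) (h * y) = 0 := by
  obtain ⟨γ, hγ⟩ := serreAux_twist hd hgh hxg hxh hyg N
  rw [serre_eq_aux] at h0 ⊢
  have h1 : serreAux d N 1 x y = 0 :=
    (smul_eq_zero.mp h0).resolve_left (pow_ne_zero N (neg_ne_zero.mpr one_ne_zero))
  rw [hγ, h1, mul_zero, smul_zero, smul_zero]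

end SerreLemmas

/-! ## The quantized enveloping algebra -/

/-- The generators: torus elements `K a = ∏ t_i ^ (a i)`, and `e i`, `f i`. -/
inductive Gen (r : ℕ) : Type
  | K (a : Fin r → ℤ) : Gen r
  | e (i : Fin r) : Gen r
  | f (i : Fin r) : Gen r

/-- The free algebra on the generators. -/
abbrev FreeU (r : ℕ) : Type := FreeAlgebra QField (Gen r)

/-- The generators as elements of the free algebra. -/
abbrev gen {r : ℕ} (x : Gen r) : FreeU r := FreeAlgebra.ι QField x

/-- The defining relations, imposed on the free algebra. -/
inductive Rel : FreeU r → FreeU r → Prop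
  | K_zero : Rel (gen (.K 0)) 1
  | K_add (a b : Fin r → ℤ) : Rel (gen (.K (a + b))) (gen (.K a) * gen (.K b))
  | K_e (a : Fin r → ℤ) (j : Fin r) :
      Rel (gen (.K a) * gen (.e j)) (qpow (a j * D.d j) • (gen (.e j) * gen (.K a)))
  | K_f (a : Fin r → ℤ) (j : Fin r) :
      Rel (gen (.K a) * gen (.f j)) (qpow (-(a j * D.d j)) • (gen (.f j) * gen (.K a)))
  | e_f (i j : Fin r) :
      Rel (gen (.e i) * gen (.f j) - gen (.f j) * gen (.e i))
        (if i = j then (qpow (D.d i) - qpow (-(D.d i)))⁻¹ •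
          (gen (.K (D.kExp i)) - gen (.K (-D.kExp i))) else 0)
  | serre_e (i j : Fin r) (h : i ≠ j) :
      Rel (serre (D.d i) (1 - D.A i j).toNat (gen (.e i)) (gen (.e j))) 0
  | serre_f (i j : Fin r) (h : i ≠ j) :
      Rel (serre (D.d i) (1 - D.A i j).toNat (gen (.f i)) (gen (.f j))) 0

/-- The quantized universal enveloping algebra of simply connected type. -/
def U : Type := RingQuot (Rel D)

instance : Ring (U D) := inferInstanceAs (Ring (RingQuot (Rel D)))

instance : Algebra QField (U D) := inferInstanceAs (Algebra QField (RingQuot (Rel D)))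

/-- The quotient map from the free algebra. -/
def U.mk : FreeU r →ₐ[QField] U D := RingQuot.mkAlgHom QField (Rel D)

/-- The torus element `∏ t_i ^ (a i)`. -/
def U.K (a : Fin r → ℤ) : U D := U.mk D (gen (.K a))

/-- The generator `e_i`. -/
def U.e (i : Fin r) : U D := U.mk D (gen (.e i))

/-- The generator `f_i`. -/
def U.f (i : Fin r) : U D := U.mk D (gen (.f i))

theorem U.mk_rel {x y : FreeU r} (h : Rel D x y) : U.mk D x = U.mk D y :=
  RingQuot.mkAlgHom_rel QField h

theorem U.qrel : QRel D (U.K D) (U.e D) (U.f D) where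
  K_zero := by simpa [U.K, U.e, U.f] using U.mk_rel D Rel.K_zero
  K_add a b := by simpa [U.K, U.e, U.f] using U.mk_rel D (Rel.K_add a b)
  K_e a j := by simpa [U.K, U.e, U.f] using U.mk_rel D (Rel.K_e a j)
  K_f a j := by simpa [U.K, U.e, U.f] using U.mk_rel D (Rel.K_f a j)
  e_f i j := by
    have h := U.mk_rel D (Rel.e_f i j)
    rw [map_sub, map_mul, map_mul] at h
    refine h.trans ?_
    split_ifs
    · rw [map_smul, map_sub]; rfl
    · rw [map_zero]
  serre_e i j h := by
    have h := U.mk_rel D (Rel.serre_e i j h)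
    rwa [serre_map, map_zero] at h
  serre_f i j h := by
    have h := U.mk_rel D (Rel.serre_f i j h)
    rwa [serre_map, map_zero] at h

section Lift

variable {B : Type*} [Ring B] [Algebra QField B]

/-- The values of the generators. -/
def Gen.val (κ : (Fin r → ℤ) → B) (e f : Fin r → B) : Gen r → B
  | .K a => κ a
  | .e i => e i
  | .f i => f i

/-- The universal property: elements satisfying the relations define an algebra homomorphism. -/
def U.lift {κ : (Fin r → ℤ) → B} {e f : Fin r → B} (h : QRel D κ e f) : U D →ₐ[QField] B :=
  RingQuot.liftAlgHom QField ⟨FreeAlgebra.lift QField (Gen.val κ e f), by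
    intro x y hxy
    induction hxy with
    | K_zero => simpa [Gen.val] using h.K_zero
    | K_add a b => simpa [Gen.val] using h.K_add a b
    | K_e a j => simpa [Gen.val] using h.K_e a j
    | K_f a j => simpa [Gen.val] using h.K_f a j
    | e_f i j =>
      rw [map_sub, map_mul, map_mul]
      simp only [FreeAlgebra.lift_ι_apply, Gen.val]
      rw [h.e_f]
      split_ifs
      · rw [map_smul, map_sub]; simp only [FreeAlgebra.lift_ι_apply, Gen.val]
      · rw [map_zero]
    | serre_e i j hij => simpa [serre_map, Gen.val] using h.serre_e i j hij
    | serre_f i j hij => simpa [serre_map, Gen.val] using h.serre_f i j hij⟩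

theorem U.lift_mk {κ : (Fin r → ℤ) → B} {e f : Fin r → B} (h : QRel D κ e f) (x : FreeU r) :
    U.lift D h (U.mk D x) = FreeAlgebra.lift QField (Gen.val κ e f) x :=
  RingQuot.liftAlgHom_mkAlgHom_apply QField _ _ x

theorem U.lift_K {κ : (Fin r → ℤ) → B} {e f : Fin r → B} (h : QRel D κ e f) (a : Fin r → ℤ) :
    U.lift D h (U.K D a) = κ a := by
  rw [U.K, U.lift_mk, FreeAlgebra.lift_ι_apply]; rfl

theorem U.lift_e {κ : (Fin r → ℤ) → B} {e f : Fin r → B} (h : QRel D κ e f) (i : Fin r) :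
    U.lift D h (U.e D i) = e i := by
  rw [U.e, U.lift_mk, FreeAlgebra.lift_ι_apply]; rfl

theorem U.lift_f {κ : (Fin r → ℤ) → B} {e f : Fin r → B} (h : QRel D κ e f) (i : Fin r) :
    U.lift D h (U.f D i) = f i := by
  rw [U.f, U.lift_mk, FreeAlgebra.lift_ι_apply]; rfl

end Lift

/-! ### The Hopf algebra structure maps -/

theorem kExp_mul_d (i j : Fin r) : (D.kExp i j : ℚ) * D.d j = D.d i * D.A i j := by
  have h := D.symm i j
  have h' : ((D.d i : ℤ) * D.A i j : ℚ) = ((D.d j : ℤ) * D.A j i : ℚ) := by exact_mod_cast h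
  simp only [CartanDatum.kExp]
  push_cast at h'
  rw [h', mul_comm]

theorem exists_nat_entry {i j : Fin r} (h : i ≠ j) :
    ∃ n : ℕ, D.A i j = -(n : ℤ) ∧ (1 - D.A i j).toNat = n + 1 := by
  have h0 := D.offDiag i j h
  refine ⟨(-D.A i j).toNat, ?_, ?_⟩ <;> omega

theorem counit_qrel : QRel D (B := QField) (fun _ => 1) (fun _ => 0) (fun _ => 0) where
  K_zero := rfl
  K_add a b := by simp
  K_e a j := by simp
  K_f a j := by simp
  e_f i j := by simp
  serre_e i j h := serre_zero_right _ _ _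
  serre_f i j h := serre_zero_right _ _ _

/-- The counit: `ε(t_i) = 1`, `ε(e_i) = ε(f_i) = 0`. -/
def counit : U D →ₐ[QField] QField := U.lift D (counit_qrel D)

theorem qpow_smul_smul_cancel {M : Type*} [AddCommGroup M] [Module QField M] (s : ℚ) (x : M) :
    qpow s • qpow (-s) • x = x := by
  rw [smul_smul, qpow_mul_neg, one_smul]

theorem theta_qrel :
    QRel D (fun a => U.K D (-a)) (fun i => -U.f D i) (fun i => -U.e D i) where
  K_zero := by rw [neg_zero]; exact (U.qrel D).K_zero
  K_add a b := by rw [neg_add]; exact (U.qrel D).K_add _ _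
  K_e a j := by
    have h := (U.qrel D).K_f (-a) j
    rw [mul_neg, neg_mul, smul_neg, h]
    simp
  K_f a j := by
    have h := (U.qrel D).K_e (-a) j
    rw [mul_neg, neg_mul, smul_neg, h]
    simp
  e_f i j := by
    have h := (U.qrel D).e_f j i
    rw [neg_mul_neg, neg_mul_neg, ← neg_sub, h]
    by_cases hij : i = j
    · subst hij
      rw [if_pos rfl, if_pos rfl, ← smul_neg, neg_sub, neg_neg]
    · rw [if_neg hij, if_neg (Ne.symm hij), neg_zero]
  serre_e i j h := by
    have := serre_smul (D.d i) (1 - D.A i j).toNat (-1) (-1) (U.f D i) (U.f D j)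
    rw [(U.qrel D).serre_f i j h, smul_zero] at this
    simpa using this
  serre_f i j h := by
    have := serre_smul (D.d i) (1 - D.A i j).toNat (-1) (-1) (U.e D i) (U.e D j)
    rw [(U.qrel D).serre_e i j h, smul_zero] at this
    simpa using this

/-- The automorphism `θ`: `θ(e_i) = -f_i`, `θ(f_i) = -e_i`, `θ(t_i) = t_i⁻¹`. -/
def theta : U D →ₐ[QField] U D := U.lift D (theta_qrel D)

theorem U.e_K (a : Fin r → ℤ) (j : Fin r) :
    U.e D j * U.K D a = qpow (-(a j * D.d j)) • (U.K D a * U.e D j) := by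
  rw [(U.qrel D).K_e, smul_smul, mul_comm, qpow_mul_neg, one_smul]

theorem U.f_K (a : Fin r → ℤ) (j : Fin r) :
    U.f D j * U.K D a = qpow (a j * D.d j) • (U.K D a * U.f D j) := by
  rw [(U.qrel D).K_f, smul_smul, qpow_mul_neg, one_smul]

theorem U.K_mul_comm (a b : Fin r → ℤ) : U.K D a * U.K D b = U.K D b * U.K D a := by
  rw [← (U.qrel D).K_add, ← (U.qrel D).K_add, add_comm]

theorem antipode_qrel :
    QRel D (B := (U D)ᵐᵒᵖ) (fun a => MulOpposite.op (U.K D (-a)))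
      (fun i => MulOpposite.op (-(U.K D (-D.kExp i) * U.e D i)))
      (fun i => MulOpposite.op (-(U.f D i * U.K D (D.kExp i)))) where
  K_zero := by rw [neg_zero, (U.qrel D).K_zero]; rfl
  K_add a b := by
    rw [neg_add, (U.qrel D).K_add, U.K_mul_comm, MulOpposite.op_mul]
  K_e a j := by
    rw [← MulOpposite.op_mul, ← MulOpposite.op_mul, ← MulOpposite.op_smul]
    congr 1
    rw [neg_mul, mul_neg, smul_neg, mul_assoc, U.e_K, mul_smul_comm, ← mul_assoc, ← mul_assoc,
      U.K_mul_comm D (-a)]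
    simp
  K_f a j := by
    rw [← MulOpposite.op_mul, ← MulOpposite.op_mul, ← MulOpposite.op_smul]
    congr 1
    rw [neg_mul, mul_neg, smul_neg, mul_assoc, U.K_mul_comm D _ (-a), ← mul_assoc, ← mul_assoc,
      U.f_K, smul_mul_assoc]
    simp
  e_f i j := by
    rw [← MulOpposite.op_mul, ← MulOpposite.op_mul, ← MulOpposite.op_sub, neg_mul_neg,
      neg_mul_neg]
    have h1 : U.f D j * U.K D (D.kExp j) * (U.K D (-D.kExp i) * U.e D i) =
        qpow ((D.kExp j j : ℚ) * D.d j - D.kExp i j * D.d j) •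
          (U.K D (D.kExp j + -D.kExp i) * (U.f D j * U.e D i)) := by
      rw [mul_assoc, ← mul_assoc (U.K D (D.kExp j)), ← (U.qrel D).K_add, ← mul_assoc, U.f_K,
        smul_mul_assoc, mul_assoc]
      congr 2
      simp only [Pi.add_apply, Pi.neg_apply]
      push_cast
      ring
    have h2 : U.K D (-D.kExp i) * U.e D i * (U.f D j * U.K D (D.kExp j)) =
        qpow ((D.kExp j j : ℚ) * D.d j - D.kExp j i * D.d i) •
          (U.K D (D.kExp j + -D.kExp i) * (U.e D i * U.f D j)) := by
      rw [U.f_K, mul_smul_comm, mul_assoc, ← mul_assoc (U.e D i), U.e_K, smul_mul_assoc,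
        mul_smul_comm, smul_smul, ← qpow_add, mul_assoc (U.K D (D.kExp j)), ← mul_assoc,
        ← (U.qrel D).K_add, add_comm (-D.kExp i), sub_eq_add_neg]
    have h3 : (D.kExp i j : ℚ) * D.d j = D.kExp j i * D.d i := by
      rw [kExp_mul_d, kExp_mul_d]
      exact_mod_cast D.symm i j
    rw [h1, h2, h3, ← smul_sub, ← mul_sub, ← neg_sub (U.e D i * _), (U.qrel D).e_f]
    by_cases hij : i = j
    · subst hij
      rw [if_pos rfl, if_pos rfl, sub_self, qpow_zero, one_smul, add_neg_cancel,
        (U.qrel D).K_zero, one_mul, ← smul_neg, neg_sub, neg_neg, MulOpposite.op_smul,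
        MulOpposite.op_sub]
    · rw [if_neg hij, if_neg hij, neg_zero, mul_zero, smul_zero, MulOpposite.op_zero]
  serre_e i j h := by
    rw [serre_op, ← neg_mul, ← neg_mul, serre_twist (D.d_pos i)
      (s := qpow ((D.kExp i i : ℚ) * D.d i)) (u := qpow ((D.kExp i j : ℚ) * D.d j))
      _ _ _ _ _ ((U.qrel D).serre_e i j h), MulOpposite.op_zero, smul_zero]
    · rw [neg_mul_neg, neg_mul_neg, U.K_mul_comm]
    · rw [mul_neg, neg_mul, smul_neg, U.e_K]; simp
    · rw [mul_neg, neg_mul, smul_neg, U.e_K, kExp_mul_d,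
        show (D.d i : ℚ) * D.A i j = D.d j * D.A j i by exact_mod_cast D.symm i j, ← kExp_mul_d]
      simp
    · rw [mul_neg, neg_mul, smul_neg, U.e_K]; simp
  serre_f i j h := by
    have hx : ∀ l, -(U.f D l * U.K D (D.kExp l)) =
        (-(qpow ((D.kExp l l : ℚ) * D.d l) • U.K D (D.kExp l))) * U.f D l := by
      intro l
      rw [U.f_K, neg_mul, smul_mul_assoc]
    rw [serre_op, hx, hx, serre_twist (D.d_pos i)
      (s := qpow ((D.kExp i i : ℚ) * D.d i)) (u := qpow ((D.kExp i j : ℚ) * D.d j))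
      _ _ _ _ _ ((U.qrel D).serre_f i j h), MulOpposite.op_zero, smul_zero]
    · simp only [neg_mul_neg, smul_mul_assoc, mul_smul_comm]
      rw [U.K_mul_comm, smul_comm]
    · rw [mul_neg, neg_mul, smul_neg, mul_smul_comm, U.f_K, smul_mul_assoc]
    · rw [mul_neg, neg_mul, smul_neg, mul_smul_comm, U.f_K, smul_mul_assoc, kExp_mul_d D i j,
        show (D.d i : ℚ) * D.A i j = D.d j * D.A j i by exact_mod_cast D.symm i j,
        ← kExp_mul_d D j i, smul_comm]
    · rw [mul_neg, neg_mul, smul_neg, mul_smul_comm, U.f_K, smul_mul_assoc, smul_comm]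

/-- The antipode, an antihomomorphism: `σ(t_i) = t_i⁻¹`, `σ(e_i) = -k_i⁻¹ e_i`,
`σ(f_i) = -f_i k_i`. -/
def antipode : U D →ₐ[QField] (U D)ᵐᵒᵖ := U.lift D (antipode_qrel D)

theorem comul_qrel :
    QRel D (B := U D ⊗[QField] U D) (fun a => U.K D a ⊗ₜ U.K D a)
      (fun i => U.e D i ⊗ₜ 1 + U.K D (D.kExp i) ⊗ₜ U.e D i)
      (fun i => U.f D i ⊗ₜ U.K D (-D.kExp i) + 1 ⊗ₜ U.f D i) where
  K_zero := by rw [(U.qrel D).K_zero]; rfl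
  K_add a b := by rw [(U.qrel D).K_add, Algebra.TensorProduct.tmul_mul_tmul]
  K_e a j := by
    simp only [mul_add, add_mul, smul_add, Algebra.TensorProduct.tmul_mul_tmul, mul_one, one_mul]
    rw [(U.qrel D).K_e, TensorProduct.smul_tmul', TensorProduct.tmul_smul, U.K_mul_comm]
  K_f a j := by
    simp only [mul_add, add_mul, smul_add, Algebra.TensorProduct.tmul_mul_tmul, mul_one, one_mul]
    rw [(U.qrel D).K_f, TensorProduct.smul_tmul', TensorProduct.tmul_smul, U.K_mul_comm]
  e_f i j := by
    simp only [mul_add, add_mul, Algebra.TensorProduct.tmul_mul_tmul, mul_one, one_mul]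
    have h1 : (U.K D (D.kExp i) * U.f D j) ⊗ₜ[QField] (U.e D i * U.K D (-D.kExp j)) =
        (U.f D j * U.K D (D.kExp i)) ⊗ₜ[QField] (U.K D (-D.kExp j) * U.e D i) := by
      rw [(U.qrel D).K_f, U.e_K, ← TensorProduct.smul_tmul', TensorProduct.tmul_smul, smul_smul,
        ← qpow_add, kExp_mul_d D i j]
      have h3 : (((-D.kExp j) i : ℤ) : ℚ) * D.d i = -(D.d i * D.A i j) := by
        rw [show (D.d i : ℚ) * D.A i j = D.d j * D.A j i by exact_mod_cast D.symm i j,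
          ← kExp_mul_d D j i]
        simp
      rw [h3, neg_neg, neg_add_cancel, qpow_zero, one_smul]
    have h2 := (U.qrel D).e_f i j
    rw [h1]
    have h4 : (U.e D i * U.f D j) ⊗ₜ[QField] U.K D (-D.kExp j) + (U.f D j * U.K D (D.kExp i)) ⊗ₜ[QField] (U.K D (-D.kExp j) * U.e D i) +
        (U.e D i ⊗ₜ[QField] U.f D j + U.K D (D.kExp i) ⊗ₜ[QField] (U.e D i * U.f D j)) -
      ((U.f D j * U.e D i) ⊗ₜ[QField] U.K D (-D.kExp j) + U.e D i ⊗ₜ[QField] U.f D j +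
        ((U.f D j * U.K D (D.kExp i)) ⊗ₜ[QField] (U.K D (-D.kExp j) * U.e D i) +
          U.K D (D.kExp i) ⊗ₜ[QField] (U.f D j * U.e D i))) =
      (U.e D i * U.f D j - U.f D j * U.e D i) ⊗ₜ[QField] U.K D (-D.kExp j) +
        U.K D (D.kExp i) ⊗ₜ[QField] (U.e D i * U.f D j - U.f D j * U.e D i) := by
      rw [TensorProduct.sub_tmul, TensorProduct.tmul_sub]
      abel
    rw [h4, h2]
    by_cases hij : i = j
    · subst hij
      simp only [if_true]
      rw [TensorProduct.tmul_smul, ← TensorProduct.smul_tmul', ← smul_add, TensorProduct.sub_tmul,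
        TensorProduct.tmul_sub]
      congr 1
      abel
    · simp only [if_neg hij, TensorProduct.zero_tmul, TensorProduct.tmul_zero, add_zero]
  serre_e i j h := by
    obtain ⟨n, hn, hN⟩ := exists_nat_entry D h
    have hs := (U.qrel D).serre_e i j h
    rw [hN] at hs ⊢
    have hd := D.d_pos i
    have hii : (D.kExp i i : ℚ) * D.d i = 2 * D.d i := by
      rw [kExp_mul_d, D.diag]; push_cast; ring
    have hij : (D.kExp i j : ℚ) * D.d j = -(n * D.d i) := by
      rw [kExp_mul_d, hn]; push_cast; ring
    have hji : (D.kExp j i : ℚ) * D.d i = -(n * D.d i) := by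
      rw [kExp_mul_d, show (D.d j : ℚ) * D.A j i = D.d i * D.A i j by
        exact_mod_cast (D.symm i j).symm, hn]; push_cast; ring
    have hba : (U.K D (D.kExp i) ⊗ₜ[QField] U.e D i) * (U.e D i ⊗ₜ[QField] 1) =
        qpow (2 * D.d i) • ((U.e D i ⊗ₜ[QField] 1) * (U.K D (D.kExp i) ⊗ₜ[QField] U.e D i)) := by
      simp only [Algebra.TensorProduct.tmul_mul_tmul, mul_one, one_mul]
      rw [(U.qrel D).K_e, hii, ← TensorProduct.smul_tmul']
    rw [serre_add_add, serre_add_left hd hba, serre_add_right hd hba]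
    · have h1 := serre_map (Algebra.TensorProduct.includeLeft : U D →ₐ[QField] U D ⊗[QField] U D)
        (D.d i) (n + 1) (U.e D i) (U.e D j)
      rw [hs, map_zero] at h1
      simp only [Algebra.TensorProduct.includeLeft_apply] at h1
      rw [← h1, zero_add]
      have h2 : serre (D.d i) (n + 1) ((1 : U D) ⊗ₜ[QField] U.e D i) ((1 : U D) ⊗ₜ[QField] U.e D j) = 0 := by
        have h1 := serre_map (Algebra.TensorProduct.includeRight : U D →ₐ[QField] U D ⊗[QField] U D)
          (D.d i) (n + 1) (U.e D i) (U.e D j)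
        rw [hs, map_zero] at h1
        exact h1.symm
      have h3 := serre_twist hd (g := U.K D (D.kExp i) ⊗ₜ[QField] (1 : U D))
        (h := U.K D (D.kExp j) ⊗ₜ[QField] (1 : U D)) (s := 1) (u := 1) ?_ ?_ ?_ ?_ (n + 1) h2
      · simpa using h3
      all_goals simp [U.K_mul_comm D (D.kExp i)]
    · simp only [Algebra.TensorProduct.tmul_mul_tmul, mul_one, one_mul]
      rw [(U.qrel D).K_e, hji, ← TensorProduct.smul_tmul']
    · simp only [Algebra.TensorProduct.tmul_mul_tmul, mul_one, one_mul]
      rw [(U.qrel D).K_e, hij, ← TensorProduct.smul_tmul']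
  serre_f i j h := by
    obtain ⟨n, hn, hN⟩ := exists_nat_entry D h
    have hs := (U.qrel D).serre_f i j h
    rw [hN] at hs ⊢
    have hd := D.d_pos i
    have hii : (D.kExp i i : ℚ) * D.d i = 2 * D.d i := by
      rw [kExp_mul_d, D.diag]; push_cast; ring
    have hij : (D.kExp i j : ℚ) * D.d j = -(n * D.d i) := by
      rw [kExp_mul_d, hn]; push_cast; ring
    have hji : (D.kExp j i : ℚ) * D.d i = -(n * D.d i) := by
      rw [kExp_mul_d, show (D.d j : ℚ) * D.A j i = D.d i * D.A i j by
        exact_mod_cast (D.symm i j).symm, hn]; push_cast; ring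
    have hneg : ∀ a b, (((-D.kExp a) b : ℤ) : ℚ) * D.d b = -(D.kExp a b * D.d b) := by
      intro a b; simp
    have hba : (U.f D i ⊗ₜ[QField] U.K D (-D.kExp i)) * ((1 : U D) ⊗ₜ[QField] U.f D i) =
        qpow (2 * D.d i) •
          (((1 : U D) ⊗ₜ[QField] U.f D i) * (U.f D i ⊗ₜ[QField] U.K D (-D.kExp i))) := by
      simp only [Algebra.TensorProduct.tmul_mul_tmul, mul_one, one_mul]
      rw [(U.qrel D).K_f, hneg, hii, neg_neg, TensorProduct.tmul_smul]
    rw [add_comm (U.f D i ⊗ₜ[QField] U.K D (-D.kExp i)), add_comm (U.f D j ⊗ₜ[QField] _),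
      serre_add_add, serre_add_left hd hba, serre_add_right hd hba]
    · have h1 := serre_map (Algebra.TensorProduct.includeRight : U D →ₐ[QField] U D ⊗[QField] U D)
        (D.d i) (n + 1) (U.f D i) (U.f D j)
      rw [hs, map_zero] at h1
      simp only [Algebra.TensorProduct.includeRight_apply] at h1
      rw [← h1, zero_add]
      have h2 : serre (D.d i) (n + 1) (U.f D i ⊗ₜ[QField] (1 : U D)) (U.f D j ⊗ₜ[QField] (1 : U D)) = 0 := by
        have h1 := serre_map (Algebra.TensorProduct.includeLeft : U D →ₐ[QField] U D ⊗[QField] U D)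
          (D.d i) (n + 1) (U.f D i) (U.f D j)
        rw [hs, map_zero] at h1
        exact h1.symm
      have h3 := serre_twist hd (g := (1 : U D) ⊗ₜ[QField] U.K D (-D.kExp i))
        (h := (1 : U D) ⊗ₜ[QField] U.K D (-D.kExp j)) (s := 1) (u := 1) ?_ ?_ ?_ ?_ (n + 1) h2
      · simpa using h3
      all_goals simp [U.K_mul_comm D (-D.kExp i)]
    · simp only [Algebra.TensorProduct.tmul_mul_tmul, mul_one, one_mul]
      rw [(U.qrel D).K_f, hneg, hji, TensorProduct.tmul_smul, neg_neg]
    · simp only [Algebra.TensorProduct.tmul_mul_tmul, mul_one, one_mul]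
      rw [(U.qrel D).K_f, hneg, hij, TensorProduct.tmul_smul, neg_neg]

/-- The comultiplication: `Δ(t_i) = t_i ⊗ t_i`, `Δ(e_i) = e_i ⊗ 1 + k_i ⊗ e_i`,
`Δ(f_i) = f_i ⊗ k_i⁻¹ + 1 ⊗ f_i`. -/
def comul : U D →ₐ[QField] U D ⊗[QField] U D := U.lift D (comul_qrel D)

/-! ## Triangular parts, weights, the pairing -/

/-- The subalgebra `U⁺` generated by the `e_i`. -/
def Upos : Subalgebra QField (U D) := Algebra.adjoin QField (Set.range (U.e D))

/-- The subalgebra `U⁻` generated by the `f_i`. -/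
def Uneg : Subalgebra QField (U D) := Algebra.adjoin QField (Set.range (U.f D))

/-- The kernel of the counit on `U⁺`. -/
def UposAug : Submodule QField (U D) :=
  Subalgebra.toSubmodule (Upos D) ⊓ LinearMap.ker (counit D).toLinearMap

/-- The kernel of the counit on `U⁻`. -/
def UnegAug : Submodule QField (U D) :=
  Subalgebra.toSubmodule (Uneg D) ⊓ LinearMap.ker (counit D).toLinearMap

/-- The group algebra of the group `T ≅ ℤ^r` generated by the `t_i`. -/
abbrev TorusAlg (r : ℕ) : Type := AddMonoidAlgebra QField (Fin r → ℤ)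

/-- The embedding of the group algebra of `T` in `U`; its image is the subalgebra `U⁰`
generated by the `t_i` and their inverses. -/
def torusMap : TorusAlg r →ₐ[QField] U D :=
  AddMonoidAlgebra.lift QField (U D) (Fin r → ℤ)
    { toFun := fun a => U.K D a.toAdd
      map_one' := (U.qrel D).K_zero
      map_mul' := fun a b => (U.qrel D).K_add a.toAdd b.toAdd }

theorem pair_zero (mu : Fin r → ℚ) : D.pair 0 mu = 0 := by simp [CartanDatum.pair]

theorem pair_add (a b : Fin r → ℤ) (mu : Fin r → ℚ) :
    D.pair (a + b) mu = D.pair a mu + D.pair b mu := by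
  simp [CartanDatum.pair, add_mul, Finset.sum_add_distrib]

/-- The character `q ^ μ` on the group algebra of `T`: `t_i ↦ q ^ (d_i ⟨μ, u_i⟩)`, with `u_i` the
simple coweights. The weight `μ ∈ 𝔥*` is given by its coordinates `μ_i = ⟨μ, u_i⟩` in the basis
of simple roots. -/
def qchar (mu : Fin r → ℚ) : TorusAlg r →ₐ[QField] QField :=
  AddMonoidAlgebra.lift QField QField (Fin r → ℤ)
    { toFun := fun a => qpow (D.pair a.toAdd mu)
      map_one' := by rw [toAdd_one, pair_zero, qpow_zero]
      map_mul' := fun a b => by rw [toAdd_mul, pair_add, qpow_add] }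

/-- The complement `U⁻₋ U + U U⁺₊` of `U⁰` in `U`. -/
def zeroPartKer : Submodule QField (U D) := UnegAug D * ⊤ + ⊤ * UposAug D

/-- The projection `x ↦ (x)₀` of `U` on `U⁰` along `U⁻₋ U + U U⁺₊`: the element `z` of `U⁰` (there is
exactly one, by the triangular decomposition) with `x - z` in that subspace. -/
def zeroPart (x : U D) : TorusAlg r :=
  Classical.epsilon fun z => x - torusMap D z ∈ zeroPartKer D

/-- The pairing `π_λ(x ⊗ y) = q^λ((σ(x) y)₀)`. -/
def pairing (lam : Fin r → ℚ) (x y : U D) : QField :=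
  qchar D lam (zeroPart D ((antipode D x).unop * y))

/-- The subspace `K_λ ⊆ U⁻`: the kernel of `π_λ` in `U⁻`. -/
def Kneg (lam : Fin r → ℚ) : Set (U D) :=
  {y | y ∈ Uneg D ∧ ∀ x ∈ Upos D, pairing D lam x y = 0}

/-- The subspace `K̃_λ ⊆ U⁺`: the kernel of `π_λ` in `U⁺`. -/
def Kpos (lam : Fin r → ℚ) : Set (U D) :=
  {x | x ∈ Upos D ∧ ∀ y ∈ Uneg D, pairing D lam x y = 0}

/-! ## Modules -/

section Modules

variable {V W : Type*} [AddCommMonoid V] [Module QField V] [AddCommMonoid W] [Module QField W]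

variable {D} in
/-- The weight subspace `V[μ]` of a `U`-module `V`. -/
def weightSpace (ρ : U D →ₐ[QField] Module.End QField V) (mu : Fin r → ℚ) : Submodule QField V where
  carrier := {v | ∀ a : Fin r → ℤ, ρ (U.K D a) v = qpow (D.pair a mu) • v}
  zero_mem' := fun a => by rw [map_zero, smul_zero]
  add_mem' := fun {v w} hv hw a => by rw [map_add, hv a, hw a, smul_add]
  smul_mem' := fun c v hv a => by rw [map_smul, hv a, smul_comm]

variable {D} in
/-- A `U`-module is admissible if it is the direct sum of its weight subspaces and these are
finite-dimensional. -/
def IsAdmissible {V : Type*} [AddCommGroup V] [Module QField V]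
    (ρ : U D →ₐ[QField] Module.End QField V) : Prop :=
  DirectSum.IsInternal (fun mu : Fin r → ℚ => weightSpace ρ mu) ∧
    ∀ mu, FiniteDimensional QField (weightSpace ρ mu)

variable {D} in
/-- The tensor product of two `U`-modules, through the comultiplication. -/
def tensorRep (ρ : U D →ₐ[QField] Module.End QField V) (τ : U D →ₐ[QField] Module.End QField W) :
    U D →ₐ[QField] Module.End QField (V ⊗[QField] W) :=
  (Module.endTensorEndAlgHom (R := QField) (S := QField) (A := QField) (M := V) (N := W)).comp
    ((Algebra.TensorProduct.map ρ τ).comp (comul D))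

end Modules

/-- The left ideal of `U` generated by the `e_i` and the `t - q^λ(t)` for `t ∈ T`. -/
def vermaIdeal (lam : Fin r → ℚ) : Submodule (U D) (U D) :=
  Submodule.span (U D) (Set.range (U.e D) ∪
    Set.range fun a : Fin r → ℤ => U.K D a - algebraMap QField (U D) (qpow (D.pair a lam)))

/-- The Verma module `M(λ)`. -/
abbrev Verma (lam : Fin r → ℚ) : Type := U D ⧸ vermaIdeal D lam

/-- The largest proper submodule `K(λ)` of `M(λ)`, as the sum of all proper submodules. -/
def vermaMax (lam : Fin r → ℚ) : Submodule (U D) (Verma D lam) :=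
  sSup {N : Submodule (U D) (Verma D lam) | N ≠ ⊤}

/-- The irreducible highest weight module `L(λ) = M(λ) / K(λ)`. -/
abbrev Irr (lam : Fin r → ℚ) : Type := Verma D lam ⧸ vermaMax D lam

/-- The highest weight vector of `L(λ)`, the image of `1 ∈ U`. -/
def hwVec (lam : Fin r → ℚ) : Irr D lam :=
  Submodule.Quotient.mk (Submodule.Quotient.mk (1 : U D))

/-- The action of `U` on `L(λ)`. -/
def irrRep (lam : Fin r → ℚ) : U D →ₐ[QField] Module.End QField (Irr D lam) :=
  Algebra.lsmul QField QField (Irr D lam)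

/-! ## The quantized coordinate ring -/

/-- The quantized coordinate ring `F`, as a subspace of the dual of `U`: the span of the matrix
coefficients of the finite-dimensional admissible `U`-modules. -/
def CoordRing : Submodule QField (Module.Dual QField (U D)) :=
  Submodule.span QField {c | ∃ (n : ℕ) (ρ : U D →ₐ[QField] Module.End QField (Fin n → QField))
    (v : Fin n → QField) (ξ : Module.Dual QField (Fin n → QField)),
      IsAdmissible ρ ∧ ∀ x, c x = ξ (ρ x v)}

/-- The left regular action of `U` on its dual: `(a f)(x) = f(x a)`. -/
def leftReg : U D →ₐ[QField] Module.End QField (Module.Dual QField (U D)) where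
  toFun a := (LinearMap.mulRight QField a).dualMap
  map_one' := by ext f x; simp
  map_mul' a b := by ext f x; simp [mul_assoc]
  map_zero' := by ext f x; simp
  map_add' a b := by ext f x; simp [mul_add]
  commutes' c := by
    ext f x
    simp [Algebra.algebraMap_eq_smul_one]

theorem leftReg_apply (a x : U D) (f : Module.Dual QField (U D)) :
    leftReg D a f x = f (x * a) := rfl

theorem leftReg_mem (a : U D) : ∀ f ∈ CoordRing D, leftReg D a f ∈ CoordRing D := by
  intro f hf
  induction hf using Submodule.span_induction with
  | mem c hc =>
    obtain ⟨n, ρ, v, ξ, hρ, h⟩ := hc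
    refine Submodule.subset_span ⟨n, ρ, ρ a v, ξ, hρ, fun x => ?_⟩
    rw [leftReg_apply, h, map_mul, Module.End.mul_apply]
  | zero => rw [map_zero]; exact Submodule.zero_mem _
  | add c c' _ _ h h' => rw [map_add]; exact Submodule.add_mem _ h h'
  | smul s c _ h => rw [map_smul]; exact Submodule.smul_mem _ s h

/-- The left regular action of `U` on `F`. -/
def coordRep : U D →ₐ[QField] Module.End QField (CoordRing D) where
  toFun a := (leftReg D a).restrict (leftReg_mem D a)
  map_one' := by ext f x; simp
  map_mul' a b := by ext f x; simp
  map_zero' := by ext f x; simp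
  map_add' a b := by ext f x; simp
  commutes' c := by
    ext f x
    simp [Algebra.algebraMap_eq_smul_one]

/-- The space `F[0]` of elements of `F` of weight zero. -/
abbrev CoordZero : Submodule QField (CoordRing D) := weightSpace (coordRep D) 0

/-- The subspace of `F[0]` of the elements annihilated by `K_λ` and by `K̃_λ`. -/
def coordInvariants (lam : Fin r → ℚ) : Submodule QField (CoordZero D) where
  carrier := {f | (∀ y ∈ Kneg D lam, coordRep D y f = 0) ∧ ∀ x ∈ Kpos D lam, coordRep D x f = 0}
  zero_mem' := ⟨fun y _ => map_zero _, fun x _ => map_zero _⟩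
  add_mem' := fun {f g} hf hg =>
    ⟨fun y hy => by rw [Submodule.coe_add, map_add, hf.1 y hy, hg.1 y hy, add_zero],
      fun x hx => by rw [Submodule.coe_add, map_add, hf.2 x hx, hg.2 x hx, add_zero]⟩
  smul_mem' := fun c f hf =>
    ⟨fun y hy => by rw [Submodule.coe_smul, map_smul, hf.1 y hy, smul_zero],
      fun x hx => by rw [Submodule.coe_smul, map_smul, hf.2 x hx, smul_zero]⟩

/-! ## Intertwining operators -/

/-- The space `Hom_U(L(λ), L(λ) ⊗ F)`. -/
def HomU (lam : Fin r → ℚ) :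
    Submodule QField (Irr D lam →ₗ[QField] Irr D lam ⊗[QField] CoordRing D) where
  carrier := {φ | ∀ (a : U D) (v : Irr D lam),
    φ (a • v) = tensorRep (irrRep D lam) (coordRep D) a (φ v)}
  zero_mem' := fun a v => by simp
  add_mem' := fun {φ ψ} hφ hψ a v => by
    rw [LinearMap.add_apply, LinearMap.add_apply, hφ a v, hψ a v, map_add]
  smul_mem' := fun c φ hφ a v => by
    rw [LinearMap.smul_apply, LinearMap.smul_apply, hφ a v, map_smul]

/-- The sum of the subspaces `L(λ)[μ] ⊗ F` of `L(λ) ⊗ F` over the weights `μ < λ`, that is,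
`μ = λ - β` with `β` a nonzero sum of simple roots. -/
def lowerTerms (lam : Fin r → ℚ) : Submodule QField (Irr D lam ⊗[QField] CoordRing D) :=
  ⨆ (β : Fin r → ℕ) (_ : β ≠ 0), LinearMap.range
    ((weightSpace (irrRep D lam) (fun i => lam i - β i)).subtype.rTensor (CoordRing D))

/-- The element `f` of `F` is the coefficient of the highest weight vector in `φ(1_λ)`:
`φ(1_λ) = 1_λ ⊗ f + ∑ v_μ ⊗ f_μ`, a sum over `μ < λ` with `v_μ` of weight `μ`. -/
def IsLeadingCoeff (lam : Fin r → ℚ) (φ : HomU D lam) (f : CoordRing D) : Prop :=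
  φ.1 (hwVec D lam) - hwVec D lam ⊗ₜ[QField] f ∈ lowerTerms D lam

end QKostant

end

/-!
Everything rests on one functional on `U`, the map `u ↦ q^λ((u)₀)`, called `hwFun`. It kills `U e_i`
and `f_i U` and is `q^λ` on the torus. That it exists is the nontrivial half of the triangular
decomposition that is needed, and it is obtained from a highest weight module: on the space of words
in the `f_i` the relations other than the Serre relations act, and one divides by the radical of the
vectors that no product of the `e_i` brings back to the highest weight vector. A Serre element in
the `f_i` commutes with all `e_k` (`PreRel.e_mul_serre_f`), and no vector in its image has a
component along the highest weight vector, so that it acts by zero on the quotient. A Serre element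
in the `e_i` commutes with all `f_k` and kills the highest weight vector, hence everything.

The functional is invariant under the antiautomorphism `σ θ`, and `σ θ σ = θ`; this gives
`π_λ(θ(y) ⊗ θ(x)) = π_λ(x ⊗ y)`, whence `K̃_λ = θ(K_λ)`.

The annihilator of the highest weight vector of `L(λ)` is the largest left ideal on which `hwFun`
vanishes (`smul_hwVec_eq_zero_iff`). So `hwFun` descends to a functional `ξ` on `L(λ)`, the
coefficient of the highest weight vector, and the functionals `x ξ`, for `x ∈ U⁺` acting on the dual
through the antipode, separate the points of `L(λ)`. The pairing `π_λ(x ⊗ y)` is the value of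
`x ξ` at `y 1_λ`; thus `K_λ` is the annihilator of `1_λ` in `U⁻` and `K̃_λ` that of `ξ` in `U⁺`.

The leading coefficient of `φ` is `f = (ξ ⊗ id)(t)` with `t = φ(1_λ)`. As `t` is killed by the
`e_i`, `(x ξ ⊗ id)(t) = x f` for `x ∈ U⁺` (`contract_dualOrbit_of_singular`). So `f` determines `t`, hence
`φ`, and is killed by `K̃_λ`. As `ξ` kills the images of the `f_i`, `(ξ ⊗ id)(y t) = y f` for
`y ∈ U⁻` (`contract_hwCoeff_Uneg`), and `f` is killed by `K_λ`.

Conversely, let `f` of weight zero be killed by `K_λ` and `K̃_λ`. Long products of the `e_i` kill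
`f`, since it lies in a finite-dimensional admissible module. Then the equations
`(x ξ ⊗ id)(t) = x f` are solved by a finite sum over dual bases
(`exists_contract_dualOrbit_eq`), and `t` is singular of weight `λ`. The operator
`u 1_λ ↦ u t` is well defined: if `u 1_λ = 0`, then `u` is an element `y` of `K_λ` modulo the
annihilator of `t`, so that `(ξ ⊗ id)(u t) = y f = 0`; the same holds for all multiples of `u`, and
a vector all of whose translates have leading coefficient zero is zero
(`eq_zero_of_contract_tensorRep`).
-/

open scoped TensorProduct

noncomputable section

namespace QKostant

variable {r : ℕ} (D : CartanDatum r)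

/-! ### The Serre elements and the relations between raising and lowering operators -/

/-- The defining relations of `U` other than the Serre relations. -/
structure PreRel {B : Type*} [Ring B] [Algebra QField B]
    (κ : (Fin r → ℤ) → B) (e f : Fin r → B) : Prop where
  K_zero : κ 0 = 1
  K_add : ∀ a b, κ (a + b) = κ a * κ b
  K_e : ∀ a j, κ a * e j = qpow (a j * D.d j) • (e j * κ a)
  K_f : ∀ a j, κ a * f j = qpow (-(a j * D.d j)) • (f j * κ a)
  e_f : ∀ i j, e i * f j - f j * e i =
    if i = j then (qpow (D.d i) - qpow (-(D.d i)))⁻¹ • (κ (D.kExp i) - κ (-D.kExp i)) else 0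

/-- The quantum integer `[s]_i` with `d = d_i`, for a rational number `s`. -/
def qrat (d : ℕ) (s : ℚ) : QField := (qpow (s * d) - qpow (-(s * d))) / (qpow d - qpow (-d))

theorem qrat_natCast (d n : ℕ) : qrat d n = qint d n := rfl

theorem qpow_neg (s : ℚ) : qpow (-s) = (qpow s)⁻¹ :=
  eq_inv_of_mul_eq_one_right (qpow_mul_neg s)

/-- The recursion for the coefficients in `commutator_serreStep_left`. -/
theorem qrat_recursion {d : ℕ} (hd : 0 < d) (n N : ℚ) :
    qrat d (N + 2) * qrat d (n - N - 1) =
      qrat d (N + 1) * qrat d (n - N) - qrat d (2 * (N + 1) - n) := by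
  have h0 : qpow (d : ℚ) - qpow (-(d : ℚ)) ≠ 0 := qpow_sub_ne_zero (by exact_mod_cast hd)
  have hQ := qpow_ne_zero (d : ℚ)
  have hX := qpow_ne_zero (N * (d : ℚ))
  have hY := qpow_ne_zero (n * (d : ℚ))
  have e1 : qpow ((N + 2) * (d : ℚ)) = qpow (N * d) * qpow d * qpow d := by
    rw [← qpow_add, ← qpow_add]; ring_nf
  have e2 : qpow ((n - N - 1) * (d : ℚ)) = qpow (n * d) * (qpow (N * d))⁻¹ * (qpow d)⁻¹ := by
    rw [← qpow_neg, ← qpow_neg, ← qpow_add, ← qpow_add]; ring_nf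
  have e3 : qpow ((N + 1) * (d : ℚ)) = qpow (N * d) * qpow d := by
    rw [← qpow_add]; ring_nf
  have e4 : qpow ((n - N) * (d : ℚ)) = qpow (n * d) * (qpow (N * d))⁻¹ := by
    rw [← qpow_neg, ← qpow_add]; ring_nf
  have e5 : qpow ((2 * (N + 1) - n) * (d : ℚ)) =
      qpow (N * d) * qpow (N * d) * qpow d * qpow d * (qpow (n * d))⁻¹ := by
    rw [← qpow_neg, ← qpow_add, ← qpow_add, ← qpow_add, ← qpow_add]; ring_nf
  simp only [qrat]
  simp only [qpow_neg] at h0 ⊢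
  rw [e1, e2, e3, e4, e5]
  generalize qpow (d : ℚ) = Q at *
  generalize qpow (N * (d : ℚ)) = X at *
  generalize qpow (n * (d : ℚ)) = Y at *
  rw [div_mul_div_comm, div_mul_div_comm, div_sub_div _ _ (mul_ne_zero h0 h0) h0,
    div_eq_div_iff (mul_ne_zero h0 h0) (mul_ne_zero (mul_ne_zero h0 h0) h0)]
  field_simp
  ring

section Commutator

variable {B : Type*} [Ring B] [Algebra QField B]

/-- The partial Serre elements: the one of degree `N + 1` in `x` is, up to a quantum integer, a
`q`-commutator of `x` with the one of degree `N`, and the one of degree `n + 1` is the Serre element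
for the entry `-n` of the Cartan matrix, up to sign. -/
def serreStep (d n N : ℕ) (x y : B) : B := serreAux d N (qpow ((N - 1 - n) * d)) x y

theorem serreStep_zero (d n : ℕ) (x y : B) : serreStep d n 0 x y = y := serreAux_zero _ _ _ _

theorem serreStep_succ {d : ℕ} (hd : 0 < d) (n N : ℕ) (x y : B) :
    qint d (N + 1) • serreStep d n (N + 1) x y =
      x * serreStep d n N x y - qpow ((2 * N - n) * d) • (serreStep d n N x y * x) := by
  have h1 : qpow (-(d : ℚ)) * qpow ((((N + 1 : ℕ) : ℚ) - 1 - n) * d)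
      = qpow (((N : ℚ) - 1 - n) * d) := by
    rw [← qpow_add]; push_cast; ring_nf
  have h2 : qpow ((N : ℚ) * d) * qpow ((((N + 1 : ℕ) : ℚ) - 1 - n) * d)
      = qpow ((2 * N - n) * d) := by
    rw [← qpow_add]; push_cast; ring_nf
  rw [serreStep, serreAux_succ hd, h1, h2, serreStep]

theorem serre_eq_serreStep (d n : ℕ) (x y : B) :
    serre d (n + 1) x y = ((-1 : QField) ^ (n + 1)) • serreStep d n (n + 1) x y := by
  have h1 : qpow ((((n + 1 : ℕ) : ℚ) - 1 - n) * d) = 1 := by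
    rw [← qpow_zero]; push_cast; ring_nf
  rw [serre_eq_aux, serreStep, h1]

theorem qpow_pow (s : ℚ) (N : ℕ) : qpow s ^ N = qpow (N * s) := by
  induction N with
  | zero => simp [qpow_zero]
  | succ N ih => rw [pow_succ, ih, ← qpow_add]; push_cast; ring_nf

theorem serreStep_comm {d : ℕ} (hd : 0 < d) {x y b : B} {s u : ℚ}
    (hx : b * x = qpow s • (x * b)) (hy : b * y = qpow u • (y * b)) (n N : ℕ) :
    b * serreStep d n N x y = qpow (N * s + u) • (serreStep d n N x y * b) := by
  rw [serreStep, serreAux_comm hd hx hy, qpow_pow, ← qpow_add]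

/-- The raising operator `E` opposite to `x` lowers the degree of the partial Serre elements in
`x`, with a coefficient that vanishes in the degree `n + 1` of the Serre relation. -/
theorem commutator_serreStep_left {d : ℕ} (hd : 0 < d) (n : ℕ) {x y E k k' : B}
    (hkx : k * x = qpow (-(2 * d)) • (x * k)) (hkx' : k' * x = qpow (2 * d) • (x * k'))
    (hky : k * y = qpow (n * d) • (y * k)) (hky' : k' * y = qpow (-(n * d)) • (y * k'))
    (hEx : E * x - x * E = (qpow d - qpow (-d))⁻¹ • (k - k')) (hEy : E * y = y * E) (N : ℕ) :
    E * serreStep d n (N + 1) x y - serreStep d n (N + 1) x y * E =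
      qrat d (n - N) • (serreStep d n N x y * k) := by
  have step : ∀ N : ℕ, qint d (N + 1) •
      (E * serreStep d n (N + 1) x y - serreStep d n (N + 1) x y * E) =
      (-qrat d (2 * N - n)) • (serreStep d n N x y * k) +
      (x * (E * serreStep d n N x y - serreStep d n N x y * E) -
        qpow ((2 * N - n) * d) • ((E * serreStep d n N x y - serreStep d n N x y * E) * x)) := by
    intro N
    have hk := serreStep_comm hd hkx hky n N
    have hk' := serreStep_comm hd hkx' hky' n N
    rw [smul_sub, ← mul_smul_comm, ← smul_mul_assoc, serreStep_succ hd]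
    generalize serreStep d n N x y = S at *
    have e1 : ((N : ℚ) * -(2 * d) + n * d) = -((2 * N - n) * d) := by ring
    have e2 : ((N : ℚ) * (2 * d) + -(n * d)) = (2 * N - n) * d := by ring
    rw [e1] at hk
    rw [e2] at hk'
    have hq : -qrat d (2 * N - n) = (qpow d - qpow (-d))⁻¹ * qpow (-((2 * N - n) * d)) -
        (qpow d - qpow (-d))⁻¹ * qpow ((2 * N - n) * d) := by
      rw [qrat]; ring
    rw [hq, sub_smul]
    clear hq e1 e2
    generalize qpow ((2 * N - n) * (d : ℚ)) = ω at *
    generalize qpow (-((2 * N - n) * (d : ℚ))) = ω' at *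
    generalize (qpow (d : ℚ) - qpow (-(d : ℚ)))⁻¹ = p at *
    have hEx' : E * x = x * E + p • (k - k') := by rw [← hEx]; abel
    have h1 : E * (x * S) = x * (E * S) + (p * ω') • (S * k) - (p * ω) • (S * k') := by
      rw [← mul_assoc, hEx', add_mul, smul_mul_assoc, sub_mul, hk, hk', smul_sub, smul_smul,
        smul_smul, mul_assoc]
      abel
    have h2 : S * (E * x) = S * (x * E) + p • (S * k) - p • (S * k') := by
      rw [hEx', mul_add, mul_smul_comm, mul_sub, smul_sub]
      abel
    rw [mul_sub, sub_mul, mul_smul_comm, smul_mul_assoc, mul_sub, sub_mul, h1, mul_assoc x S E,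
      mul_assoc S E x, h2, mul_assoc S x E, mul_assoc E S x]
    module
  induction N with
  | zero =>
    apply serreAux_ext hd 0
    rw [step]
    simp only [serreStep_zero, hEy, sub_self, mul_zero, zero_mul, smul_zero, add_zero, smul_smul]
    congr 1
    simp [qrat, qint, div_self (qpow_sub_ne_zero (show (0 : ℚ) < d by exact_mod_cast hd))]
    ring
  | succ N ih =>
    apply serreAux_ext hd (N + 1)
    have hN := serreStep_succ hd n N x y
    rw [step, ih]
    generalize serreStep d n (N + 1) x y = S' at *
    generalize serreStep d n N x y = S at *
    have e1 : qpow ((2 * ((N + 1 : ℕ) : ℚ) - n) * d) * qpow (-(2 * d)) =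
        qpow ((2 * N - n) * d) := by
      rw [← qpow_add]; push_cast; ring_nf
    rw [← e1] at hN
    have h1 : x * (qrat d (n - N) • (S * k)) -
        qpow ((2 * ((N + 1 : ℕ) : ℚ) - n) * d) • (qrat d (n - N) • (S * k) * x) =
        (qrat d (n - N) * qint d (N + 1)) • (S' * k) := by
      rw [mul_smul, ← smul_mul_assoc (qint d (N + 1)), hN]
      rw [mul_smul_comm, smul_mul_assoc, mul_assoc S k x, hkx, mul_smul_comm, sub_mul (x * S),
        smul_mul_assoc, mul_assoc x S k, mul_assoc S x k]
      module
    rw [h1, ← add_smul, smul_smul]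
    congr 1
    have h2 := qrat_recursion hd n N
    rw [show (N : ℚ) + 2 = ((N + 1 + 1 : ℕ) : ℚ) by push_cast; ring,
      show (N : ℚ) + 1 = ((N + 1 : ℕ) : ℚ) by push_cast; ring, qrat_natCast, qrat_natCast] at h2
    rw [show (n : ℚ) - ((N + 1 : ℕ) : ℚ) = n - N - 1 by push_cast; ring, h2]
    ring

/-- The raising operator `E` opposite to `y` commutes with the Serre element, the partial Serre
element of degree `n + 1`. -/
theorem commutator_serreStep_right {d : ℕ} (hd : 0 < d) (n : ℕ) {x y E k k' : B} {s : QField}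
    (hkx : k * x = qpow (n * d) • (x * k)) (hkx' : k' * x = qpow (-(n * d)) • (x * k'))
    (hEy : E * y - y * E = s • (k - k')) (hEx : E * x = x * E) :
    E * serreStep d n (n + 1) x y = serreStep d n (n + 1) x y * E := by
  have step : ∀ N : ℕ, qint d (N + 1) •
      (E * serreStep d n (N + 1) x y - serreStep d n (N + 1) x y * E) =
      x * (E * serreStep d n N x y - serreStep d n N x y * E) -
        qpow ((2 * N - n) * d) • ((E * serreStep d n N x y - serreStep d n N x y * E) * x) := by
    intro N
    rw [smul_sub, ← mul_smul_comm, ← smul_mul_assoc, serreStep_succ hd]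
    generalize serreStep d n N x y = S
    simp only [mul_sub, sub_mul, mul_smul_comm, smul_mul_assoc, ← mul_assoc, hEx, smul_sub]
    rw [mul_assoc S x E, ← hEx, ← mul_assoc]
    abel
  -- In positive degree `N + 1` the commutator is a multiple of `x ^ (N + 1) * k'`, with a factor
  -- that vanishes at `N = n`.
  have key : ∀ N : ℕ, ∃ p : QField,
      E * serreStep d n (N + 1) x y - serreStep d n (N + 1) x y * E =
        (p * (1 - qpow (2 * (N - n) * d))) • (x ^ (N + 1) * k') := by
    intro N
    induction N with
    | zero =>
      refine ⟨-s * (qint d 1)⁻¹, ?_⟩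
      apply serreAux_ext hd 0
      rw [step]
      rw [serreStep_zero, hEy, zero_add, pow_one, mul_smul_comm, smul_mul_assoc, mul_sub x,
        sub_mul k, hkx, hkx', smul_smul]
      have e1 : qpow ((2 * ((0 : ℕ) : ℚ) - n) * d) * s * qpow (n * d) = s := by
        rw [mul_right_comm, ← qpow_add]; simp [qpow_zero]
      have e2 : qpow ((2 * ((0 : ℕ) : ℚ) - n) * d) * (s * qpow (-(n * d))) =
          s * qpow (2 * (((0 : ℕ) : ℚ) - n) * d) := by
        rw [mul_left_comm, ← qpow_add]; ring_nf
      have e3 : qint d 1 * (-s * (qint d 1)⁻¹ * (1 - qpow (2 * (((0 : ℕ) : ℚ) - n) * d))) =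
          -s * (1 - qpow (2 * (((0 : ℕ) : ℚ) - n) * d)) := by
        have := qint_ne_zero hd 0
        rw [zero_add] at this
        field_simp
      rw [smul_smul (qint d 1), e3, neg_mul, mul_sub s, mul_one, ← e2, smul_sub, smul_sub,
        smul_smul, smul_smul, e1]
      module
    | succ N ih =>
      obtain ⟨p, hp⟩ := ih
      refine ⟨p * (1 - qpow (2 * (N - n) * d)) * (qint d (N + 1 + 1))⁻¹, ?_⟩
      apply serreAux_ext hd (N + 1)
      rw [step, hp]
      generalize p * (1 - qpow (2 * (N - n) * d)) = p'
      have hne := qint_ne_zero hd (N + 1)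
      have e1 : qpow ((2 * ((N + 1 : ℕ) : ℚ) - n) * d) * qpow (-(n * d)) =
          qpow (2 * (((N + 1 : ℕ) : ℚ) - n) * d) := by
        rw [← qpow_add]; ring_nf
      have e2 : qint d (N + 1 + 1) * (p' * (qint d (N + 1 + 1))⁻¹ *
          (1 - qpow (2 * (((N + 1 : ℕ) : ℚ) - n) * d))) =
          p' * (1 - qpow (2 * (((N + 1 : ℕ) : ℚ) - n) * d)) := by
        field_simp
      rw [smul_smul, e2, ← e1]
      simp only [mul_smul_comm, smul_mul_assoc, mul_assoc, hkx', smul_smul]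
      rw [← mul_assoc x, ← pow_succ', ← mul_assoc _ x k', ← pow_succ, ← sub_smul]
      congr 1
      ring
  obtain ⟨p, hp⟩ := key n
  rw [sub_self, mul_zero, zero_mul, qpow_zero, sub_self, mul_zero, zero_smul] at hp
  exact sub_eq_zero.mp hp

variable {D} {κ : (Fin r → ℤ) → B} {e f : Fin r → B}

/-- The Serre elements in the lowering operators commute with the raising operators. -/
theorem PreRel.e_mul_serre_f (h : PreRel D κ e f) {i j : Fin r} (hij : i ≠ j) (k : Fin r) :
    e k * serre (D.d i) (1 - D.A i j).toNat (f i) (f j) =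
      serre (D.d i) (1 - D.A i j).toNat (f i) (f j) * e k := by
  obtain ⟨n, hn, hN⟩ := exists_nat_entry D hij
  have hd := D.d_pos i
  have hneg : ∀ a b, (((-D.kExp a) b : ℤ) : ℚ) * D.d b = -(D.kExp a b * D.d b) := by
    intro a b; simp
  have hii : (D.kExp i i : ℚ) * D.d i = 2 * D.d i := by
    rw [kExp_mul_d, D.diag]; push_cast; ring
  have hij' : (D.kExp i j : ℚ) * D.d j = -(n * D.d i) := by
    rw [kExp_mul_d, hn]; push_cast; ring
  have hji : (D.kExp j i : ℚ) * D.d i = -(n * D.d i) := by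
    rw [kExp_mul_d, show (D.d j : ℚ) * D.A j i = D.d i * D.A i j by
      exact_mod_cast (D.symm i j).symm, hn]; push_cast; ring
  have hcomm : ∀ a b, a ≠ b → e a * f b = f b * e a := by
    intro a b hab
    have := h.e_f a b
    rw [if_neg hab] at this
    exact sub_eq_zero.mp this
  rw [hN, serre_eq_serreStep, mul_smul_comm, smul_mul_assoc]
  congr 1
  by_cases hki : k = i
  · subst hki
    have := commutator_serreStep_left hd n (x := f k) (y := f j) (E := e k)
      (k := κ (D.kExp k)) (k' := κ (-D.kExp k)) ?_ ?_ ?_ ?_ ?_ (hcomm k j hij) n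
    · rw [sub_self] at this
      simpa [qrat, sub_eq_zero] using this
    · rw [h.K_f, hii]
    · rw [h.K_f, hneg, hii, neg_neg]
    · rw [h.K_f, hij', neg_neg]
    · rw [h.K_f, hneg, hij', neg_neg]
    · rw [h.e_f, if_pos rfl]
  · by_cases hkj : k = j
    · subst hkj
      refine commutator_serreStep_right hd n (k := κ (D.kExp k)) (k' := κ (-D.kExp k))
        (s := (qpow (D.d k) - qpow (-(D.d k)))⁻¹) ?_ ?_ ?_ (hcomm k i hki)
      · rw [h.K_f, hji, neg_neg]
      · rw [h.K_f, hneg, hji, neg_neg]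
      · rw [h.e_f, if_pos rfl]
    · have := serreStep_comm hd (b := e k) (x := f i) (y := f j) (s := 0) (u := 0)
        (by rw [qpow_zero, one_smul, hcomm k i hki])
        (by rw [qpow_zero, one_smul, hcomm k j hkj]) n (n + 1)
      simpa [qpow_zero] using this

/-- Exchanging the raising and the lowering operators, up to sign, preserves the relations. -/
theorem PreRel.swap (h : PreRel D κ e f) :
    PreRel D (fun a => κ (-a)) (fun i => -f i) (fun i => -e i) where
  K_zero := by rw [neg_zero]; exact h.K_zero
  K_add a b := by rw [neg_add]; exact h.K_add _ _
  K_e a j := by rw [mul_neg, neg_mul, smul_neg, h.K_f]; simp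
  K_f a j := by rw [mul_neg, neg_mul, smul_neg, h.K_e]; simp
  e_f i j := by
    have h := h.e_f j i
    rw [neg_mul_neg, neg_mul_neg, ← neg_sub, h]
    by_cases hij : i = j
    · subst hij
      rw [if_pos rfl, if_pos rfl, ← smul_neg, neg_sub, neg_neg]
    · rw [if_neg hij, if_neg (Ne.symm hij), neg_zero]

/-- The Serre elements in the raising operators commute with the lowering operators. -/
theorem PreRel.f_mul_serre_e (h : PreRel D κ e f) {i j : Fin r} (hij : i ≠ j) (k : Fin r) :
    f k * serre (D.d i) (1 - D.A i j).toNat (e i) (e j) =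
      serre (D.d i) (1 - D.A i j).toNat (e i) (e j) * f k := by
  have h1 : -f k * serre (D.d i) (1 - D.A i j).toNat (-e i) (-e j) =
      serre (D.d i) (1 - D.A i j).toNat (-e i) (-e j) * -f k := h.swap.e_mul_serre_f hij k
  have h2 := serre_smul (D.d i) (1 - D.A i j).toNat (-1) (-1) (e i) (e j)
  rw [neg_one_smul, neg_one_smul] at h2
  have hne : (-1 : QField) ^ (1 - D.A i j).toNat * -1 ≠ 0 := by simp
  generalize (-1 : QField) ^ (1 - D.A i j).toNat * -1 = c at h2 hne
  rw [h2, neg_mul, mul_neg, mul_smul_comm, smul_mul_assoc, neg_inj] at h1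
  exact smul_right_injective B hne h1

end Commutator

/-! ### A highest weight module with nonzero highest weight vector -/

/-- The weight `∑ α_i` of a word in the letters `i`, in the basis of simple roots. -/
def wordWt (w : List (Fin r)) : Fin r → ℚ := fun i => w.count i

theorem wordWt_nil : wordWt ([] : List (Fin r)) = 0 := by ext i; simp [wordWt]

theorem pair_sub (a : Fin r → ℤ) (μ ν : Fin r → ℚ) :
    D.pair a (μ - ν) = D.pair a μ - D.pair a ν := by
  simp [CartanDatum.pair, mul_sub, Finset.sum_sub_distrib]

theorem pair_add_right (a : Fin r → ℤ) (μ ν : Fin r → ℚ) :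
    D.pair a (μ + ν) = D.pair a μ + D.pair a ν := by
  simp [CartanDatum.pair, mul_add, Finset.sum_add_distrib]

theorem pair_zero_right (a : Fin r → ℤ) : D.pair a 0 = 0 := by simp [CartanDatum.pair]

theorem pair_wordWt_cons (a : Fin r → ℤ) (j : Fin r) (w : List (Fin r)) :
    D.pair a (wordWt (j :: w)) = a j * D.d j + D.pair a (wordWt w) := by
  simp only [CartanDatum.pair, wordWt, List.count_cons]
  push_cast
  simp only [mul_add, Finset.sum_add_distrib]
  rw [add_comm]
  congr 1
  rw [Finset.sum_eq_single j]
  · simp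
  · intro b _ hb; simp [Ne.symm hb]
  · simp

/-- The space with a basis of words, underlying the Verma module of the algebra without Serre
relations: the word `w` stands for the product of the `f_i` over `w`, applied to the highest weight
vector. -/
abbrev WordSpace (r : ℕ) : Type := List (Fin r) →₀ QField

variable (lam : Fin r → ℚ)

/-- The action of the torus on words. -/
def wordK (a : Fin r → ℤ) : Module.End QField (WordSpace r) :=
  Finsupp.linearCombination QField fun w =>
    Finsupp.single w (qpow (D.pair a (lam - wordWt w)))

/-- The action of `f_j` on words: `j` is added in front. -/
def wordF (j : Fin r) : Module.End QField (WordSpace r) :=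
  Finsupp.lmapDomain QField QField (List.cons j)

/-- The value of `e_i` on a word, by moving `e_i` to the right. -/
def wordEAux (i : Fin r) : List (Fin r) → WordSpace r
  | [] => 0
  | j :: w => wordF j (wordEAux i w) +
      if i = j then (qpow (D.d i) - qpow (-(D.d i)))⁻¹ •
        (wordK D lam (D.kExp i) (Finsupp.single w 1) -
          wordK D lam (-D.kExp i) (Finsupp.single w 1)) else 0

/-- The action of `e_i` on words. -/
def wordE (i : Fin r) : Module.End QField (WordSpace r) :=
  Finsupp.linearCombination QField (wordEAux D lam i)

theorem wordK_single (a : Fin r → ℤ) (w : List (Fin r)) :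
    wordK D lam a (Finsupp.single w 1) =
      qpow (D.pair a (lam - wordWt w)) • Finsupp.single w 1 := by
  rw [wordK, Finsupp.linearCombination_single, one_smul, Finsupp.smul_single, smul_eq_mul, mul_one]

theorem wordF_single (j : Fin r) (w : List (Fin r)) :
    wordF j (Finsupp.single w 1) = Finsupp.single (j :: w) 1 := by
  rw [wordF, Finsupp.lmapDomain_apply, Finsupp.mapDomain_single]

theorem wordE_single_nil (i : Fin r) : wordE D lam i (Finsupp.single [] 1) = 0 := by
  rw [wordE, Finsupp.linearCombination_single, one_smul, wordEAux]

theorem wordE_single_cons (i j : Fin r) (w : List (Fin r)) :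
    wordE D lam i (Finsupp.single (j :: w) 1) = wordF j (wordE D lam i (Finsupp.single w 1)) +
      if i = j then (qpow (D.d i) - qpow (-(D.d i)))⁻¹ •
        (wordK D lam (D.kExp i) (Finsupp.single w 1) -
          wordK D lam (-D.kExp i) (Finsupp.single w 1)) else 0 := by
  rw [wordE, Finsupp.linearCombination_single, one_smul, wordEAux,
    Finsupp.linearCombination_single, one_smul]

theorem wordSpace_ext {V : Type*} [AddCommMonoid V] [Module QField V]
    {S T : WordSpace r →ₗ[QField] V}
    (h : ∀ w, S (Finsupp.single w 1) = T (Finsupp.single w 1)) : S = T := by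
  refine Finsupp.lhom_ext' fun w => LinearMap.ext_ring ?_
  simpa using h w

theorem word_preRel : PreRel D (wordK D lam) (wordE D lam) (wordF (r := r)) where
  K_zero := wordSpace_ext fun w => by
    rw [wordK_single, pair_zero, qpow_zero, one_smul, Module.End.one_apply]
  K_add a b := wordSpace_ext fun w => by
    rw [Module.End.mul_apply, wordK_single, wordK_single, map_smul, wordK_single, pair_add,
      qpow_add, smul_smul, mul_comm]
  K_f a j := wordSpace_ext fun w => by
    rw [LinearMap.smul_apply, Module.End.mul_apply, Module.End.mul_apply, wordF_single,
      wordK_single, wordK_single, map_smul, wordF_single, smul_smul, ← qpow_add, pair_sub,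
      pair_sub, pair_wordWt_cons]
    congr 2
    ring
  e_f i j := wordSpace_ext fun w => by
    rw [LinearMap.sub_apply, Module.End.mul_apply, Module.End.mul_apply, wordF_single,
      wordE_single_cons, add_sub_cancel_left]
    split_ifs <;> simp
  K_e a j := wordSpace_ext fun w => by
    rw [LinearMap.smul_apply, Module.End.mul_apply, Module.End.mul_apply]
    induction w with
    | nil => rw [wordE_single_nil, wordK_single, map_smul, wordE_single_nil]; simp
    | cons i w ih =>
      have hKF : ∀ v, wordK D lam a (wordF i v) =
          qpow (-(a i * D.d i)) • wordF i (wordK D lam a v) := by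
        intro v
        refine LinearMap.congr_fun (f := wordK D lam a ∘ₗ wordF i)
          (g := qpow (-(a i * D.d i)) • (wordF i ∘ₗ wordK D lam a)) (wordSpace_ext fun w => ?_) v
        simp only [LinearMap.smul_apply, LinearMap.comp_apply]
        rw [wordF_single, wordK_single, wordK_single, map_smul, wordF_single, smul_smul, ← qpow_add,
          pair_sub, pair_sub, pair_wordWt_cons]
        congr 2
        ring
      rw [wordE_single_cons, map_add, hKF, ih, wordK_single D lam a w,
        wordK_single D lam a (i :: w), map_smul, map_smul, map_smul, map_smul, wordE_single_cons, smul_add, smul_add, smul_smul,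
        smul_smul, smul_smul, smul_smul, ← qpow_add, ← qpow_add, ← qpow_add, pair_sub, pair_sub,
        pair_wordWt_cons]
      congr 1
      · congr 2
        ring
      · split_ifs with hij
        · subst hij
          simp only [map_smul, map_sub, wordK_single, smul_smul, smul_sub]
          rw [pair_sub D a lam (wordWt w)]
          have e1 : (a j : ℚ) * D.d j + (D.pair a lam - (a j * D.d j + D.pair a (wordWt w))) =
              D.pair a lam - D.pair a (wordWt w) := by ring
          rw [e1]
          congr 2 <;> ring
        · simp

/-- The coefficient of the highest weight vector. -/
def wordCoeff : Module.Dual QField (WordSpace r) := Finsupp.lapply []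

/-- The radical: the vectors that no product of raising operators brings to a vector with a nonzero
component along the highest weight vector. -/
def wordRadical : Submodule QField (WordSpace r) where
  carrier := {v | ∀ w : List (Fin r), wordCoeff ((w.map (wordE D lam)).prod v) = 0}
  zero_mem' w := by simp
  add_mem' h h' w := by rw [map_add, map_add, h w, h' w, add_zero]
  smul_mem' c v h w := by rw [map_smul, map_smul, h w, smul_zero]

theorem wordCoeff_wordK (a : Fin r → ℤ) (v : WordSpace r) :
    wordCoeff (wordK D lam a v) = qpow (D.pair a lam) * wordCoeff v := by
  refine LinearMap.congr_fun (f := wordCoeff ∘ₗ wordK D lam a)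
    (g := qpow (D.pair a lam) • wordCoeff) (wordSpace_ext fun w => ?_) v
  rw [LinearMap.comp_apply, wordK_single, map_smul, LinearMap.smul_apply]
  cases w with
  | nil => rw [wordWt_nil, sub_zero]
  | cons i w => simp [wordCoeff]

theorem wordCoeff_wordF (j : Fin r) (v : WordSpace r) : wordCoeff (wordF j v) = 0 := by
  refine LinearMap.congr_fun (f := wordCoeff ∘ₗ wordF j) (g := 0) (wordSpace_ext fun w => ?_) v
  rw [LinearMap.comp_apply, wordF_single]
  simp [wordCoeff]

theorem wordRadical_E (i : Fin r) : wordRadical D lam ≤ (wordRadical D lam).comap (wordE D lam i) :=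
  fun v hv w => by simpa using hv (w ++ [i])

theorem wordRadical_K (a : Fin r → ℤ) :
    wordRadical D lam ≤ (wordRadical D lam).comap (wordK D lam a) := by
  intro v hv w
  induction w using List.reverseRecOn generalizing v with
  | nil => simpa [wordCoeff_wordK] using Or.inr (hv [])
  | append_singleton w j ih =>
    have h := LinearMap.congr_fun ((word_preRel D lam).K_e a j) v
    rw [Module.End.mul_apply, LinearMap.smul_apply, Module.End.mul_apply] at h
    have h2 := ih (wordRadical_E D lam j hv)
    rw [h, map_smul, map_smul] at h2
    simpa using (smul_eq_zero.mp h2).resolve_left (qpow_ne_zero _)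

theorem wordRadical_F (j : Fin r) : wordRadical D lam ≤ (wordRadical D lam).comap (wordF j) := by
  intro v hv w
  induction w using List.reverseRecOn generalizing v with
  | nil => simpa using wordCoeff_wordF j v
  | append_singleton w i ih =>
    have h := LinearMap.congr_fun ((word_preRel D lam).e_f i j) v
    rw [LinearMap.sub_apply, Module.End.mul_apply, Module.End.mul_apply, sub_eq_iff_eq_add] at h
    rw [List.map_append, List.prod_append, Module.End.mul_apply, List.map_singleton,
      List.prod_singleton, h, map_add, map_add, ih (wordRadical_E D lam i hv), add_zero]
    split_ifs with hij
    · rw [LinearMap.smul_apply, LinearMap.sub_apply, map_smul, map_smul, map_sub, map_sub,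
        wordRadical_K D lam _ hv w, wordRadical_K D lam _ hv w, sub_zero, smul_zero]
    · simp

/-- The quotient of the space of words by the radical. It realizes the irreducible highest weight
module `L(λ)`. -/
abbrev WordQuot : Type := WordSpace r ⧸ wordRadical D lam

/-- The action of the torus on the quotient. -/
def quotK (a : Fin r → ℤ) : Module.End QField (WordQuot D lam) :=
  (wordRadical D lam).mapQ _ (wordK D lam a) (wordRadical_K D lam a)

/-- The action of `e_i` on the quotient. -/
def quotE (i : Fin r) : Module.End QField (WordQuot D lam) :=
  (wordRadical D lam).mapQ _ (wordE D lam i) (wordRadical_E D lam i)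

/-- The action of `f_i` on the quotient. -/
def quotF (i : Fin r) : Module.End QField (WordQuot D lam) :=
  (wordRadical D lam).mapQ _ (wordF i) (wordRadical_F D lam i)

theorem quotK_mk (a : Fin r → ℤ) (v : WordSpace r) :
    quotK D lam a (Submodule.Quotient.mk v) = Submodule.Quotient.mk (wordK D lam a v) := rfl

theorem quotE_mk (i : Fin r) (v : WordSpace r) :
    quotE D lam i (Submodule.Quotient.mk v) = Submodule.Quotient.mk (wordE D lam i v) := rfl

theorem quotF_mk (i : Fin r) (v : WordSpace r) :
    quotF D lam i (Submodule.Quotient.mk v) = Submodule.Quotient.mk (wordF i v) := rfl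

theorem wordQuot_ext {S T : Module.End QField (WordQuot D lam)}
    (h : ∀ v : WordSpace r, S (Submodule.Quotient.mk v) = T (Submodule.Quotient.mk v)) : S = T :=
  Submodule.linearMap_qext _ (LinearMap.ext h)

theorem quot_preRel : PreRel D (quotK D lam) (quotE D lam) (quotF D lam) where
  K_zero := wordQuot_ext D lam fun v => by
    rw [quotK_mk, (word_preRel D lam).K_zero]; rfl
  K_add a b := wordQuot_ext D lam fun v => by
    rw [quotK_mk, (word_preRel D lam).K_add]; rfl
  K_e a j := wordQuot_ext D lam fun v =>
    congrArg Submodule.Quotient.mk (LinearMap.congr_fun ((word_preRel D lam).K_e a j) v)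
  K_f a j := wordQuot_ext D lam fun v =>
    congrArg Submodule.Quotient.mk (LinearMap.congr_fun ((word_preRel D lam).K_f a j) v)
  e_f i j := wordQuot_ext D lam fun v => by
    have h := congrArg (Submodule.Quotient.mk (p := wordRadical D lam))
      (LinearMap.congr_fun ((word_preRel D lam).e_f i j) v)
    refine Eq.trans ?_ (h.trans ?_)
    · rfl
    · split_ifs <;> rfl

/-- The coefficient of the highest weight vector, on the quotient. -/
def quotCoeff : Module.Dual QField (WordQuot D lam) :=
  (wordRadical D lam).liftQ wordCoeff fun v hv => by simpa using hv []

theorem quotCoeff_quotF (j : Fin r) (v : WordQuot D lam) :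
    quotCoeff D lam (quotF D lam j v) = 0 := by
  induction v using Submodule.Quotient.induction_on with
  | H v => exact wordCoeff_wordF j v

theorem quotCoeff_quotK (a : Fin r → ℤ) (v : WordQuot D lam) :
    quotCoeff D lam (quotK D lam a v) = qpow (D.pair a lam) * quotCoeff D lam v := by
  induction v using Submodule.Quotient.induction_on with
  | H v => exact wordCoeff_wordK D lam a v

theorem prod_quotE_mk (w : List (Fin r)) (v : WordSpace r) :
    (w.map (quotE D lam)).prod (Submodule.Quotient.mk v) =
      Submodule.Quotient.mk ((w.map (wordE D lam)).prod v) := by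
  induction w with
  | nil => rfl
  | cons i w ih =>
    rw [List.map_cons, List.prod_cons, Module.End.mul_apply, ih, quotE_mk]; simp

theorem wordQuot_eq_zero {v : WordQuot D lam}
    (h : ∀ w : List (Fin r), quotCoeff D lam ((w.map (quotE D lam)).prod v) = 0) : v = 0 := by
  induction v using Submodule.Quotient.induction_on with
  | H v =>
    rw [Submodule.Quotient.mk_eq_zero]
    intro w
    have := h w
    rwa [prod_quotE_mk] at this

/-- The Serre elements in the lowering operators commute with the raising operators, and their
images have no component along the highest weight vector; so these images lie in the radical. The
Serre elements in the raising operators commute with the lowering operators and kill the highest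
weight vector, which generates the module. -/
theorem quot_qrel : QRel D (quotK D lam) (quotE D lam) (quotF D lam) where
  K_zero := (quot_preRel D lam).K_zero
  K_add := (quot_preRel D lam).K_add
  K_e := (quot_preRel D lam).K_e
  K_f := (quot_preRel D lam).K_f
  e_f := (quot_preRel D lam).e_f
  serre_f i j hij := by
    have hcomm := (quot_preRel D lam).e_mul_serre_f hij
    obtain ⟨n, -, hN⟩ := exists_nat_entry D hij
    have hzero : ∀ v, quotCoeff D lam
        (serre (D.d i) (1 - D.A i j).toNat (quotF D lam i) (quotF D lam j) v) = 0 := by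
      intro v
      rw [serre, LinearMap.sum_apply, map_sum]
      refine Finset.sum_eq_zero fun m _ => ?_
      rw [LinearMap.smul_apply, map_smul]
      refine smul_eq_zero_of_right _ ?_
      cases m with
      | zero => rw [pow_zero, one_mul, Module.End.mul_apply, quotCoeff_quotF]
      | succ m =>
        rw [pow_succ', mul_assoc, mul_assoc, Module.End.mul_apply, quotCoeff_quotF]
    generalize serre (D.d i) (1 - D.A i j).toNat (quotF D lam i) (quotF D lam j) = S at *
    refine LinearMap.ext fun v => wordQuot_eq_zero D lam fun w => ?_
    have hw : (w.map (quotE D lam)).prod * S = S * (w.map (quotE D lam)).prod := by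
      induction w with
      | nil => simp
      | cons k w ih =>
        rw [List.map_cons, List.prod_cons, mul_assoc, ih, ← mul_assoc, hcomm, mul_assoc]
    rw [← Module.End.mul_apply, hw, Module.End.mul_apply, hzero]
  serre_e i j hij := by
    have hcomm := (quot_preRel D lam).f_mul_serre_e hij
    have hzero : serre (D.d i) (1 - D.A i j).toNat (quotE D lam i) (quotE D lam j)
        (Submodule.Quotient.mk (Finsupp.single [] 1)) = 0 := by
      rw [serre, LinearMap.sum_apply]
      refine Finset.sum_eq_zero fun m _ => ?_
      have h0 : ∀ k, quotE D lam k (Submodule.Quotient.mk (Finsupp.single [] 1)) = 0 := by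
        intro k; rw [quotE_mk, wordE_single_nil, Submodule.Quotient.mk_zero]
      rw [LinearMap.smul_apply]
      rcases (1 - D.A i j).toNat - m with _ | l
      · rw [pow_zero, mul_one, Module.End.mul_apply, h0, map_zero, smul_zero]
      · rw [pow_succ, Module.End.mul_apply, Module.End.mul_apply, Module.End.mul_apply, h0,
          map_zero, map_zero, map_zero, smul_zero]
    generalize serre (D.d i) (1 - D.A i j).toNat (quotE D lam i) (quotE D lam j) = S at *
    refine Submodule.linearMap_qext _ (wordSpace_ext fun w => ?_)
    rw [LinearMap.comp_apply, LinearMap.comp_apply, Submodule.mkQ_apply, LinearMap.zero_apply]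
    induction w with
    | nil => exact hzero
    | cons k w ih =>
      rw [← wordF_single, ← quotF_mk, ← Module.End.mul_apply, ← hcomm, Module.End.mul_apply, ih,
        map_zero]

/-- The representation of `U` on the quotient. -/
def quotRep : U D →ₐ[QField] Module.End QField (WordQuot D lam) := U.lift D (quot_qrel D lam)

/-- The functional `u ↦ q^λ((u)₀)` on `U`, as the coefficient of the highest weight vector `1` in
`u 1`. -/
def hwFun : Module.Dual QField (U D) :=
  quotCoeff D lam ∘ₗ
    LinearMap.applyₗ (Submodule.Quotient.mk (Finsupp.single [] 1) : WordQuot D lam) ∘ₗ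
      (quotRep D lam).toLinearMap

theorem hwFun_apply (u : U D) : hwFun D lam u =
    quotCoeff D lam (quotRep D lam u (Submodule.Quotient.mk (Finsupp.single [] 1))) := rfl

theorem hwFun_one : hwFun D lam 1 = 1 := by
  rw [hwFun_apply, map_one, Module.End.one_apply]
  exact Finsupp.single_eq_same

theorem hwFun_mul_e (u : U D) (i : Fin r) : hwFun D lam (u * U.e D i) = 0 := by
  rw [hwFun_apply, map_mul, Module.End.mul_apply, quotRep, U.lift_e, quotE_mk, wordE_single_nil,
    Submodule.Quotient.mk_zero, map_zero, map_zero]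

theorem hwFun_f_mul (u : U D) (i : Fin r) : hwFun D lam (U.f D i * u) = 0 := by
  rw [hwFun_apply, map_mul, Module.End.mul_apply, quotRep, U.lift_f, quotCoeff_quotF]

theorem hwFun_K_mul (u : U D) (a : Fin r → ℤ) :
    hwFun D lam (U.K D a * u) = qpow (D.pair a lam) * hwFun D lam u := by
  rw [hwFun_apply, map_mul, Module.End.mul_apply, quotRep, U.lift_K, quotCoeff_quotK]; rfl

theorem hwFun_mul_K (u : U D) (a : Fin r → ℤ) :
    hwFun D lam (u * U.K D a) = qpow (D.pair a lam) * hwFun D lam u := by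
  rw [hwFun_apply, map_mul, Module.End.mul_apply, quotRep, U.lift_K, quotK_mk, wordK_single,
    wordWt_nil, sub_zero, Submodule.Quotient.mk_smul, map_smul, map_smul, smul_eq_mul]; rfl

theorem hwFun_K (a : Fin r → ℤ) : hwFun D lam (U.K D a) = qpow (D.pair a lam) := by
  rw [← mul_one (U.K D a), hwFun_K_mul, hwFun_one, mul_one]

/-! ### Triangular decomposition and the pairing -/

theorem U_induction {p : U D → Prop} (halg : ∀ c, p (algebraMap QField (U D) c))
    (hK : ∀ a, p (U.K D a)) (he : ∀ i, p (U.e D i)) (hf : ∀ i, p (U.f D i))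
    (hmul : ∀ x y, p x → p y → p (x * y)) (hadd : ∀ x y, p x → p y → p (x + y)) (u : U D) :
    p u := by
  obtain ⟨x, rfl⟩ := RingQuot.mkAlgHom_surjective QField (Rel D) u
  change p (U.mk D x)
  induction x using FreeAlgebra.induction with
  | grade0 c => rw [AlgHom.commutes]; exact halg c
  | grade1 g => cases g with
    | K a => exact hK a
    | e i => exact he i
    | f i => exact hf i
  | mul a b ha hb => rw [map_mul]; exact hmul _ _ ha hb
  | add a b ha hb => rw [map_add]; exact hadd _ _ ha hb

/-- The product of the `e_i` over a word. -/
def eWord (w : List (Fin r)) : U D := (w.map (U.e D)).prod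

/-- The product of the `f_i` over a word. -/
def fWord (w : List (Fin r)) : U D := (w.map (U.f D)).prod

theorem eWord_nil : eWord D [] = 1 := rfl

theorem fWord_nil : fWord D [] = 1 := rfl

theorem eWord_cons (i : Fin r) (w : List (Fin r)) : eWord D (i :: w) = U.e D i * eWord D w := by
  simp [eWord]

theorem fWord_cons (i : Fin r) (w : List (Fin r)) : fWord D (i :: w) = U.f D i * fWord D w := by
  simp [fWord]

theorem eWord_append (v w : List (Fin r)) : eWord D (v ++ w) = eWord D v * eWord D w := by
  simp [eWord]

theorem eWord_mem (w : List (Fin r)) : eWord D w ∈ Upos D := by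
  refine Subalgebra.list_prod_mem _ fun x hx => ?_
  obtain ⟨i, -, rfl⟩ := List.mem_map.mp hx
  exact Algebra.subset_adjoin ⟨i, rfl⟩

theorem fWord_mem (w : List (Fin r)) : fWord D w ∈ Uneg D := by
  refine Subalgebra.list_prod_mem _ fun x hx => ?_
  obtain ⟨i, -, rfl⟩ := List.mem_map.mp hx
  exact Algebra.subset_adjoin ⟨i, rfl⟩

theorem Upos_eq_span :
    Subalgebra.toSubmodule (Upos D) = Submodule.span QField (Set.range (eWord D)) := by
  refine le_antisymm ?_ (Submodule.span_le.mpr ?_)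
  · rw [Upos, Algebra.adjoin_eq_span]
    refine Submodule.span_mono fun x hx => ?_
    obtain ⟨l, hl, rfl⟩ := Submonoid.exists_list_of_mem_closure hx
    clear hx
    induction l with
    | nil => exact ⟨[], rfl⟩
    | cons a l ih =>
      obtain ⟨w, hw⟩ := ih fun y hy => hl y (List.mem_cons_of_mem _ hy)
      obtain ⟨i, rfl⟩ := hl a List.mem_cons_self
      exact ⟨i :: w, by rw [eWord_cons, hw, List.prod_cons]⟩
  · rintro _ ⟨w, rfl⟩
    exact eWord_mem D w

theorem K_mul_eWord (a : Fin r → ℤ) (w : List (Fin r)) :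
    U.K D a * eWord D w = qpow (D.pair a (wordWt w)) • (eWord D w * U.K D a) := by
  induction w with
  | nil => rw [eWord_nil, wordWt_nil, pair_zero_right, qpow_zero, one_smul, mul_one, one_mul]
  | cons i w ih =>
    rw [eWord_cons, ← mul_assoc, (U.qrel D).K_e, smul_mul_assoc, mul_assoc, ih, mul_smul_comm,
      smul_smul, ← qpow_add, pair_wordWt_cons, mul_assoc]

theorem K_mul_fWord (a : Fin r → ℤ) (w : List (Fin r)) :
    U.K D a * fWord D w = qpow (-D.pair a (wordWt w)) • (fWord D w * U.K D a) := by
  induction w with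
  | nil => rw [fWord_nil, wordWt_nil, pair_zero_right, neg_zero, qpow_zero, one_smul, mul_one,
      one_mul]
  | cons i w ih =>
    rw [fWord_cons, ← mul_assoc, (U.qrel D).K_f, smul_mul_assoc, mul_assoc, ih, mul_smul_comm,
      smul_smul, ← qpow_add, pair_wordWt_cons, neg_add, mul_assoc]

/-- The triangular products of words and torus elements. -/
def triangularSet : Set (U D) :=
  Set.range fun p : List (Fin r) × (Fin r → ℤ) × List (Fin r) =>
    fWord D p.1 * U.K D p.2.1 * eWord D p.2.2

/-- The spanning half of the triangular decomposition. -/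
theorem span_triangularSet : Submodule.span QField (triangularSet D) = ⊤ := by
  set S := Submodule.span QField (triangularSet D) with hS
  have hmem : ∀ w a w', fWord D w * U.K D a * eWord D w' ∈ S := fun w a w' =>
    Submodule.subset_span ⟨(w, a, w'), rfl⟩
  have hlift : ∀ g : U D, (∀ w a w', g * (fWord D w * U.K D a * eWord D w') ∈ S) →
      ∀ s ∈ S, g * s ∈ S := by
    intro g hg s hs
    induction hs using Submodule.span_induction with
    | mem x hx => obtain ⟨⟨w, a, w'⟩, rfl⟩ := hx; exact hg w a w'
    | zero => rw [mul_zero]; exact S.zero_mem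
    | add x y _ _ hx hy => rw [mul_add]; exact S.add_mem hx hy
    | smul c x _ hx => rw [mul_smul_comm]; exact S.smul_mem c hx
  have hf : ∀ i, ∀ s ∈ S, U.f D i * s ∈ S := fun i => hlift _ fun w a w' => by
    have := hmem (i :: w) a w'
    rwa [fWord_cons, mul_assoc (U.f D i), mul_assoc (U.f D i)] at this
  have hK : ∀ b, ∀ s ∈ S, U.K D b * s ∈ S := fun b => hlift _ fun w a w' => by
    rw [← mul_assoc, ← mul_assoc, K_mul_fWord, smul_mul_assoc, smul_mul_assoc,
      mul_assoc (fWord D w), ← (U.qrel D).K_add]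
    exact S.smul_mem _ (hmem _ _ _)
  have he : ∀ i, ∀ s ∈ S, U.e D i * s ∈ S := fun i => hlift _ fun w a w' => by
    induction w with
    | nil =>
      have := hmem [] a (i :: w')
      rw [fWord_nil, one_mul, ← mul_assoc, U.e_K, smul_mul_assoc, mul_assoc, ← eWord_cons]
      rw [fWord_nil, one_mul] at this
      exact S.smul_mem _ this
    | cons j w ih =>
      have h := (U.qrel D).e_f i j
      rw [sub_eq_iff_eq_add] at h
      rw [fWord_cons, mul_assoc (U.f D j), mul_assoc (U.f D j), ← mul_assoc, h, add_mul,
        mul_assoc (U.f D j)]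
      refine S.add_mem ?_ (hf j _ ih)
      split_ifs
      · rw [smul_mul_assoc, sub_mul]
        exact S.smul_mem _ (S.sub_mem (hK _ _ (hmem _ _ _)) (hK _ _ (hmem _ _ _)))
      · rw [zero_mul]; exact S.zero_mem
  have hall : ∀ u : U D, ∀ s ∈ S, u * s ∈ S := by
    intro u
    induction u using U_induction D with
    | halg c => intro s hs; rw [← Algebra.smul_def]; exact S.smul_mem c hs
    | hK a => exact hK a
    | he i => exact he i
    | hf i => exact hf i
    | hmul x y hx hy => intro s hs; rw [mul_assoc]; exact hx _ (hy _ hs)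
    | hadd x y hx hy => intro s hs; rw [add_mul]; exact S.add_mem (hx _ hs) (hy _ hs)
  have h1 : (1 : U D) ∈ S := by
    have := hmem [] 0 []
    rwa [fWord_nil, eWord_nil, (U.qrel D).K_zero, mul_one, mul_one] at this
  exact eq_top_iff.mpr fun u _ => by simpa using hall u 1 h1

theorem triangular_induction {p : U D → Prop}
    (hmem : ∀ w a w', p (fWord D w * U.K D a * eWord D w')) (hzero : p 0)
    (hadd : ∀ x y, p x → p y → p (x + y)) (hsmul : ∀ (c : QField) x, p x → p (c • x)) (u : U D) :
    p u := by
  have hu : u ∈ Submodule.span QField (triangularSet D) := by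
    rw [span_triangularSet]; exact Submodule.mem_top
  induction hu using Submodule.span_induction with
  | mem x hx => obtain ⟨⟨w, a, w'⟩, rfl⟩ := hx; exact hmem w a w'
  | zero => exact hzero
  | add x y _ _ hx hy => exact hadd x y hx hy
  | smul c x _ hx => exact hsmul c x hx

theorem counit_e (i : Fin r) : counit D (U.e D i) = 0 := U.lift_e D _ i

theorem counit_f (i : Fin r) : counit D (U.f D i) = 0 := U.lift_f D _ i

theorem hwFun_Uneg_mul {y : U D} (hy : y ∈ Uneg D) (u : U D) :
    hwFun D lam (y * u) = counit D y * hwFun D lam u := by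
  induction hy using Algebra.adjoin_induction generalizing u with
  | mem x hx => obtain ⟨i, rfl⟩ := hx; rw [hwFun_f_mul, counit_f, zero_mul]
  | algebraMap c => rw [← Algebra.smul_def, map_smul, AlgHom.commutes]; rfl
  | add x y _ _ hx hy => rw [add_mul, map_add, hx, hy, map_add, add_mul]
  | mul x y _ _ hx hy => rw [mul_assoc, hx, hy, map_mul, mul_assoc]

theorem hwFun_mul_Upos {x : U D} (hx : x ∈ Upos D) (u : U D) :
    hwFun D lam (u * x) = counit D x * hwFun D lam u := by
  induction hx using Algebra.adjoin_induction generalizing u with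
  | mem x hx => obtain ⟨i, rfl⟩ := hx; rw [hwFun_mul_e, counit_e, zero_mul]
  | algebraMap c => rw [← Algebra.commutes, ← Algebra.smul_def, map_smul, AlgHom.commutes]; rfl
  | add x y _ _ hx hy => rw [mul_add, map_add, hx, hy, map_add, add_mul]
  | mul x y _ _ hx hy => rw [← mul_assoc, hy, hx, map_mul, mul_left_comm, mul_assoc]

theorem hwFun_zeroPartKer {u : U D} (hu : u ∈ zeroPartKer D) : hwFun D lam u = 0 := by
  obtain ⟨v, hv, w, hw, rfl⟩ := Submodule.mem_sup.mp hu
  clear hu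
  rw [map_add]
  have h1 : hwFun D lam v = 0 := by
    induction hv using Submodule.mul_induction_on' with
    | mem_mul_mem y hy u _ =>
      rw [hwFun_Uneg_mul D lam hy.1, show counit D y = 0 from hy.2, zero_mul]
    | add x _ y _ hx hy => rw [map_add, hx, hy, add_zero]
  have h2 : hwFun D lam w = 0 := by
    induction hw using Submodule.mul_induction_on' with
    | mem_mul_mem u _ x hx =>
      rw [hwFun_mul_Upos D lam hx.1, show counit D x = 0 from hx.2, zero_mul]
    | add x _ y _ hx hy => rw [map_add, hx, hy, add_zero]
  rw [h1, h2, add_zero]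

theorem torusMap_single (a : Fin r → ℤ) (c : QField) :
    torusMap D (AddMonoidAlgebra.single a c) = c • U.K D a := by
  rw [torusMap, AddMonoidAlgebra.lift_single]; rfl

theorem hwFun_torusMap (z : TorusAlg r) : hwFun D lam (torusMap D z) = qchar D lam z := by
  induction z using AddMonoidAlgebra.induction_linear with
  | zero => simp
  | add f g hf hg => rw [map_add, map_add, map_add, hf, hg]
  | single a c =>
    rw [torusMap_single, map_smul, hwFun_K, qchar, AddMonoidAlgebra.lift_single]; rfl

theorem fWord_mul_mem_zeroPartKer {w : List (Fin r)} (hw : w ≠ []) (u : U D) :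
    fWord D w * u ∈ zeroPartKer D := by
  refine Submodule.mem_sup_left (Submodule.mul_mem_mul ⟨fWord_mem D w, ?_⟩ Submodule.mem_top)
  obtain ⟨i, w, rfl⟩ := List.exists_cons_of_ne_nil hw
  change counit D _ = 0
  rw [fWord_cons, map_mul, counit_f, zero_mul]

theorem mul_eWord_mem_zeroPartKer {w : List (Fin r)} (hw : w ≠ []) (u : U D) :
    u * eWord D w ∈ zeroPartKer D := by
  refine Submodule.mem_sup_right (Submodule.mul_mem_mul Submodule.mem_top ⟨eWord_mem D w, ?_⟩)
  obtain ⟨i, w, rfl⟩ := List.exists_cons_of_ne_nil hw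
  change counit D _ = 0
  rw [eWord_cons, map_mul, counit_e, zero_mul]

theorem exists_sub_mem_zeroPartKer (u : U D) : ∃ z, u - torusMap D z ∈ zeroPartKer D := by
  induction u using triangular_induction D with
  | hmem w a w' =>
    by_cases hw : w = []
    · by_cases hw' : w' = []
      · refine ⟨AddMonoidAlgebra.single a 1, ?_⟩
        rw [hw, hw', torusMap_single, fWord_nil, eWord_nil, one_smul, one_mul, mul_one, sub_self]
        exact Submodule.zero_mem _
      · exact ⟨0, by rw [map_zero, sub_zero]; exact mul_eWord_mem_zeroPartKer D hw' _⟩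
    · exact ⟨0, by rw [map_zero, sub_zero, mul_assoc]; exact fWord_mul_mem_zeroPartKer D hw _⟩
  | hzero => exact ⟨0, by rw [map_zero, sub_zero]; exact Submodule.zero_mem _⟩
  | hadd x y hx hy =>
    obtain ⟨z, hz⟩ := hx
    obtain ⟨z', hz'⟩ := hy
    refine ⟨z + z', ?_⟩
    rw [map_add, add_sub_add_comm]
    exact Submodule.add_mem _ hz hz'
  | hsmul c x hx =>
    obtain ⟨z, hz⟩ := hx
    refine ⟨c • z, ?_⟩
    rw [map_smul, ← smul_sub]
    exact Submodule.smul_mem _ c hz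

theorem pairing_eq (x y : U D) :
    pairing D lam x y = hwFun D lam ((antipode D x).unop * y) := by
  have h : (antipode D x).unop * y - torusMap D (zeroPart D ((antipode D x).unop * y)) ∈
      zeroPartKer D :=
    Classical.epsilon_spec (exists_sub_mem_zeroPartKer D _)
  have h2 := hwFun_zeroPartKer D lam h
  rw [map_sub, sub_eq_zero, hwFun_torusMap] at h2
  rw [h2, pairing]

/-! ### The symmetry exchanging the two kernels of the pairing -/

theorem theta_K (a : Fin r → ℤ) : theta D (U.K D a) = U.K D (-a) := U.lift_K D _ a

theorem theta_e (i : Fin r) : theta D (U.e D i) = -U.f D i := U.lift_e D _ i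

theorem theta_f (i : Fin r) : theta D (U.f D i) = -U.e D i := U.lift_f D _ i

theorem antipode_K (a : Fin r → ℤ) : (antipode D (U.K D a)).unop = U.K D (-a) :=
  congrArg MulOpposite.unop (U.lift_K D _ a)

theorem antipode_e (i : Fin r) :
    (antipode D (U.e D i)).unop = -(U.K D (-D.kExp i) * U.e D i) :=
  congrArg MulOpposite.unop (U.lift_e D _ i)

theorem antipode_f (i : Fin r) :
    (antipode D (U.f D i)).unop = -(U.f D i * U.K D (D.kExp i)) :=
  congrArg MulOpposite.unop (U.lift_f D _ i)

theorem antipode_mul (x y : U D) :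
    (antipode D (x * y)).unop = (antipode D y).unop * (antipode D x).unop := by
  rw [map_mul, MulOpposite.unop_mul]

theorem antipode_algebraMap (c : QField) :
    (antipode D (algebraMap QField (U D) c)).unop = algebraMap QField (U D) c := by
  rw [AlgHom.commutes]; rfl

theorem antipode_neg (x : U D) : (antipode D (-x)).unop = -(antipode D x).unop := by
  rw [map_neg, MulOpposite.unop_neg]

theorem antipode_add (x y : U D) :
    (antipode D (x + y)).unop = (antipode D x).unop + (antipode D y).unop := by
  rw [map_add, MulOpposite.unop_add]

theorem antipode_smul (c : QField) (x : U D) :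
    (antipode D (c • x)).unop = c • (antipode D x).unop := by
  rw [map_smul, MulOpposite.unop_smul]

theorem K_mul_K_neg (a : Fin r → ℤ) : U.K D a * U.K D (-a) = 1 := by
  rw [← (U.qrel D).K_add, add_neg_cancel, (U.qrel D).K_zero]

theorem K_neg_mul_K (a : Fin r → ℤ) : U.K D (-a) * U.K D a = 1 := by
  rw [← (U.qrel D).K_add, neg_add_cancel, (U.qrel D).K_zero]

theorem theta_theta (u : U D) : theta D (theta D u) = u := by
  induction u using U_induction D with
  | halg c => rw [AlgHom.commutes, AlgHom.commutes]
  | hK a => rw [theta_K, theta_K, neg_neg]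
  | he i => rw [theta_e, map_neg, theta_f, neg_neg]
  | hf i => rw [theta_f, map_neg, theta_e, neg_neg]
  | hmul x y hx hy => rw [map_mul, map_mul, hx, hy]
  | hadd x y hx hy => rw [map_add, map_add, hx, hy]

theorem antipode_theta_antipode (u : U D) :
    (antipode D (theta D (antipode D u).unop)).unop = theta D u := by
  induction u using U_induction D with
  | halg c => rw [antipode_algebraMap, AlgHom.commutes, antipode_algebraMap]
  | hK a => rw [antipode_K, theta_K, antipode_K, theta_K, neg_neg]
  | he i =>
    rw [antipode_e, map_neg, map_mul, theta_K, theta_e, neg_neg, mul_neg, neg_neg, antipode_mul,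
      antipode_f, antipode_K, neg_mul, mul_assoc, K_mul_K_neg, mul_one]
  | hf i =>
    rw [antipode_f, map_neg, map_mul, theta_K, theta_f, neg_mul, neg_neg, antipode_mul,
      antipode_e, antipode_K, neg_neg, mul_neg, ← mul_assoc, K_mul_K_neg, one_mul]
  | hmul x y hx hy => rw [antipode_mul, map_mul, antipode_mul, hx, hy, map_mul]
  | hadd x y hx hy => rw [antipode_add, map_add, antipode_add, hx, hy, map_add]

/-- The functional `hwFun` is invariant under the antiautomorphism `σ ∘ θ`, which exchanges `U⁺` and
`U⁻` up to the torus and fixes the torus. -/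
theorem hwFun_antipode_theta (u : U D) :
    hwFun D lam (antipode D (theta D u)).unop = hwFun D lam u := by
  induction u using triangular_induction D with
  | hmem w a w' =>
    rw [map_mul (theta D), antipode_mul, map_mul (theta D), antipode_mul, theta_K, antipode_K,
      neg_neg]
    cases w with
    | nil =>
      rw [fWord_nil, map_one, map_one, MulOpposite.unop_one, mul_one, one_mul]
      induction w' using List.reverseRecOn with
      | nil => rw [eWord_nil, map_one, map_one, MulOpposite.unop_one, one_mul, mul_one]
      | append_singleton w' i _ =>
        rw [eWord_append, eWord_cons, eWord_nil, mul_one, ← mul_assoc, hwFun_mul_e,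
          map_mul (theta D), antipode_mul, theta_e, antipode_neg, antipode_f, neg_neg, mul_assoc, mul_assoc,
          hwFun_f_mul]
    | cons i w =>
      rw [fWord_cons, map_mul (theta D), antipode_mul, theta_f, antipode_neg, antipode_e, neg_neg,
        mul_assoc (U.f D i), mul_assoc (U.f D i), hwFun_f_mul, ← mul_assoc, ← mul_assoc,
        ← mul_assoc, hwFun_mul_e]
  | hzero => simp
  | hadd x y hx hy => rw [map_add, antipode_add, map_add, hx, hy, map_add]
  | hsmul c x hx => rw [map_smul, antipode_smul, map_smul, hx, map_smul]

theorem pairing_theta (x y : U D) :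
    pairing D lam (theta D y) (theta D x) = pairing D lam x y := by
  rw [pairing_eq, pairing_eq, ← antipode_theta_antipode D x, ← antipode_mul, ← map_mul,
    hwFun_antipode_theta]

theorem theta_mem_Upos {y : U D} (hy : y ∈ Uneg D) : theta D y ∈ Upos D := by
  have h : Uneg D ≤ (Upos D).comap (theta D) := by
    refine Algebra.adjoin_le ?_
    rintro _ ⟨i, rfl⟩
    change theta D _ ∈ Upos D
    rw [theta_f]
    exact neg_mem (Algebra.subset_adjoin ⟨i, rfl⟩)
  exact h hy

theorem theta_mem_Uneg {x : U D} (hx : x ∈ Upos D) : theta D x ∈ Uneg D := by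
  have h : Upos D ≤ (Uneg D).comap (theta D) := by
    refine Algebra.adjoin_le ?_
    rintro _ ⟨i, rfl⟩
    change theta D _ ∈ Uneg D
    rw [theta_e]
    exact neg_mem (Algebra.subset_adjoin ⟨i, rfl⟩)
  exact h hx

theorem Kpos_eq : Kpos D lam = theta D '' Kneg D lam := by
  ext x
  constructor
  · rintro ⟨hx, h⟩
    refine ⟨theta D x, ⟨theta_mem_Uneg D hx, fun x' hx' => ?_⟩, theta_theta D x⟩
    rw [← pairing_theta, theta_theta]
    exact h _ (theta_mem_Uneg D hx')
  · rintro ⟨y, ⟨hy, h⟩, rfl⟩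
    refine ⟨theta_mem_Upos D hy, fun y' hy' => ?_⟩
    rw [← theta_theta D y', pairing_theta]
    exact h _ (theta_mem_Upos D hy')

/-! ### The irreducible highest weight module -/

/-- The left ideal of the `u` with `hwFun (a * u) = 0` for all `a`. It is the annihilator of the
highest weight vector of `L(λ)`. -/
def hwIdeal : Submodule (U D) (U D) where
  carrier := {u | ∀ a, hwFun D lam (a * u) = 0}
  zero_mem' a := by rw [mul_zero, map_zero]
  add_mem' h h' a := by rw [mul_add, map_add, h a, h' a, add_zero]
  smul_mem' b u h a := by rw [smul_eq_mul, ← mul_assoc, h]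

theorem vermaIdeal_le_hwIdeal : vermaIdeal D lam ≤ hwIdeal D lam := by
  refine Submodule.span_le.mpr ?_
  rintro _ (⟨i, rfl⟩ | ⟨a, rfl⟩) u
  · exact hwFun_mul_e D lam u i
  · rw [mul_sub, map_sub, hwFun_mul_K, ← Algebra.commutes, ← Algebra.smul_def, map_smul,
      smul_eq_mul, sub_self]

theorem one_notMem_hwIdeal : (1 : U D) ∉ hwIdeal D lam := fun h => by
  have := h 1
  rw [mul_one, hwFun_one] at this
  exact one_ne_zero this

/-- The span of the nonempty products of the `f_i`. -/
def fWordSpan : Submodule QField (U D) := Submodule.span QField (fWord D '' {w | w ≠ []})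

theorem fWordSpan_le : fWordSpan D ≤ Subalgebra.toSubmodule (Uneg D) :=
  Submodule.span_le.mpr fun _ ⟨w, _, h⟩ => h ▸ fWord_mem D w

theorem sub_hwFun_mem (u : U D) : u - hwFun D lam u • 1 ∈
    fWordSpan D ⊔ (vermaIdeal D lam).restrictScalars QField := by
  induction u using triangular_induction D with
  | hmem w a w' =>
    by_cases hw' : w' = []
    · have h1 : fWord D w * U.K D a - qpow (D.pair a lam) • fWord D w ∈ vermaIdeal D lam := by
        have := (vermaIdeal D lam).smul_mem (fWord D w)
          (Submodule.subset_span (Or.inr ⟨a, rfl⟩))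
        rwa [smul_eq_mul, mul_sub, ← Algebra.commutes, ← Algebra.smul_def] at this
      rw [hw', eWord_nil, mul_one, hwFun_mul_K,
        ← sub_add_sub_cancel _ (qpow (D.pair a lam) • fWord D w)]
      refine add_mem (Submodule.mem_sup_right h1) ?_
      by_cases hw : w = []
      · rw [hw, fWord_nil, hwFun_one, mul_one, sub_self]
        exact Submodule.zero_mem _
      · have h2 : hwFun D lam (fWord D w) = 0 := by
          obtain ⟨i, w, rfl⟩ := List.exists_cons_of_ne_nil hw
          rw [fWord_cons, hwFun_f_mul]
        rw [h2, mul_zero, zero_smul, sub_zero]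
        exact Submodule.mem_sup_left (Submodule.smul_mem _ _ (Submodule.subset_span ⟨w, hw, rfl⟩))
    · obtain ⟨v, i, rfl⟩ := List.eq_nil_or_concat' w' |>.resolve_left hw'
      have h1 : fWord D w * U.K D a * eWord D (v ++ [i]) ∈ vermaIdeal D lam := by
        rw [eWord_append, eWord_cons, eWord_nil, mul_one, ← mul_assoc]
        exact (vermaIdeal D lam).smul_mem _ (Submodule.subset_span (Or.inl ⟨i, rfl⟩))
      have h2 := vermaIdeal_le_hwIdeal D lam h1 1
      rw [one_mul] at h2
      rw [h2, zero_smul, sub_zero]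
      exact Submodule.mem_sup_right h1
  | hzero => rw [map_zero, zero_smul, sub_zero]; exact Submodule.zero_mem _
  | hadd x y hx hy => rw [map_add, add_smul, add_sub_add_comm]; exact add_mem hx hy
  | hsmul c x hx => rw [map_smul, smul_assoc, ← smul_sub]; exact Submodule.smul_mem _ c hx

theorem length_le_pair_one (w : List (Fin r)) : (w.length : ℚ) ≤ D.pair 1 (wordWt w) := by
  induction w with
  | nil => simp [wordWt_nil, pair_zero_right]
  | cons i w ih =>
    rw [pair_wordWt_cons]
    have h1 : (1 : ℚ) ≤ D.d i := by exact_mod_cast D.d_pos i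
    simp only [Pi.one_apply, Int.cast_one, one_mul, List.length_cons]
    push_cast
    linarith

theorem pair_one_wordWt_pos {w : List (Fin r)} (hw : w ≠ []) : 0 < D.pair 1 (wordWt w) :=
  lt_of_lt_of_le (by exact_mod_cast List.length_pos_iff.mpr hw) (length_le_pair_one D w)

/-- A proper submodule of the Verma module (`I` is its preimage in `U`) contains no vector with a
nonzero component along the generator: in the quotient by it, the element `∏ t_i` of the torus
separates the weight `λ` of the generator from the other weights. -/
theorem hwFun_eq_zero_of_mem {I : Submodule (U D) (U D)} (hI : vermaIdeal D lam ≤ I) (h1 : I ≠ ⊤)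
    {u : U D} (hu : u ∈ I) : hwFun D lam u = 0 := by
  let T : Module.End QField (U D ⧸ I) := Algebra.lsmul QField QField (U D ⧸ I) (U.K D 1)
  let π : U D →ₗ[QField] U D ⧸ I := I.mkQ.restrictScalars QField
  have hT : ∀ v, T (π v) = π (U.K D 1 * v) := fun v => rfl
  have hker : ∀ v ∈ I, π v = 0 := fun v hv => (Submodule.Quotient.mk_eq_zero I).mpr hv
  have hK : π (U.K D 1) = qpow (D.pair 1 lam) • π 1 := by
    have := hker _ (hI (Submodule.subset_span (Or.inr ⟨1, rfl⟩)))
    rwa [map_sub, sub_eq_zero, Algebra.algebraMap_eq_smul_one, map_smul] at this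
  have hone : π 1 ∈ T.eigenspace (qpow (D.pair 1 lam)) := by
    rw [Module.End.mem_eigenspace_iff, hT, mul_one, hK]
  have hlow : fWordSpan D ≤
      (⨆ c ≠ qpow (D.pair 1 lam), T.eigenspace c).comap π := by
    refine Submodule.span_le.mpr ?_
    rintro _ ⟨w, hw, rfl⟩
    have hpos := pair_one_wordWt_pos D hw
    refine Submodule.mem_iSup_of_mem (qpow (-D.pair 1 (wordWt w) + D.pair 1 lam))
      (Submodule.mem_iSup_of_mem (fun h => ?_) ?_)
    · have := qpow_injective h
      linarith
    · rw [Module.End.mem_eigenspace_iff, hT, K_mul_fWord, map_smul, qpow_add, mul_smul]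
      congr 1
      have h2 : fWord D w * U.K D 1 - qpow (D.pair 1 lam) • fWord D w ∈ I := by
        have := hI ((vermaIdeal D lam).smul_mem (fWord D w)
          (Submodule.subset_span (Or.inr ⟨1, rfl⟩)))
        rwa [smul_eq_mul, mul_sub, ← Algebra.commutes, ← Algebra.smul_def] at this
      have := hker _ h2
      rwa [map_sub, sub_eq_zero, map_smul] at this
  obtain ⟨y, hy, z, hz, hyz⟩ := Submodule.mem_sup.mp (sub_hwFun_mem D lam u)
  have h2 := congrArg π hyz
  rw [map_add, hker z (hI hz), add_zero, map_sub, hker u hu, zero_sub, map_smul] at h2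
  have h3 := (T.eigenspaces_iSupIndep (qpow (D.pair 1 lam))).le_bot
    ⟨Submodule.smul_mem _ (hwFun D lam u) hone, neg_mem_iff.mp (h2 ▸ hlow hy)⟩
  rw [Submodule.mem_bot] at h3
  rcases smul_eq_zero.mp h3 with h | h
  · exact h
  · have h4 : (1 : U D) ∈ I := (Submodule.Quotient.mk_eq_zero I).mp h
    exact absurd (eq_top_iff.mpr fun v _ => by simpa using I.smul_mem v h4) h1

theorem vermaMax_eq : vermaMax D lam = (hwIdeal D lam).map (vermaIdeal D lam).mkQ := by
  have hcomap : ((hwIdeal D lam).map (vermaIdeal D lam).mkQ).comap (vermaIdeal D lam).mkQ =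
      hwIdeal D lam := by
    rw [Submodule.comap_map_eq, Submodule.ker_mkQ, sup_eq_left]
    exact vermaIdeal_le_hwIdeal D lam
  refine le_antisymm (sSup_le fun N hN => ?_) (le_sSup fun h => ?_)
  · intro x hx
    obtain ⟨u, rfl⟩ := Submodule.mkQ_surjective _ x
    refine ⟨u, fun a => ?_, rfl⟩
    refine hwFun_eq_zero_of_mem D lam (I := N.comap (vermaIdeal D lam).mkQ) ?_ ?_
      (Submodule.smul_mem _ a hx)
    · intro v hv
      have h0 : (vermaIdeal D lam).mkQ v = 0 := (Submodule.Quotient.mk_eq_zero _).mpr hv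
      rw [Submodule.mem_comap, h0]
      exact N.zero_mem
    · intro h
      refine hN (eq_top_iff.mpr fun y _ => ?_)
      obtain ⟨v, rfl⟩ := Submodule.mkQ_surjective _ y
      have : v ∈ N.comap (vermaIdeal D lam).mkQ := by rw [h]; exact Submodule.mem_top
      exact this
  · rw [h, Submodule.comap_top] at hcomap
    exact one_notMem_hwIdeal D lam (hcomap ▸ Submodule.mem_top)

theorem smul_hwVec_eq_zero_iff {u : U D} : u • hwVec D lam = 0 ↔ u ∈ hwIdeal D lam := by
  have h : u • hwVec D lam = Submodule.Quotient.mk (Submodule.Quotient.mk u) := by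
    rw [hwVec, ← Submodule.Quotient.mk_smul, ← Submodule.Quotient.mk_smul, smul_eq_mul, mul_one]
  rw [h, Submodule.Quotient.mk_eq_zero, vermaMax_eq]
  constructor
  · rintro ⟨v, hv, hvu⟩
    have h2 := vermaIdeal_le_hwIdeal D lam ((Submodule.Quotient.eq _).mp hvu)
    have h3 := sub_mem hv h2
    rwa [sub_sub_cancel] at h3
  · exact fun hu => ⟨u, hu, rfl⟩

/-- The map `u ↦ u 1_λ` from `U` to `L(λ)`. -/
def orbitMap : U D →ₗ[QField] Irr D lam :=
  (LinearMap.toSpanSingleton (U D) (Irr D lam) (hwVec D lam)).restrictScalars QField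

theorem orbitMap_apply (u : U D) : orbitMap D lam u = u • hwVec D lam := rfl

theorem orbitMap_surjective : Function.Surjective (orbitMap D lam) := by
  intro x
  obtain ⟨y, rfl⟩ := Submodule.mkQ_surjective _ x
  obtain ⟨u, rfl⟩ := Submodule.mkQ_surjective _ y
  refine ⟨u, ?_⟩
  rw [orbitMap_apply, hwVec, ← Submodule.Quotient.mk_smul, ← Submodule.Quotient.mk_smul,
    smul_eq_mul, mul_one]
  rfl

section Descend

variable {W : Type*} [AddCommGroup W] [Module QField W]

/-- A linear map on `U` that vanishes on the annihilator of the highest weight vector induces a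
linear map on `L(λ)`. -/
def descend (g : U D →ₗ[QField] W) (hg : ∀ u, u • hwVec D lam = 0 → g u = 0) :
    Irr D lam →ₗ[QField] W :=
  (LinearMap.ker (orbitMap D lam)).liftQ g (fun u hu => hg u (LinearMap.mem_ker.mp hu)) ∘ₗ
    ((orbitMap D lam).quotKerEquivOfSurjective (orbitMap_surjective D lam)).symm.toLinearMap

theorem descend_smul_hwVec (g : U D →ₗ[QField] W) (hg : ∀ u, u • hwVec D lam = 0 → g u = 0)
    (u : U D) : descend D lam g hg (u • hwVec D lam) = g u := by
  have h : ((orbitMap D lam).quotKerEquivOfSurjective (orbitMap_surjective D lam)).symm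
      (u • hwVec D lam) = Submodule.Quotient.mk u := by
    rw [LinearEquiv.symm_apply_eq]; rfl
  rw [descend, LinearMap.comp_apply, LinearEquiv.coe_coe, h]
  exact Submodule.liftQ_apply _ _ _

end Descend

/-- The coefficient of the highest weight vector, as a functional on `L(λ)`. -/
def hwCoeff : Module.Dual QField (Irr D lam) :=
  descend D lam (hwFun D lam) fun u hu => by
    simpa using (smul_hwVec_eq_zero_iff D lam).mp hu 1

theorem hwCoeff_smul_hwVec (u : U D) : hwCoeff D lam (u • hwVec D lam) = hwFun D lam u :=
  descend_smul_hwVec D lam _ _ u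

theorem hwCoeff_hwVec : hwCoeff D lam (hwVec D lam) = 1 := by
  rw [← one_smul (U D) (hwVec D lam), hwCoeff_smul_hwVec, hwFun_one]

theorem exists_smul_hwVec (v : Irr D lam) : ∃ u : U D, u • hwVec D lam = v :=
  orbitMap_surjective D lam v

theorem hwCoeff_f_smul (i : Fin r) (v : Irr D lam) : hwCoeff D lam (U.f D i • v) = 0 := by
  obtain ⟨u, rfl⟩ := exists_smul_hwVec D lam v
  rw [smul_smul, hwCoeff_smul_hwVec, hwFun_f_mul]

theorem hwCoeff_K_smul (a : Fin r → ℤ) (v : Irr D lam) :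
    hwCoeff D lam (U.K D a • v) = qpow (D.pair a lam) * hwCoeff D lam v := by
  obtain ⟨u, rfl⟩ := exists_smul_hwVec D lam v
  rw [smul_smul, hwCoeff_smul_hwVec, hwFun_K_mul, hwCoeff_smul_hwVec]

theorem K_smul_hwVec (a : Fin r → ℤ) :
    U.K D a • hwVec D lam = qpow (D.pair a lam) • hwVec D lam := by
  have h : (U.K D a - algebraMap QField (U D) (qpow (D.pair a lam))) • hwVec D lam = 0 :=
    (smul_hwVec_eq_zero_iff D lam).mpr
      (vermaIdeal_le_hwIdeal D lam (Submodule.subset_span (Or.inr ⟨a, rfl⟩)))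
  rwa [sub_smul, sub_eq_zero, algebraMap_smul] at h

theorem e_smul_hwVec (i : Fin r) : U.e D i • hwVec D lam = 0 :=
  (smul_hwVec_eq_zero_iff D lam).mpr
    (vermaIdeal_le_hwIdeal D lam (Submodule.subset_span (Or.inl ⟨i, rfl⟩)))

/-- The functionals `v ↦ hwCoeff (eWord w • v)` separate the points of `L(λ)`. -/
theorem irr_eq_zero {v : Irr D lam} (h : ∀ w, hwCoeff D lam (eWord D w • v) = 0) : v = 0 := by
  obtain ⟨u, rfl⟩ := exists_smul_hwVec D lam v
  rw [smul_hwVec_eq_zero_iff]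
  intro a
  have h' : ∀ w, hwFun D lam (eWord D w * u) = 0 := fun w => by
    rw [← hwCoeff_smul_hwVec, ← smul_smul, h]
  induction a using triangular_induction D with
  | hmem w a w' =>
    rw [mul_assoc, mul_assoc, hwFun_Uneg_mul D lam (fWord_mem D w), hwFun_K_mul, h', mul_zero,
      mul_zero]
  | hzero => rw [zero_mul, map_zero]
  | hadd x y hx hy => rw [add_mul, map_add, hx, hy, add_zero]
  | hsmul c x hx => rw [smul_mul_assoc, map_smul, hx, smul_zero]

theorem exists_Uneg_sub_smul_hwVec (u : U D) :
    ∃ y ∈ Uneg D, u - y ∈ vermaIdeal D lam := by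
  obtain ⟨y, hy, z, hz, hyz⟩ := Submodule.mem_sup.mp (sub_hwFun_mem D lam u)
  refine ⟨y + hwFun D lam u • 1, add_mem (fWordSpan_le D hy) ?_, ?_⟩
  · exact Subalgebra.smul_mem _ (one_mem _) _
  · have : u - (y + hwFun D lam u • 1) = z := by
      rw [← sub_sub, sub_right_comm, ← hyz, add_sub_cancel_left]
    rw [this]
    exact hz

theorem K_smul_fWord_smul (a : Fin r → ℤ) (w : List (Fin r)) :
    U.K D a • fWord D w • hwVec D lam =
      qpow (D.pair a lam - D.pair a (wordWt w)) • fWord D w • hwVec D lam := by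
  rw [smul_smul, K_mul_fWord, smul_assoc, ← smul_smul, K_smul_hwVec, smul_comm (fWord D w),
    smul_smul, ← qpow_add, neg_add_eq_sub]

/-- A vector of `L(λ)` minus its component along the highest weight vector is a combination of the
vectors `fWord w • hwVec` with `w` nonempty. -/
theorem sub_hwCoeff_mem (v : Irr D lam) : v - hwCoeff D lam v • hwVec D lam ∈
    Submodule.span QField ((fun w => fWord D w • hwVec D lam) '' {w | w ≠ []}) := by
  obtain ⟨u, rfl⟩ := exists_smul_hwVec D lam v
  obtain ⟨y, hy, z, hz, hyz⟩ := Submodule.mem_sup.mp (sub_hwFun_mem D lam u)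
  have h1 := congrArg (orbitMap D lam) hyz
  have h2 : orbitMap D lam z = 0 :=
    (smul_hwVec_eq_zero_iff D lam).mpr (vermaIdeal_le_hwIdeal D lam hz)
  rw [map_add, h2, add_zero, map_sub, map_smul, orbitMap_apply D lam 1, one_smul,
    orbitMap_apply D lam u] at h1
  rw [hwCoeff_smul_hwVec, ← h1]
  have h3 := Submodule.mem_map_of_mem (f := orbitMap D lam) hy
  rw [fWordSpan, Submodule.map_span, Set.image_image] at h3
  exact h3

/-! ### Tensor products and contraction with functionals -/

section Contract

variable {V W : Type*} [AddCommGroup V] [Module QField V] [AddCommMonoid W] [Module QField W]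

/-- The contraction of the first factor of `V ⊗ W` with a functional. -/
def contract (ξ : Module.Dual QField V) : V ⊗[QField] W →ₗ[QField] W :=
  (TensorProduct.lid QField W).toLinearMap ∘ₗ ξ.rTensor W

theorem contract_tmul (ξ : Module.Dual QField V) (v : V) (w : W) :
    contract ξ (v ⊗ₜ[QField] w) = ξ v • w := by
  simp [contract]

theorem contract_map (ξ : Module.Dual QField V) (S : Module.End QField V)
    (T : Module.End QField W) (t : V ⊗[QField] W) :
    contract ξ (TensorProduct.map S T t) = T (contract (ξ ∘ₗ S) t) := by
  induction t using TensorProduct.induction_on with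
  | zero => simp
  | tmul v w => rw [TensorProduct.map_tmul, contract_tmul, contract_tmul, map_smul]; rfl
  | add x y hx hy => simp only [map_add, hx, hy]

theorem contract_smul (c : QField) (ξ : Module.Dual QField V) (t : V ⊗[QField] W) :
    contract (c • ξ) t = c • contract ξ t := by
  simp [contract, LinearMap.rTensor_smul]

theorem contract_zero (t : V ⊗[QField] W) : contract (0 : Module.Dual QField V) t = 0 := by
  simp [contract]

theorem contract_add (ξ η : Module.Dual QField V) (t : V ⊗[QField] W) :
    contract (ξ + η) t = contract ξ t + contract η t := by
  simp [contract, LinearMap.rTensor_add]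

/-- If functionals separate the points of `V`, then the contractions with them separate the points
of `V ⊗ W`. -/
theorem eq_zero_of_contract {ι : Type*} (ξ : ι → Module.Dual QField V)
    (hξ : ∀ v, (∀ i, ξ i v = 0) → v = 0) {t : V ⊗[QField] W} (ht : ∀ i, contract (ξ i) t = 0) :
    t = 0 := by
  classical
  let := Module.addCommMonoidToAddCommGroup QField (M := W)
  let b := Module.Basis.ofVectorSpace QField W
  have h : ∀ (i : ι) (t : V ⊗[QField] W) k, b.repr (contract (ξ i) t) k =
      ξ i (TensorProduct.equivFinsuppOfBasisRight b t k) := by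
    intro i t k
    induction t using TensorProduct.induction_on with
    | zero => simp
    | tmul v w =>
      rw [contract_tmul, TensorProduct.equivFinsuppOfBasisRight_apply_tmul_apply]
      simp [mul_comm]
    | add x y hx hy => simp only [map_add, Finsupp.add_apply, hx, hy]
  rw [← (TensorProduct.equivFinsuppOfBasisRight b).map_eq_zero_iff]
  ext k
  rw [Finsupp.zero_apply]
  exact hξ _ fun i => by rw [← h, ht, map_zero, Finsupp.zero_apply]

variable {D} (ρ : U D →ₐ[QField] Module.End QField V) (τ : U D →ₐ[QField] Module.End QField W)

theorem tensorRep_of_comul {u a b : U D} (h : comul D u = a ⊗ₜ b) :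
    tensorRep ρ τ u = TensorProduct.map (ρ a) (τ b) := by
  simp only [tensorRep, AlgHom.comp_apply, h, Algebra.TensorProduct.map_tmul]
  rfl

theorem tensorRep_of_comul_add {u a b a' b' : U D} (h : comul D u = a ⊗ₜ b + a' ⊗ₜ b') :
    tensorRep ρ τ u = TensorProduct.map (ρ a) (τ b) + TensorProduct.map (ρ a') (τ b') := by
  simp only [tensorRep, AlgHom.comp_apply, h, map_add, Algebra.TensorProduct.map_tmul]
  rfl

theorem tensorRep_K (a : Fin r → ℤ) :
    tensorRep ρ τ (U.K D a) = TensorProduct.map (ρ (U.K D a)) (τ (U.K D a)) :=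
  tensorRep_of_comul ρ τ (U.lift_K D _ a)

theorem tensorRep_e (i : Fin r) :
    tensorRep ρ τ (U.e D i) = TensorProduct.map (ρ (U.e D i)) (τ 1) +
      TensorProduct.map (ρ (U.K D (D.kExp i))) (τ (U.e D i)) :=
  tensorRep_of_comul_add ρ τ (U.lift_e D _ i)

theorem tensorRep_f (i : Fin r) :
    tensorRep ρ τ (U.f D i) = TensorProduct.map (ρ (U.f D i)) (τ (U.K D (-D.kExp i))) +
      TensorProduct.map (ρ 1) (τ (U.f D i)) :=
  tensorRep_of_comul_add ρ τ (U.lift_f D _ i)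

theorem tensorRep_e_eq (i : Fin r) :
    tensorRep ρ τ (U.e D i) = TensorProduct.map (ρ (U.K D (D.kExp i))) 1 *
      (TensorProduct.map 1 (τ (U.e D i)) -
        TensorProduct.map (ρ (antipode D (U.e D i)).unop) 1) := by
  rw [tensorRep_e, mul_sub, ← TensorProduct.map_mul, ← TensorProduct.map_mul, antipode_e, ← map_mul,
    mul_neg, ← mul_assoc, K_mul_K_neg, one_mul, mul_one, one_mul, map_one, map_neg, mul_one]
  rw [show TensorProduct.map (-ρ (U.e D i)) (1 : Module.End QField W) =
    -TensorProduct.map (ρ (U.e D i)) 1 by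
      ext v w; simp [TensorProduct.neg_tmul]]
  abel

/-- For a vector killed by `e_i`, the action of `e_i` on the second factor is that of `σ(e_i)` on
the first one. -/
theorem tensorRep_e_eq_zero_iff (i : Fin r) (t : V ⊗[QField] W) :
    tensorRep ρ τ (U.e D i) t = 0 ↔
      TensorProduct.map (ρ (antipode D (U.e D i)).unop) 1 t =
        TensorProduct.map 1 (τ (U.e D i)) t := by
  rw [tensorRep_e_eq, Module.End.mul_apply, LinearMap.sub_apply,
    eq_comm (b := TensorProduct.map 1 _ t), ← sub_eq_zero (a := TensorProduct.map 1 _ t)]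
  constructor
  · intro h
    have h2 := congrArg (TensorProduct.map (ρ (U.K D (-D.kExp i))) (1 : Module.End QField W)) h
    rw [← Module.End.mul_apply, ← TensorProduct.map_mul, ← map_mul, K_neg_mul_K, map_one, one_mul,
      TensorProduct.map_one, Module.End.one_apply, map_zero] at h2
    exact h2
  · intro h
    rw [h, map_zero]

theorem map_eWord_mem_weightSpace {μ : Fin r → ℚ} {v : V} (hv : v ∈ weightSpace ρ μ)
    (w : List (Fin r)) : ρ (eWord D w) v ∈ weightSpace ρ (μ + wordWt w) := by
  intro a
  rw [← Module.End.mul_apply, ← map_mul, K_mul_eWord, map_smul, map_mul, LinearMap.smul_apply,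
    Module.End.mul_apply, hv a, map_smul, smul_smul, ← qpow_add, pair_add_right, add_comm]

end Contract

/-! ### Functionals on the irreducible module -/

theorem irrRep_apply (u : U D) (v : Irr D lam) : irrRep D lam u v = u • v := rfl

/-- The functional `v ↦ hwCoeff (σ(x) v)`: the translate by `x` of the functional `hwCoeff` under
the dual action. -/
def dualOrbit : U D →ₗ[QField] Module.Dual QField (Irr D lam) where
  toFun x := hwCoeff D lam ∘ₗ irrRep D lam (antipode D x).unop
  map_add' x y := by rw [antipode_add, map_add, LinearMap.comp_add]
  map_smul' c x := by rw [antipode_smul, map_smul, LinearMap.comp_smul]; rfl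

theorem dualOrbit_apply (x : U D) (v : Irr D lam) :
    dualOrbit D lam x v = hwCoeff D lam ((antipode D x).unop • v) := rfl

theorem dualOrbit_one : dualOrbit D lam 1 = hwCoeff D lam := by
  refine LinearMap.ext fun v => ?_
  rw [dualOrbit_apply, map_one, MulOpposite.unop_one, one_smul]

theorem dualOrbit_mul (x y : U D) :
    dualOrbit D lam (x * y) = dualOrbit D lam y ∘ₗ irrRep D lam (antipode D x).unop := by
  refine LinearMap.ext fun v => ?_
  rw [LinearMap.comp_apply, dualOrbit_apply, dualOrbit_apply, antipode_mul, ← smul_smul,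
    irrRep_apply]

theorem dualOrbit_smul_hwVec (x y : U D) :
    dualOrbit D lam x (y • hwVec D lam) = pairing D lam x y := by
  rw [dualOrbit_apply, smul_smul, hwCoeff_smul_hwVec, pairing_eq]

theorem wordWt_reverse (w : List (Fin r)) : wordWt w.reverse = wordWt w := by
  ext i; simp [wordWt]

theorem antipode_eWord (w : List (Fin r)) : ∃ (c : QField) (a : Fin r → ℤ), c ≠ 0 ∧
    (antipode D (eWord D w)).unop = c • (U.K D a * eWord D w.reverse) := by
  induction w with
  | nil =>
    refine ⟨1, 0, one_ne_zero, ?_⟩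
    rw [eWord_nil, map_one, MulOpposite.unop_one, (U.qrel D).K_zero, List.reverse_nil, eWord_nil,
      mul_one, one_smul]
  | cons i w ih =>
    obtain ⟨c, a, hc, h⟩ := ih
    have hK : eWord D w.reverse * U.K D (-D.kExp i) =
        qpow (-D.pair (-D.kExp i) (wordWt w.reverse)) •
          (U.K D (-D.kExp i) * eWord D w.reverse) := by
      rw [K_mul_eWord, smul_smul, mul_comm, qpow_mul_neg, one_smul]
    refine ⟨-(c * qpow (-D.pair (-D.kExp i) (wordWt w.reverse))), a + -D.kExp i,
      neg_ne_zero.mpr (mul_ne_zero hc (qpow_ne_zero _)), ?_⟩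
    rw [eWord_cons, antipode_mul, h, antipode_e, mul_neg, smul_mul_assoc, mul_assoc,
      ← mul_assoc (eWord D w.reverse), hK, List.reverse_cons, eWord_append, eWord_cons, eWord_nil,
      mul_one, (U.qrel D).K_add, neg_smul, mul_smul, smul_mul_assoc, mul_smul_comm, mul_assoc,
      mul_assoc]

theorem hwCoeff_eWord_K_smul (w : List (Fin r)) (a : Fin r → ℤ) (v : Irr D lam) :
    hwCoeff D lam (eWord D w • U.K D a • v) =
      qpow (D.pair a lam - D.pair a (wordWt w)) * hwCoeff D lam (eWord D w • v) := by
  have h : eWord D w * U.K D a = qpow (-D.pair a (wordWt w)) • (U.K D a * eWord D w) := by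
    rw [K_mul_eWord, smul_smul, mul_comm, qpow_mul_neg, one_smul]
  rw [smul_smul, h, smul_assoc, ← smul_smul, map_smul, hwCoeff_K_smul, smul_eq_mul, ← mul_assoc,
    ← qpow_add, neg_add_eq_sub]

theorem dualOrbit_eWord (w : List (Fin r)) : ∃ c : QField, c ≠ 0 ∧ ∀ v,
    dualOrbit D lam (eWord D w) v = c * hwCoeff D lam (eWord D w.reverse • v) := by
  obtain ⟨c, a, hc, h⟩ := antipode_eWord D w
  refine ⟨c * qpow (D.pair a lam), mul_ne_zero hc (qpow_ne_zero _), fun v => ?_⟩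
  rw [dualOrbit_apply, h, smul_assoc, map_smul, ← smul_smul, hwCoeff_K_smul, smul_eq_mul, mul_assoc]

theorem dualOrbit_eWord_K (w : List (Fin r)) (a : Fin r → ℤ) :
    dualOrbit D lam (eWord D w) ∘ₗ irrRep D lam (U.K D a) =
      qpow (D.pair a lam - D.pair a (wordWt w)) • dualOrbit D lam (eWord D w) := by
  obtain ⟨c, -, h⟩ := dualOrbit_eWord D lam w
  refine LinearMap.ext fun v => ?_
  rw [LinearMap.comp_apply, irrRep_apply, LinearMap.smul_apply, h, h, hwCoeff_eWord_K_smul,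
    wordWt_reverse, smul_eq_mul, mul_left_comm]

/-- The functionals `dualOrbit x` with `x ∈ U⁺` separate the points of `L(λ)`. -/
theorem irr_eq_zero_of_dualOrbit {v : Irr D lam} (h : ∀ w, dualOrbit D lam (eWord D w) v = 0) :
    v = 0 := by
  refine irr_eq_zero D lam fun w => ?_
  obtain ⟨c, hc, h2⟩ := dualOrbit_eWord D lam w.reverse
  have h3 := h2 v
  rw [h, List.reverse_reverse] at h3
  exact (mul_eq_zero.mp h3.symm).resolve_left hc

theorem smul_hwVec_eq_zero_of_mem_Kneg {y : U D} (hy : y ∈ Kneg D lam) : y • hwVec D lam = 0 :=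
  irr_eq_zero_of_dualOrbit D lam fun w => by
    rw [dualOrbit_smul_hwVec]; exact hy.2 _ (eWord_mem D w)

theorem mem_Kneg {y : U D} (hy : y ∈ Uneg D) (h : y • hwVec D lam = 0) : y ∈ Kneg D lam :=
  ⟨hy, fun x _ => by rw [← dualOrbit_smul_hwVec, h, map_zero]⟩

theorem exists_Uneg_smul_hwVec (v : Irr D lam) : ∃ y ∈ Uneg D, y • hwVec D lam = v := by
  obtain ⟨u, rfl⟩ := exists_smul_hwVec D lam v
  obtain ⟨y, hy, h⟩ := exists_Uneg_sub_smul_hwVec D lam u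
  refine ⟨y, hy, ?_⟩
  have h2 := (smul_hwVec_eq_zero_iff D lam).mpr (vermaIdeal_le_hwIdeal D lam h)
  rw [sub_smul, sub_eq_zero] at h2
  exact h2.symm

theorem dualOrbit_eq_zero_of_mem_Kpos {x : U D} (hx : x ∈ Kpos D lam) : dualOrbit D lam x = 0 := by
  refine LinearMap.ext fun v => ?_
  obtain ⟨y, hy, rfl⟩ := exists_Uneg_smul_hwVec D lam v
  rw [dualOrbit_smul_hwVec, hx.2 y hy, LinearMap.zero_apply]

theorem mem_Kpos {x : U D} (hx : x ∈ Upos D) (h : dualOrbit D lam x = 0) : x ∈ Kpos D lam :=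
  ⟨hx, fun y _ => by rw [← dualOrbit_smul_hwVec, h, LinearMap.zero_apply]⟩

theorem span_fWord_smul_hwVec :
    Submodule.span QField (Set.range fun w => fWord D w • hwVec D lam) = ⊤ := by
  refine eq_top_iff.mpr fun v _ => ?_
  rw [← sub_add_cancel v (hwCoeff D lam v • hwVec D lam)]
  refine add_mem (Submodule.span_mono (Set.image_subset_range _ _) (sub_hwCoeff_mem D lam v))
    (Submodule.smul_mem _ _ (Submodule.subset_span ⟨[], ?_⟩))
  change fWord D [] • hwVec D lam = _
  rw [fWord_nil, one_smul]

/-- Functionals and vectors of different weights are orthogonal. -/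
theorem dualOrbit_eWord_fWord {w w' : List (Fin r)} (h : w.length ≠ w'.length) :
    dualOrbit D lam (eWord D w) (fWord D w' • hwVec D lam) = 0 := by
  by_contra hne
  refine h (List.Perm.length_eq (List.perm_iff_count.mpr fun i => ?_))
  have h1 := LinearMap.congr_fun (dualOrbit_eWord_K D lam w (Pi.single i 1))
    (fWord D w' • hwVec D lam)
  rw [LinearMap.comp_apply, irrRep_apply, K_smul_fWord_smul, map_smul, LinearMap.smul_apply,
    smul_eq_mul, smul_eq_mul] at h1
  have h2 := qpow_injective (mul_right_cancel₀ hne h1)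
  have h3 : ∀ v : List (Fin r), D.pair (Pi.single i 1) (wordWt v) = D.d i * v.count i := by
    intro v
    rw [CartanDatum.pair, Finset.sum_eq_single i]
    · simp [wordWt]
    · intro j _ hj; simp [hj]
    · simp
  rw [h3, h3] at h2
  have hd : (D.d i : ℚ) ≠ 0 := by exact_mod_cast (D.d_pos i).ne'
  have h4 : (w.count i : ℚ) = w'.count i := mul_left_cancel₀ hd (by linarith)
  exact_mod_cast h4

/-! ### Lower terms and leading coefficients -/

theorem contract_hwCoeff_lowerTerms {t : Irr D lam ⊗[QField] CoordRing D}
    (ht : t ∈ lowerTerms D lam) : contract (W := CoordRing D) (hwCoeff D lam) t = 0 := by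
  suffices h : lowerTerms D lam ≤
    LinearMap.ker (contract (W := CoordRing D) (hwCoeff D lam)) from h ht
  refine iSup₂_le fun β hβ => ?_
  rintro _ ⟨s, rfl⟩
  rw [LinearMap.mem_ker]
  induction s using TensorProduct.induction_on with
  | zero => simp
  | tmul v f =>
    rw [LinearMap.rTensor_tmul, contract_tmul]
    obtain ⟨v, hv⟩ := v
    obtain ⟨i, hi⟩ := Function.ne_iff.mp hβ
    have h1 : U.K D (Pi.single i 1) • v = _ := hv (Pi.single i 1)
    have h2 := congrArg (hwCoeff D lam) h1
    have h3 : ∀ ν : Fin r → ℚ, D.pair (Pi.single i 1) ν = D.d i * ν i := by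
      intro ν
      rw [CartanDatum.pair, Finset.sum_eq_single i]
      · simp
      · intro j _ hj; simp [hj]
      · simp
    rw [hwCoeff_K_smul, map_smul, smul_eq_mul, h3, h3] at h2
    have h4 : hwCoeff D lam v = 0 := by
      by_contra hne
      have h5 := qpow_injective (mul_right_cancel₀ hne h2)
      have hd : (D.d i : ℚ) ≠ 0 := by exact_mod_cast (D.d_pos i).ne'
      have h6 : (β i : ℚ) = 0 := by linarith [mul_left_cancel₀ hd h5]
      exact hi (by exact_mod_cast h6)
    rw [Submodule.subtype_apply, h4, zero_smul]
  | add x y hx hy => rw [map_add, map_add, hx, hy, add_zero]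

theorem sub_contract_mem_lowerTerms (t : Irr D lam ⊗[QField] CoordRing D) :
    t - hwVec D lam ⊗ₜ[QField] contract (W := CoordRing D) (hwCoeff D lam) t ∈
      lowerTerms D lam := by
  induction t using TensorProduct.induction_on with
  | zero => simp
  | tmul v f =>
    rw [contract_tmul, TensorProduct.tmul_smul, TensorProduct.smul_tmul', ← TensorProduct.sub_tmul]
    have h : Submodule.span QField ((fun w => fWord D w • hwVec D lam) '' {w | w ≠ []}) ≤
        (lowerTerms D lam).comap ((TensorProduct.mk QField (Irr D lam) (CoordRing D)).flip f) := by
      refine Submodule.span_le.mpr ?_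
      rintro _ ⟨w, hw, rfl⟩
      have hβ : (fun i => w.count i) ≠ 0 := by
        obtain ⟨i, w, rfl⟩ := List.exists_cons_of_ne_nil hw
        exact fun h => by simpa using congrFun h i
      have hmem : fWord D w • hwVec D lam ∈
          weightSpace (irrRep D lam) (fun i => lam i - (w.count i : ℕ)) := by
        intro a
        rw [irrRep_apply, K_smul_fWord_smul, ← pair_sub]
        rfl
      refine Submodule.mem_iSup_of_mem (fun i => w.count i) (Submodule.mem_iSup_of_mem hβ ?_)
      exact ⟨⟨_, hmem⟩ ⊗ₜ f, rfl⟩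
    exact h (sub_hwCoeff_mem D lam v)
  | add x y hx hy =>
    rw [map_add, TensorProduct.tmul_add, add_sub_add_comm]
    exact add_mem hx hy

theorem isLeadingCoeff_iff (φ : HomU D lam) (f : CoordRing D) :
    IsLeadingCoeff D lam φ f ↔
      f = contract (W := CoordRing D) (hwCoeff D lam) (φ.1 (hwVec D lam)) := by
  constructor
  · intro h
    have h2 := contract_hwCoeff_lowerTerms D lam h
    rw [map_sub, contract_tmul, hwCoeff_hwVec, one_smul, sub_eq_zero] at h2
    exact h2.symm
  · rintro rfl
    exact sub_contract_mem_lowerTerms D lam _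

/-! ### Local nilpotency of the coordinate ring -/

variable {D} in
theorem exists_map_eWord_eq_zero {V : Type*} [AddCommGroup V] [Module QField V]
    [FiniteDimensional QField V] {ρ : U D →ₐ[QField] Module.End QField V} (hρ : IsAdmissible ρ) :
    ∃ N : ℕ, ∀ w : List (Fin r), N < w.length → ρ (eWord D w) = 0 := by
  have hfin : {μ | weightSpace ρ μ ≠ ⊥}.Finite :=
    WellFoundedGT.finite_ne_bot_of_iSupIndep hρ.1.submodule_iSupIndep
  obtain ⟨B, hB⟩ := ((hfin.prod hfin).image fun p => D.pair 1 p.2 - D.pair 1 p.1).bddAbove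
  obtain ⟨N, hN⟩ := exists_nat_gt B
  refine ⟨N, fun w hw => ?_⟩
  rw [← LinearMap.ker_eq_top, eq_top_iff, ← hρ.1.submodule_iSup_eq_top]
  refine iSup_le fun μ v hv => ?_
  rw [LinearMap.mem_ker]
  by_contra hne
  -- Otherwise both `μ` and `μ + wordWt w` are weights, too far apart.
  have h1 : weightSpace ρ μ ≠ ⊥ := fun h => hne (by
    rw [(Submodule.mem_bot QField).mp (h.le hv), map_zero])
  have h2 : weightSpace ρ (μ + wordWt w) ≠ ⊥ := fun h => hne
    ((Submodule.mem_bot QField).mp (h.le (map_eWord_mem_weightSpace ρ hv w)))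
  have h3 := hB ⟨(μ, μ + wordWt w), ⟨h1, h2⟩, rfl⟩
  simp only [pair_add_right, add_sub_cancel_left] at h3
  have h4 := length_le_pair_one D w
  have h5 : (N : ℚ) < w.length := by exact_mod_cast hw
  linarith

theorem exists_coordRep_eWord_eq_zero (f : CoordRing D) :
    ∃ N : ℕ, ∀ w : List (Fin r), N < w.length → coordRep D (eWord D w) f = 0 := by
  obtain ⟨f, hf⟩ := f
  suffices h : ∃ N : ℕ, ∀ w : List (Fin r), N < w.length → ∀ x, f (x * eWord D w) = 0 by
    obtain ⟨N, hN⟩ := h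
    exact ⟨N, fun w hw => Subtype.ext (LinearMap.ext fun x => hN w hw x)⟩
  induction hf using Submodule.span_induction with
  | mem c hc =>
    obtain ⟨n, ρ, v, ξ, hρ, h⟩ := hc
    obtain ⟨N, hN⟩ := exists_map_eWord_eq_zero hρ
    refine ⟨N, fun w hw x => ?_⟩
    rw [h, map_mul, hN w hw, mul_zero, LinearMap.zero_apply, map_zero]
  | zero => exact ⟨0, fun _ _ _ => rfl⟩
  | add f g _ _ hf hg =>
    obtain ⟨N, hN⟩ := hf
    obtain ⟨N', hN'⟩ := hg
    refine ⟨max N N', fun w hw x => ?_⟩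
    rw [LinearMap.add_apply, hN w ((le_max_left _ _).trans_lt hw),
      hN' w ((le_max_right _ _).trans_lt hw), add_zero]
  | smul c f _ hf =>
    obtain ⟨N, hN⟩ := hf
    exact ⟨N, fun w hw x => by rw [LinearMap.smul_apply, hN w hw, smul_zero]⟩

/-! ### Singular vectors in the tensor product -/

section Singular

variable {D} {M : Type*} [AddCommMonoid M] [Module QField M]
  (τ : U D →ₐ[QField] Module.End QField M)

/-- The contractions of a singular vector are determined by the one with `hwCoeff`. -/
theorem contract_dualOrbit_of_singular {t : Irr D lam ⊗[QField] M}
    (ht : ∀ i, tensorRep (irrRep D lam) τ (U.e D i) t = 0) {x : U D} (hx : x ∈ Upos D) :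
    contract (dualOrbit D lam x) t = τ x (contract (hwCoeff D lam) t) := by
  have hx' : x ∈ Submodule.span QField (Set.range (eWord D)) := by
    rw [← Upos_eq_span]; exact hx
  clear hx
  induction hx' using Submodule.span_induction with
  | mem x h =>
    obtain ⟨w, rfl⟩ := h
    induction w with
    | nil => rw [eWord_nil, dualOrbit_one, map_one, Module.End.one_apply]
    | cons i w ih =>
      have h1 := (tensorRep_e_eq_zero_iff (irrRep D lam) τ i t).mp (ht i)
      have h2 := contract_map (dualOrbit D lam (eWord D w))
        (irrRep D lam (antipode D (U.e D i)).unop)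
        (1 : Module.End QField M) t
      have h3 := contract_map (dualOrbit D lam (eWord D w)) (1 : Module.End QField (Irr D lam))
        (τ (U.e D i)) t
      rw [eWord_cons, dualOrbit_mul, map_mul, Module.End.mul_apply, ← ih]
      rw [h1, h3, Module.End.one_apply] at h2
      exact h2.symm
  | zero => rw [map_zero, map_zero, contract_zero, LinearMap.zero_apply]
  | add x y _ _ hx hy => rw [map_add, map_add, contract_add, LinearMap.add_apply, hx, hy]
  | smul c x _ hx => rw [map_smul, map_smul, contract_smul, LinearMap.smul_apply, hx]

/-- Singular vectors are determined by their leading coefficients. -/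
theorem eq_of_singular {t t' : Irr D lam ⊗[QField] M}
    (ht : ∀ i, tensorRep (irrRep D lam) τ (U.e D i) t = 0)
    (ht' : ∀ i, tensorRep (irrRep D lam) τ (U.e D i) t' = 0)
    (h : contract (hwCoeff D lam) t = contract (hwCoeff D lam) t') : t = t' := by
  let := Module.addCommMonoidToAddCommGroup QField (M := M)
  rw [← sub_eq_zero]
  refine eq_zero_of_contract (fun w => dualOrbit D lam (eWord D w))
    (fun v => irr_eq_zero_of_dualOrbit D lam) fun w => ?_
  rw [map_sub, contract_dualOrbit_of_singular lam τ ht (eWord_mem D w),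
    contract_dualOrbit_of_singular lam τ ht' (eWord_mem D w), h, sub_self]

theorem contract_hwCoeff_Uneg {y : U D} (hy : y ∈ Uneg D) (t : Irr D lam ⊗[QField] M) :
    contract (hwCoeff D lam) (tensorRep (irrRep D lam) τ y t) =
      τ y (contract (hwCoeff D lam) t) := by
  induction hy using Algebra.adjoin_induction generalizing t with
  | mem x hx =>
    obtain ⟨i, rfl⟩ := hx
    have h : hwCoeff D lam ∘ₗ irrRep D lam (U.f D i) = 0 :=
      LinearMap.ext fun v => hwCoeff_f_smul D lam i v
    rw [tensorRep_f, LinearMap.add_apply, map_add, contract_map, contract_map, h, contract_zero,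
      map_zero, zero_add, map_one]
    rfl
  | algebraMap c =>
    rw [AlgHom.commutes, AlgHom.commutes, Algebra.algebraMap_eq_smul_one,
      Algebra.algebraMap_eq_smul_one, LinearMap.smul_apply, map_smul]
    rfl
  | add x y _ _ hx hy =>
    rw [map_add, LinearMap.add_apply, map_add, hx, hy, map_add, LinearMap.add_apply]
  | mul x y _ _ hx hy =>
    rw [map_mul, Module.End.mul_apply, hx, hy, map_mul, Module.End.mul_apply]

theorem contract_hwCoeff_K (a : Fin r → ℤ) (t : Irr D lam ⊗[QField] M) :
    contract (hwCoeff D lam) (tensorRep (irrRep D lam) τ (U.K D a) t) =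
      qpow (D.pair a lam) • τ (U.K D a) (contract (hwCoeff D lam) t) := by
  have h : hwCoeff D lam ∘ₗ irrRep D lam (U.K D a) = qpow (D.pair a lam) • hwCoeff D lam :=
    LinearMap.ext fun v => hwCoeff_K_smul D lam a v
  rw [tensorRep_K, contract_map, h, contract_smul, map_smul]

/-- A vector all of whose translates have leading coefficient zero vanishes. -/
theorem eq_zero_of_contract_tensorRep {t : Irr D lam ⊗[QField] M}
    (h : ∀ u, contract (hwCoeff D lam) (tensorRep (irrRep D lam) τ u t) = 0) : t = 0 := by
  have key : ∀ (w : List (Fin r)) (u : U D),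
      contract (hwCoeff D lam ∘ₗ irrRep D lam (eWord D w))
        (tensorRep (irrRep D lam) τ u t) = 0 := by
    intro w
    induction w using List.reverseRecOn with
    | nil => intro u; rw [eWord_nil, map_one]; exact h u
    | append_singleton w i ih =>
      intro u
      have h1 := ih (U.e D i * u)
      have h2 := ih u
      rw [map_mul, Module.End.mul_apply] at h1
      generalize tensorRep (irrRep D lam) τ u t = s at *
      have hK : (hwCoeff D lam ∘ₗ irrRep D lam (eWord D w)) ∘ₗ irrRep D lam (U.K D (D.kExp i)) =
          qpow (D.pair (D.kExp i) lam - D.pair (D.kExp i) (wordWt w)) •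
            (hwCoeff D lam ∘ₗ irrRep D lam (eWord D w)) :=
        LinearMap.ext fun v => hwCoeff_eWord_K_smul D lam w _ v
      rw [tensorRep_e, LinearMap.add_apply, map_add, contract_map, contract_map, hK, contract_smul,
        h2, smul_zero, map_zero, add_zero, map_one] at h1
      rw [eWord_append, eWord_cons, eWord_nil, mul_one, map_mul]
      exact h1
  refine eq_zero_of_contract (fun w => hwCoeff D lam ∘ₗ irrRep D lam (eWord D w))
    (fun v hv => irr_eq_zero D lam hv) fun w => ?_
  have := key w 1
  rwa [map_one, Module.End.one_apply] at this

/-- A functional of the form `dualOrbit x` with `x` a combination of short words can be prescribed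
on the vectors of `L(λ)` of small height. This is the finite-dimensional duality between the
truncations of `U⁺ / K̃_λ` and `L(λ)`. -/
theorem exists_dualOrbit_eq (D : CartanDatum r) (lam : Fin r → ℚ) (N : ℕ)
    (L : Submodule QField (Irr D lam))
    (hL : L = Submodule.span QField ((fun w => fWord D w • hwVec D lam) '' {w | w.length ≤ N}))
    [FiniteDimensional QField L] (ξ : Module.Dual QField L) :
    ∃ x ∈ Submodule.span QField (eWord D '' {w | w.length ≤ N}),
      ∀ v : L, dualOrbit D lam x v = ξ v := by
  let R : U D →ₗ[QField] Module.Dual QField L := L.subtype.dualMap ∘ₗ dualOrbit D lam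
  let S := (Submodule.span QField (eWord D '' {w | w.length ≤ N})).map R
  have hS : S = ⊤ := by
    rw [← Subspace.dualCoannihilator_dualAnnihilator_eq (W := S), eq_top_iff]
    intro η _
    rw [Submodule.mem_dualAnnihilator]
    intro v hv
    rw [Submodule.mem_dualCoannihilator] at hv
    suffices h0 : v = 0 by rw [h0, map_zero]
    refine Subtype.ext (irr_eq_zero_of_dualOrbit D lam fun w => ?_)
    by_cases hw : w.length ≤ N
    · exact hv _ (Submodule.mem_map_of_mem (Submodule.subset_span ⟨w, hw, rfl⟩))
    · have h1 : L ≤ LinearMap.ker (dualOrbit D lam (eWord D w)) := by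
        rw [hL]
        refine Submodule.span_le.mpr ?_
        rintro _ ⟨w', hw', rfl⟩
        refine dualOrbit_eWord_fWord D lam fun h => hw ?_
        rw [h]; exact hw'
      exact h1 v.2
  have hξ : ξ ∈ S := by rw [hS]; exact Submodule.mem_top
  obtain ⟨x, hx, h⟩ := hξ
  exact ⟨x, hx, fun v => LinearMap.congr_fun h v⟩

/-- The equations `(x ξ ⊗ id)(t) = x f`, with `ξ = hwCoeff` and `x ∈ U⁺`, are solved by
`t = ∑ v_j ⊗ x_j f` for dual bases `v_j` and `x_j` of the truncations of `L(λ)` and `U⁺ / K̃_λ` to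
words of length at most `N`; the truncation suffices because longer words kill `f`. -/
theorem exists_contract_dualOrbit_eq {f : M} (hf : ∀ x ∈ Kpos D lam, τ x f = 0) {N : ℕ}
    (hN : ∀ w : List (Fin r), N < w.length → τ (eWord D w) f = 0) :
    ∃ t : Irr D lam ⊗[QField] M, ∀ w, contract (dualOrbit D lam (eWord D w)) t =
      τ (eWord D w) f := by
  let := Module.addCommMonoidToAddCommGroup QField (M := M)
  obtain ⟨L, hL⟩ : ∃ L, L = Submodule.span QField
      ((fun w => fWord D w • hwVec D lam) '' {w : List (Fin r) | w.length ≤ N}) := ⟨_, rfl⟩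
  have : FiniteDimensional QField L := by
    rw [hL]
    exact FiniteDimensional.span_of_finite QField ((List.finite_length_le (Fin r) N).image _)
  let b := Module.finBasis QField L
  choose x hx hxb using fun j => exists_dualOrbit_eq D lam N L hL (b.coord j)
  have hspan : Submodule.span QField (eWord D '' {w : List (Fin r) | w.length ≤ N}) ≤
      Subalgebra.toSubmodule (Upos D) := by
    rw [Upos_eq_span]; exact Submodule.span_mono (Set.image_subset_range _ _)
  -- Functionals given by words of length at most `N` vanish on longer vectors.
  have hlong : ∀ w' : List (Fin r), N < w'.length →
      ∀ y ∈ Submodule.span QField (eWord D '' {w : List (Fin r) | w.length ≤ N}),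
        dualOrbit D lam y (fWord D w' • hwVec D lam) = 0 := by
    intro w' hw' y hy
    induction hy using Submodule.span_induction with
    | mem y h =>
      obtain ⟨w, hw, rfl⟩ := h
      exact dualOrbit_eWord_fWord D lam (lt_of_le_of_lt hw hw').ne
    | zero => rw [map_zero, LinearMap.zero_apply]
    | add y z _ _ hy hz => rw [map_add, LinearMap.add_apply, hy, hz, add_zero]
    | smul c y _ hy => rw [map_smul (dualOrbit D lam), LinearMap.smul_apply, hy, smul_zero]
  refine ⟨∑ j, (b j : Irr D lam) ⊗ₜ[QField] τ (x j) f, fun w => ?_⟩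
  rw [map_sum]
  simp only [contract_tmul]
  by_cases hw : w.length ≤ N
  · have hmem : eWord D w - ∑ j, dualOrbit D lam (eWord D w) (b j) • x j ∈
        Submodule.span QField (eWord D '' {w : List (Fin r) | w.length ≤ N}) :=
      sub_mem (Submodule.subset_span ⟨w, hw, rfl⟩)
        (Submodule.sum_mem _ fun j _ => Submodule.smul_mem _ _ (hx j))
    have hzero :
        dualOrbit D lam (eWord D w - ∑ j, dualOrbit D lam (eWord D w) (b j) • x j) = 0 := by
      refine LinearMap.ext_on_range (span_fWord_smul_hwVec D lam) fun w' => ?_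
      rw [LinearMap.zero_apply]
      by_cases hw' : w'.length ≤ N
      · have hv : fWord D w' • hwVec D lam ∈ L := by
          rw [hL]; exact Submodule.subset_span ⟨w', hw', rfl⟩
        have h1 := congrArg (dualOrbit D lam (eWord D w) ∘ₗ L.subtype) (b.sum_repr ⟨_, hv⟩)
        simp only [map_sum, map_smul, LinearMap.comp_apply, Submodule.subtype_apply] at h1
        have h2 : ∀ j, dualOrbit D lam (x j) (fWord D w' • hwVec D lam) =
            b.repr ⟨fWord D w' • hwVec D lam, hv⟩ j := fun j => hxb j ⟨_, hv⟩
        rw [map_sub, map_sum, LinearMap.sub_apply, LinearMap.sum_apply, ← h1, sub_eq_zero]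
        refine Finset.sum_congr rfl fun j _ => ?_
        rw [map_smul (dualOrbit D lam), LinearMap.smul_apply, h2, smul_eq_mul, smul_eq_mul,
          mul_comm]
      · exact hlong w' (not_le.mp hw') _ hmem
    have h3 := hf _ (mem_Kpos D lam (hspan hmem) hzero)
    rw [map_sub, map_sum, LinearMap.sub_apply, LinearMap.sum_apply, sub_eq_zero] at h3
    rw [h3]
    exact Finset.sum_congr rfl fun j _ => by rw [map_smul, LinearMap.smul_apply]
  · have h1 : L ≤ LinearMap.ker (dualOrbit D lam (eWord D w)) := by
      rw [hL]
      refine Submodule.span_le.mpr ?_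
      rintro _ ⟨w', hw', rfl⟩
      refine dualOrbit_eWord_fWord D lam fun h => hw ?_
      rw [h]; exact hw'
    rw [hN w (not_le.mp hw)]
    refine Finset.sum_eq_zero fun j _ => ?_
    rw [show dualOrbit D lam (eWord D w) (b j) = 0 from h1 (b j).2, zero_smul]

/-- A singular vector of weight `λ` with a given leading coefficient of weight zero, killed by
`K̃_λ`. -/
theorem exists_singular {f : M} (h0 : f ∈ weightSpace τ 0) (hf : ∀ x ∈ Kpos D lam, τ x f = 0)
    {N : ℕ} (hN : ∀ w : List (Fin r), N < w.length → τ (eWord D w) f = 0) :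
    ∃ t : Irr D lam ⊗[QField] M, contract (hwCoeff D lam) t = f ∧
      (∀ i, tensorRep (irrRep D lam) τ (U.e D i) t = 0) ∧
      ∀ a, tensorRep (irrRep D lam) τ (U.K D a) t = qpow (D.pair a lam) • t := by
  let := Module.addCommMonoidToAddCommGroup QField (M := M)
  obtain ⟨t, ht⟩ := exists_contract_dualOrbit_eq lam τ hf hN
  refine ⟨t, ?_, fun i => ?_, fun a => ?_⟩
  · have := ht []
    rwa [eWord_nil, dualOrbit_one, map_one, Module.End.one_apply] at this
  · rw [tensorRep_e_eq_zero_iff, ← sub_eq_zero]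
    refine eq_zero_of_contract (fun w => dualOrbit D lam (eWord D w))
      (fun v => irr_eq_zero_of_dualOrbit D lam) fun w => ?_
    have h1 := ht (i :: w)
    rw [eWord_cons, dualOrbit_mul, map_mul, Module.End.mul_apply, ← ht w] at h1
    rw [map_sub, contract_map, contract_map, h1, sub_eq_zero]
    rfl
  · rw [← sub_eq_zero]
    refine eq_zero_of_contract (fun w => dualOrbit D lam (eWord D w))
      (fun v => irr_eq_zero_of_dualOrbit D lam) fun w => ?_
    rw [map_sub, tensorRep_K, contract_map, dualOrbit_eWord_K, contract_smul, map_smul, map_smul,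
      ht, ← Module.End.mul_apply, ← map_mul, K_mul_eWord, map_smul, map_mul, LinearMap.smul_apply,
      Module.End.mul_apply, h0 a, pair_zero_right, qpow_zero, one_smul, smul_smul, ← qpow_add,
      sub_add_cancel, sub_self]

theorem tensorRep_vermaIdeal {t : Irr D lam ⊗[QField] M}
    (he : ∀ i, tensorRep (irrRep D lam) τ (U.e D i) t = 0)
    (hK : ∀ a, tensorRep (irrRep D lam) τ (U.K D a) t = qpow (D.pair a lam) • t)
    {u : U D} (hu : u ∈ vermaIdeal D lam) : tensorRep (irrRep D lam) τ u t = 0 := by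
  induction hu using Submodule.span_induction with
  | mem u hu =>
    rcases hu with ⟨i, rfl⟩ | ⟨a, rfl⟩
    · exact he i
    · change tensorRep (irrRep D lam) τ
        (U.K D a - algebraMap QField (U D) (qpow (D.pair a lam))) t = 0
      rw [map_sub, LinearMap.sub_apply, hK, AlgHom.commutes, Algebra.algebraMap_eq_smul_one,
        LinearMap.smul_apply, Module.End.one_apply, sub_self]
  | zero => rw [map_zero, LinearMap.zero_apply]
  | add u v _ _ hu hv => rw [map_add, LinearMap.add_apply, hu, hv, add_zero]
  | smul a u _ hu => rw [smul_eq_mul, map_mul, Module.End.mul_apply, hu, map_zero]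

/-- A singular vector of weight `λ` is annihilated by the annihilator of the highest weight vector
of `L(λ)` as soon as its leading coefficient is killed by `K_λ`. -/
theorem tensorRep_eq_zero_of_smul_hwVec {t : Irr D lam ⊗[QField] M}
    (he : ∀ i, tensorRep (irrRep D lam) τ (U.e D i) t = 0)
    (hK : ∀ a, tensorRep (irrRep D lam) τ (U.K D a) t = qpow (D.pair a lam) • t)
    (hf : ∀ y ∈ Kneg D lam, τ y (contract (hwCoeff D lam) t) = 0)
    {u : U D} (hu : u • hwVec D lam = 0) : tensorRep (irrRep D lam) τ u t = 0 := by
  have key : ∀ u : U D, u • hwVec D lam = 0 →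
      contract (hwCoeff D lam) (tensorRep (irrRep D lam) τ u t) = 0 := by
    intro u hu
    obtain ⟨y, hy, h⟩ := exists_Uneg_sub_smul_hwVec D lam u
    have h1 := tensorRep_vermaIdeal lam τ he hK h
    have h2 := (smul_hwVec_eq_zero_iff D lam).mpr (vermaIdeal_le_hwIdeal D lam h)
    rw [sub_smul, hu, zero_sub, neg_eq_zero] at h2
    rw [map_sub, LinearMap.sub_apply, sub_eq_zero] at h1
    rw [h1, contract_hwCoeff_Uneg lam τ hy, hf y (mem_Kneg D lam hy h2)]
  refine eq_zero_of_contract_tensorRep lam τ fun v => ?_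
  rw [← Module.End.mul_apply, ← map_mul]
  exact key _ (by rw [← smul_smul, hu, smul_zero])

/-- The operator from `L(λ)` to `L(λ) ⊗ M` with a given leading coefficient: `u 1_λ ↦ u t`, for the
singular vector `t` with that leading coefficient. -/
theorem exists_intertwiner {f : M} (h0 : f ∈ weightSpace τ 0)
    (hneg : ∀ y ∈ Kneg D lam, τ y f = 0) (hpos : ∀ x ∈ Kpos D lam, τ x f = 0)
    {N : ℕ} (hN : ∀ w : List (Fin r), N < w.length → τ (eWord D w) f = 0) :
    ∃ φ : Irr D lam →ₗ[QField] Irr D lam ⊗[QField] M,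
      (∀ (a : U D) v, φ (a • v) = tensorRep (irrRep D lam) τ a (φ v)) ∧
        contract (hwCoeff D lam) (φ (hwVec D lam)) = f := by
  obtain ⟨t, htf, he, hK⟩ := exists_singular lam τ h0 hpos hN
  let g : U D →ₗ[QField] Irr D lam ⊗[QField] M :=
    LinearMap.applyₗ t ∘ₗ (tensorRep (irrRep D lam) τ).toLinearMap
  have hg : ∀ u, g u = tensorRep (irrRep D lam) τ u t := fun u => rfl
  have hann : ∀ u : U D, u • hwVec D lam = 0 → g u = 0 := fun u hu =>
    tensorRep_eq_zero_of_smul_hwVec lam τ he hK (htf ▸ hneg) hu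
  have hφ : ∀ u, descend D lam g hann (u • hwVec D lam) = g u := descend_smul_hwVec D lam g hann
  refine ⟨descend D lam g hann, fun a v => ?_, ?_⟩
  · obtain ⟨u, rfl⟩ := exists_smul_hwVec D lam v
    rw [smul_smul, hφ, hφ, hg, hg, map_mul, Module.End.mul_apply]
  · have := hφ 1
    rw [one_smul, hg, map_one, Module.End.one_apply] at this
    rw [this, htf]

end Singular

/-! ### The leading coefficient map -/

/-- The leading coefficient of an intertwining operator, as an element of `F`. -/
def leadingCoeff : HomU D lam →ₗ[QField] CoordRing D :=
  contract (W := CoordRing D) (hwCoeff D lam) ∘ₗ LinearMap.applyₗ (hwVec D lam) ∘ₗ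
    (HomU D lam).subtype

theorem leadingCoeff_apply (φ : HomU D lam) :
    leadingCoeff D lam φ = contract (W := CoordRing D) (hwCoeff D lam) (φ.1 (hwVec D lam)) := rfl

theorem homU_e (φ : HomU D lam) (i : Fin r) :
    tensorRep (irrRep D lam) (coordRep D) (U.e D i) (φ.1 (hwVec D lam)) = 0 := by
  rw [← φ.2, e_smul_hwVec, map_zero]

theorem leadingCoeff_mem (φ : HomU D lam) : leadingCoeff D lam φ ∈ CoordZero D := by
  intro a
  have h := contract_hwCoeff_K lam (coordRep D) a (φ.1 (hwVec D lam))
  rw [← φ.2, K_smul_hwVec, map_smul, map_smul] at h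
  rw [pair_zero_right, qpow_zero, one_smul, leadingCoeff_apply]
  exact (smul_right_injective _ (qpow_ne_zero _) h).symm

theorem leadingCoeff_injective : Function.Injective (leadingCoeff D lam) := by
  intro φ ψ h
  have h0 : φ.1 (hwVec D lam) = ψ.1 (hwVec D lam) :=
    eq_of_singular lam (coordRep D) (homU_e D lam φ) (homU_e D lam ψ) h
  refine Subtype.ext (LinearMap.ext fun v => ?_)
  obtain ⟨u, rfl⟩ := exists_smul_hwVec D lam v
  rw [φ.2, ψ.2, h0]

theorem coordRep_Kneg_leadingCoeff (φ : HomU D lam) {y : U D} (hy : y ∈ Kneg D lam) :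
    coordRep D y (leadingCoeff D lam φ) = 0 := by
  rw [leadingCoeff_apply, ← contract_hwCoeff_Uneg lam (coordRep D) hy.1, ← φ.2,
    smul_hwVec_eq_zero_of_mem_Kneg D lam hy, map_zero, map_zero]

theorem coordRep_Kpos_leadingCoeff (φ : HomU D lam) {x : U D} (hx : x ∈ Kpos D lam) :
    coordRep D x (leadingCoeff D lam φ) = 0 := by
  rw [leadingCoeff_apply, ← contract_dualOrbit_of_singular lam (coordRep D) (homU_e D lam φ) hx.1,
    dualOrbit_eq_zero_of_mem_Kpos D lam hx, contract_zero]

theorem exists_leadingCoeff_eq {f : CoordRing D} (h0 : f ∈ CoordZero D)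
    (hneg : ∀ y ∈ Kneg D lam, coordRep D y f = 0) (hpos : ∀ x ∈ Kpos D lam, coordRep D x f = 0) :
    ∃ φ, leadingCoeff D lam φ = f := by
  obtain ⟨N, hN⟩ := exists_coordRep_eWord_eq_zero D f
  obtain ⟨φ, hφ, hf⟩ := exists_intertwiner lam (coordRep D) h0 hneg hpos hN
  exact ⟨⟨φ, hφ⟩, hf⟩

end QKostant

end

theorem theorem5 {r : ℕ} (D : QKostant.CartanDatum r) (lam : Fin r → ℚ) :
    QKostant.Kpos D lam = QKostant.theta D '' QKostant.Kneg D lam ∧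
    ∃ Θ : QKostant.HomU D lam →ₗ[QKostant.QField] QKostant.CoordZero D,
      (∀ (φ : QKostant.HomU D lam) (f : QKostant.CoordRing D),
        QKostant.IsLeadingCoeff D lam φ f ↔ f = (Θ φ : QKostant.CoordRing D)) ∧
      Function.Injective Θ ∧
      LinearMap.range Θ = QKostant.coordInvariants D lam := by
  open QKostant in
  refine ⟨Kpos_eq D lam, (leadingCoeff D lam).codRestrict (CoordZero D) (leadingCoeff_mem D lam),
    fun φ f => isLeadingCoeff_iff D lam φ f, fun φ ψ h => ?_, le_antisymm ?_ ?_⟩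
  · exact leadingCoeff_injective D lam (congrArg Subtype.val h)
  · rintro _ ⟨φ, rfl⟩
    exact ⟨fun y hy => coordRep_Kneg_leadingCoeff D lam φ hy,
      fun x hx => coordRep_Kpos_leadingCoeff D lam φ hx⟩
  · rintro ⟨f, h0⟩ ⟨hneg, hpos⟩
    obtain ⟨φ, hφ⟩ := exists_leadingCoeff_eq D lam h0 hneg hpos
    exact ⟨φ, Subtype.ext hφ⟩
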